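/- **Setting.** Let $\Omega\subset\mathbb R^d$ be a bounded open set, $X:=L^2(\Omega,\mathbb R)$, $Y$ a real Hilbert space, and let $V$ be an admissible Hilbert space of vector fields, $V\subset C^p_0(\Omega)$ with $p\ge 1$; that is, every $v\in V$ is a $C^p$ vector field on $\mathbb R^d$ vanishing outside $\Omega$, and $\sup_{x}\|D^k v(x)\|\le C\|v\|_V$ for all $k\le p$ and all $v\in V$, with a constant $C$. For $\boldsymbol\nu\in L^2([0,1],V)$ let $\varphi^{\boldsymbol\nu}_{0,t}$, $t\in[0,1]$, be its flow, i.e. the unique absolutely continuous solution of $\frac{d}{dt}\varphi_{0,t}(x)=\boldsymbol\nu(t,\varphi_{0,t}(x))$, $\varphi_{0,0}(x)=x$. For a fixed $I_0\in X$ and $\zeta\in L^2([0,1],X)$ let $f^{\boldsymbol\nu,\zeta}_t\in X$ be given by $f_t^{\boldsymbol\nu,\zeta}=I_0+\int_0^t\zeta(s,\cdot)\circ\varphi^{\boldsymbol\nu}_{0,s}\,ds$, i.e. $\frac{d}{dt}f_t(x)=\zeta(t,\varphi^{\boldsymbol\nu}_{0,t}(x))$, $f_0=I_0$. Set $$W(\boldsymbol\nu,\zeta):=f_1^{\boldsymbol\nu,\zeta}\circ(\varphi^{\boldsymbol\nu}_{0,1})^{-1}\in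 X .$$ Let $\mathcal T:X\to Y$ be weakly sequentially continuous ($f_n\rightharpoonup f$ implies $\mathcal T(f_n)\rightharpoonup\mathcal T(f)$; for example, $\mathcal T$ bounded and linear). Let $\mathcal D:Y\times Y\to[0,\infty)$ be a data discrepancy such that $\mathcal D(y,h)=0$ implies $y=h$, and $\mathcal D(y,h)\le\liminf_n\mathcal D(y_n,h_n)$ whenever $y_n\rightharpoonup y$ weakly and $h_n\to h$ in norm (for example, $\mathcal D(y,h)=\|y-h\|^2$). For $\gamma,\tau>0$ and $h\in Y$ put $$\mathcal J_{\gamma,\tau}(\boldsymbol\nu,\zeta;h):=\frac\gamma2\int_0^1\|\boldsymbol\nu(t)\|_V^2\,dt+\frac\tau2\int_0^1\|\zeta(t)\|_X^2\,dt+\mathcal D\bigl(\mathcal T(W(\boldsymbol\nu,\zeta)),h\bigr).$$ **Proposition (Convergence).** Let $g\in Y$ be such that $\mathcal T(W(\boldsymbol\nu,\zeta))=g$ for some $(\boldsymbol\nu,\zeta)\in L^2([0,1],V)\times L^2([0,1],X)$, and assume that $\mathcal D(g,h)=O(\|h-g\|^2)$ as $h\to g$. Let $\gamma,\tau:(0,\infty)\to(0,\infty)$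 be parameter choice rules and, for every $\delta>0$, let $e_\delta\in Y$ with $\|e_\delta\|=\delta$ and $$(\boldsymbol\nu_\delta,\zeta_\delta)\in\operatorname*{arg\,min}_{(\boldsymbol\nu,\zeta)\in L^2([0,1],V)\times L^2([0,1],X)}\mathcal J_{\gamma(\delta),\tau(\delta)}(\boldsymbol\nu,\zeta;g+e_\delta).$$ Assume that $\delta\mapsto\gamma(\delta)/\tau(\delta)$ and $\delta\mapsto\tau(\delta)/\gamma(\delta)$ are bounded and that $$\lim_{\delta\to0}\gamma(\delta)=\lim_{\delta\to0}\tau(\delta)=\lim_{\delta\to0}\frac{\delta^2}{\gamma(\delta)}=\lim_{\delta\to0}\frac{\delta^2}{\tau(\delta)}=0 .$$ Then for any sequence $\delta_k\to0$ with $\delta_k>0$ there is a subsequence $(\delta_{k'})$ such that $(\boldsymbol\nu_{\delta_{k'}},\zeta_{\delta_{k'}})$ converges weakly in $L^2([0,1],V)\times L^2([0,1],X)$ to some $(\boldsymbol\nu^*,\zeta^*)$ with $\mathcal T(W(\boldsymbol\nu^*,\zeta^*))=g$. -/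

import Mathlib

open MeasureTheory Filter Topology Set

noncomputable section

namespace Metamorphosis

/-- Points of `ℝ^d`, with the Euclidean norm. -/
abbrev Pt (d : ℕ) : Type := EuclideanSpace ℝ (Fin d)

/-- Grey scale images `X = L²(Ω, ℝ)`. -/
abbrev ImageSpace {d : ℕ} (Ω : Set (Pt d)) : Type :=
  Lp ℝ 2 ((volume : Measure (Pt d)).restrict Ω)

/-- The Bochner space `L²([0,1], H)`, with norm `(∫₀¹ ‖u(t)‖² dt)^(1/2)`. -/
abbrev L2Time (H : Type*) [NormedAddCommGroup H] : Type _ :=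
  Lp H 2 ((volume : Measure ℝ).restrict (Icc (0 : ℝ) 1))

/-- Weak convergence of a sequence in a normed space. -/
def WeaklyTendsto {H : Type*} [NormedAddCommGroup H] [NormedSpace ℝ H]
    (u : ℕ → H) (x : H) : Prop :=
  Tendsto (fun n => toWeakSpace ℝ H (u n)) atTop (𝓝 (toWeakSpace ℝ H x))

/-- The Hilbert space `V`, each element `v` of which is identified with the vector field `ι v` on
`ℝ^d`, is an admissible space of vector fields contained in `C^p_0(Ω)`: its elements are `C^p`
vector fields on `ℝ^d` vanishing outside `Ω`, and the `C^p` norm is bounded by a multiple of the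
norm of `V`. -/
structure IsAdmissible {d : ℕ} {V : Type*} [NormedAddCommGroup V] [InnerProductSpace ℝ V]
    (p : ℕ) (Ω : Set (Pt d)) (ι : V →ₗ[ℝ] (Pt d → Pt d)) : Prop where
  injective : Function.Injective ι
  contDiff : ∀ v, ContDiff ℝ p (ι v)
  eq_zero_of_notMem : ∀ v, ∀ x ∉ Ω, ι v x = 0
  norm_le : ∃ C : ℝ, ∀ v, ∀ k ≤ p, ∀ x, ‖iteratedFDeriv ℝ k (ι v) x‖ ≤ C * ‖v‖

section

variable {d : ℕ} {V : Type*} [NormedAddCommGroup V] [InnerProductSpace ℝ V]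

/-- `φ` is an absolutely continuous solution on `[0,1]` of the flow equation
`d/dt φ(t,x) = v(t, φ(t,x))`, `φ(0,x) = x`, for every `x`, in integrated form. -/
def IsFlow (ι : V →ₗ[ℝ] (Pt d → Pt d)) (v : L2Time V) (φ : ℝ → Pt d → Pt d) : Prop :=
  ∀ x, ContinuousOn (fun t => φ t x) (Icc 0 1) ∧
    IntervalIntegrable (fun s => ι (v s) (φ s x)) volume 0 1 ∧
    ∀ t ∈ Icc (0 : ℝ) 1, φ t x = x + ∫ s in (0 : ℝ)..t, ι (v s) (φ s x)

/-- The flow of `v`: the (unique) solution of the flow equation. Its value at time `t ∈ [0,1]` is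
the diffeomorphism `φ_{0,t}`. -/
def flow (ι : V →ₗ[ℝ] (Pt d → Pt d)) (v : L2Time V) : ℝ → Pt d → Pt d :=
  Classical.epsilon (IsFlow ι v)

open Classical in
/-- The image `f ∘ ψ ∈ L²(Ω)`, for `f ∈ L²(Ω)` and a map `ψ` (here always a
`C¹` diffeomorphism of `ℝ^d` that maps `Ω` onto `Ω`, so that `f ∘ ψ` is again in `L²(Ω)` and does
not depend on the representative of `f`). -/
def compImage {Ω : Set (Pt d)} (f : ImageSpace Ω) (ψ : Pt d → Pt d) : ImageSpace Ω :=
  if h : MemLp (fun x => f (ψ x)) 2 ((volume : Measure (Pt d)).restrict Ω) then h.toLp _ else 0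

/-- The geometric group action `(φ, f) ↦ f ∘ φ⁻¹`. -/
def deform {Ω : Set (Pt d)} (φ : Pt d → Pt d) (f : ImageSpace Ω) : ImageSpace Ω :=
  compImage f (Function.invFun φ)

/-- The template part `f_t` of the metamorphosis: the solution in `L²(Ω)` of
`d/dt f_t(x) = ζ(t, φ_{0,t}(x))`, `f_0 = I₀`, that is, `f_t = I₀ + ∫₀ᵗ ζ(s) ∘ φ_{0,s} ds`. -/
def template (ι : V →ₗ[ℝ] (Pt d → Pt d)) {Ω : Set (Pt d)} (I₀ : ImageSpace Ω)
    (v : L2Time V) (ζ : L2Time (ImageSpace Ω)) (t : ℝ) : ImageSpace Ω :=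
  I₀ + ∫ s in (0 : ℝ)..t, compImage (ζ s) (flow ι v s)

/-- The final registered template `f_1 ∘ (φ_{0,1})⁻¹`. -/
def registered (ι : V →ₗ[ℝ] (Pt d → Pt d)) {Ω : Set (Pt d)} (I₀ : ImageSpace Ω)
    (v : L2Time V) (ζ : L2Time (ImageSpace Ω)) : ImageSpace Ω :=
  deform (flow ι v 1) (template ι I₀ v ζ 1)

/-- The objective functional
`γ/2 ‖v‖₂² + τ/2 ‖ζ‖₂² + D (T (f_1 ∘ (φ_{0,1})⁻¹), g)`. -/
def objective {Y : Type*} (ι : V →ₗ[ℝ] (Pt d → Pt d)) {Ω : Set (Pt d)} (I₀ : ImageSpace Ω)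
    (T : ImageSpace Ω → Y) (D : Y → Y → ℝ) (γ τ : ℝ) (g : Y)
    (q : L2Time V × L2Time (ImageSpace Ω)) : ℝ :=
  γ / 2 * ‖q.1‖ ^ 2 + τ / 2 * ‖q.2‖ ^ 2 + D (T (registered ι I₀ q.1 q.2)) g

end

end Metamorphosis

end

/-! The outer argument is the classical one for Tikhonov regularisation. Comparing a minimiser with
a pair `(v₁, ζ₁)` that attains the exact data bounds the objective by `γ/2 ‖v₁‖² + τ/2 ‖ζ₁‖² +
O(δ²)`. Dividing by `γ` or by `τ` bounds both components uniformly, so weak limits exist along a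
subsequence, and the discrepancy tends to zero. Lower semicontinuity and definiteness of `D` then
identify the data of the limit, provided that the registered template passes to weak limits.

That weak continuity (`IsC1Bounded.exists_subseq_weaklyTendsto_registered`) is the substance of the
proof. Weak convergence of fields gives pointwise convergence of flows (`IsC1Bounded.tendsto_flow`),
by Grönwall's inequality around the limit trajectory. The sources `ζ n` converge only weakly and are
composed with varying flows, so the composition is moved to the test image: the adjoint of `f ↦ f ∘
φ` is `g ↦ (g / |det Dφ|) ∘ φ⁻¹`. The adjoint images must converge strongly in `L²([0,1], X)`, and
for this the Jacobians must converge almost everywhere.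

With `p = 1` the derivatives of fields in the unit ball of `V` need not share a modulus of
continuity, so the variational equation cannot be compared directly along two different
trajectories. Instead, the Riesz representatives `κ x` of the entries of `w ↦ Dw(x)` form a bounded
strongly measurable map into a finite power of `V`, with `‖Dw(x) - Dw(y)‖ ≤ d² ‖κ x - κ y‖ ‖w‖`.
Composition with the flows is strongly continuous on `L²(Ω)` functions even when they are
discontinuous (`tendsto_eLpNorm_comp_sub`); hence `κ ∘ φ_n → κ ∘ φ` in `L²`, and a subsequence
converges for almost every starting point. Grönwall's inequality for the variational equation
finishes (`IsC1Bounded.exists_subseq_tendsto_fderiv_flow`). -/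

noncomputable section

namespace Metamorphosis

/-! ### Weak convergence and weak measurability in Hilbert spaces. -/

section WeakConvergence

variable {H : Type*} [NormedAddCommGroup H] [InnerProductSpace ℝ H]

theorem weaklyTendsto_iff_forall_dual {F : Type*} [NormedAddCommGroup F] [NormedSpace ℝ F]
    {u : ℕ → F} {x : F} :
    WeaklyTendsto u x ↔ ∀ f : F →L[ℝ] ℝ, Tendsto (fun n => f (u n)) atTop (𝓝 (f x)) := by
  have hinj : Function.Injective ⇑(topDualPairing ℝ F).flip := by
    intro a b hab
    by_contra hne
    obtain ⟨f, hf⟩ := SeparatingDual.exists_separating_of_ne (R := ℝ) hne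
    exact hf (by simpa using LinearMap.congr_fun hab f)
  exact WeakBilin.tendsto_iff_forall_eval_tendsto _ hinj

theorem WeaklyTendsto.map_clm {F : Type*} [NormedAddCommGroup F] [NormedSpace ℝ F]
    {u : ℕ → F} {x : F} (h : WeaklyTendsto u x) (f : F →L[ℝ] ℝ) :
    Tendsto (fun n => f (u n)) atTop (𝓝 (f x)) :=
  weaklyTendsto_iff_forall_dual.1 h f

theorem WeaklyTendsto.map_clm_finiteDimensional {F E : Type*} [NormedAddCommGroup F]
    [NormedSpace ℝ F] [NormedAddCommGroup E] [NormedSpace ℝ E] [FiniteDimensional ℝ E]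
    {u : ℕ → F} {x : F} (h : WeaklyTendsto u x) (f : F →L[ℝ] E) :
    Tendsto (fun n => f (u n)) atTop (𝓝 (f x)) := by
  set e := (Module.finBasis ℝ E).equivFunL
  have key : Tendsto (fun n => e (f (u n))) atTop (𝓝 (e (f x))) := by
    rw [tendsto_pi_nhds]
    intro i
    exact h.map_clm ((ContinuousLinearMap.proj i).comp (e.toContinuousLinearMap.comp f))
  have := (e.symm.continuous.tendsto (e (f x))).comp key
  simpa [Function.comp_def] using this

theorem WeaklyTendsto.comp_tendsto {F : Type*} [NormedAddCommGroup F] [NormedSpace ℝ F]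
    {u : ℕ → F} {x : F} (h : WeaklyTendsto u x) {n : ℕ → ℕ} (hn : Tendsto n atTop atTop) :
    WeaklyTendsto (fun k => u (n k)) x :=
  Tendsto.comp (f := n) (g := fun k => toWeakSpace ℝ F (u k)) h hn

theorem weaklyTendsto_iff_inner [CompleteSpace H] {u : ℕ → H} {x : H} :
    WeaklyTendsto u x ↔ ∀ w : H, Tendsto (fun n => inner ℝ w (u n)) atTop (𝓝 (inner ℝ w x)) := by
  rw [weaklyTendsto_iff_forall_dual]
  constructor
  · intro h w
    exact h (innerSL ℝ w)
  · intro h f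
    have := h ((InnerProductSpace.toDual ℝ H).symm f)
    simpa using this

/-- The inner product of a bounded weakly convergent and a norm convergent sequence converges. -/
theorem WeaklyTendsto.inner_tendsto {u w : ℕ → H} {x y : H} {R : ℝ} (hu : WeaklyTendsto u x)
    (hR : ∀ n, ‖u n‖ ≤ R) (hw : Tendsto w atTop (𝓝 y)) :
    Tendsto (fun n => inner ℝ (u n) (w n)) atTop (𝓝 (inner ℝ x y)) := by
  have h1 : Tendsto (fun n => inner ℝ (u n) (w n - y)) atTop (𝓝 0) := by
    refine squeeze_zero_norm (a := fun n => R * ‖w n - y‖) (fun n => ?_) ?_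
    · exact (norm_inner_le_norm _ _).trans (mul_le_mul_of_nonneg_right (hR n) (norm_nonneg _))
    · simpa using ((tendsto_iff_norm_sub_tendsto_zero.1 hw).const_mul R)
  have h2 : Tendsto (fun n => inner ℝ (u n) y) atTop (𝓝 (inner ℝ x y)) := by
    simpa [real_inner_comm] using hu.map_clm (innerSL ℝ y)
  simpa [← inner_add_right] using h1.add h2

/-- Bounded sequences in a Hilbert space have weakly convergent subsequences. -/
theorem exists_subseq_weaklyTendsto [CompleteSpace H] {u : ℕ → H} {R : ℝ}
    (hR : ∀ n, ‖u n‖ ≤ R) :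
    ∃ n : ℕ → ℕ, StrictMono n ∧ ∃ x : H, WeaklyTendsto (fun k => u (n k)) x := by
  have hR0 : 0 ≤ R := (norm_nonneg _).trans (hR 0)
  have hcomp : IsCompact (Set.univ.pi fun _ : ℕ => Icc (-(R * R)) (R * R)) :=
    isCompact_univ_pi fun _ => isCompact_Icc
  -- Sequential compactness of a countable product of intervals replaces the diagonal argument: one
  -- subsequence makes the pairings with every `u m` converge.
  obtain ⟨a, -, n, hn, ha⟩ := hcomp.tendsto_subseq (x := fun k m => inner ℝ (u k) (u m)) (by
    intro k m _
    rw [mem_Icc, ← abs_le]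
    exact (abs_real_inner_le_norm _ _).trans
      (mul_le_mul (hR k) (hR m) (norm_nonneg _) hR0))
  rw [tendsto_pi_nhds] at ha
  let S : Submodule ℝ H :=
    { carrier := {w | CauchySeq fun k => inner ℝ (u (n k)) w}
      add_mem' := by
        intro w w' hw hw'
        simpa [inner_add_right] using! CauchySeq.add hw hw'
      zero_mem' := by simpa using cauchySeq_const (0 : ℝ)
      smul_mem' := by
        intro c w hw
        obtain ⟨b, hb⟩ := cauchySeq_tendsto_of_complete hw
        have := (hb.const_mul c).cauchySeq
        simpa [inner_smul_right] using this }
  have hSclosed : IsClosed (S : Set H) := by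
    rw [← closure_subset_iff_isClosed]
    intro w hw
    change CauchySeq _
    rw [Metric.cauchySeq_iff]
    intro ε hε
    obtain ⟨w', hw', hd⟩ := Metric.mem_closure_iff.1 hw (ε / (3 * (R + 1))) (by positivity)
    obtain ⟨N, hN⟩ := Metric.cauchySeq_iff.1 (show CauchySeq _ from hw') (ε / 3) (by positivity)
    have hclose : ∀ k, |(inner ℝ (u (n k)) w : ℝ) - inner ℝ (u (n k)) w'| ≤ ε / 3 := by
      intro k
      rw [← inner_sub_right]
      refine (abs_real_inner_le_norm _ _).trans ?_
      rw [dist_eq_norm] at hd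
      calc ‖u (n k)‖ * ‖w - w'‖ ≤ (R + 1) * (ε / (3 * (R + 1))) :=
            mul_le_mul ((hR _).trans (by linarith)) hd.le (norm_nonneg _) (by linarith)
        _ = ε / 3 := by field_simp
    refine ⟨N, fun i hi j hj => ?_⟩
    have h1 := hN i hi j hj
    rw [Real.dist_eq] at h1 ⊢
    have h2 := abs_le.1 (hclose i)
    have h3 := abs_le.1 (hclose j)
    rw [abs_lt] at h1 ⊢
    constructor <;> linarith [h1.1, h1.2, h2.1, h2.2, h3.1, h3.2]
  have : CompleteSpace S := hSclosed.completeSpace_coe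
  have hSu : ∀ m, u m ∈ S := fun m => (ha m).cauchySeq
  -- `S` is closed and contains every `u m`. A vector orthogonal to `S` has zero pairings with the
  -- sequence, so it lies in `S` too. Separability of `H` is not needed.
  have hStop : ∀ w, w ∈ S := by
    intro w
    have hmem : w ∈ S ⊔ Sᗮ := by rw [Submodule.sup_orthogonal_of_hasOrthogonalProjection]; trivial
    have hle : Sᗮ ≤ S := by
      intro y hy
      have : ∀ k, inner ℝ (u (n k)) y = (0 : ℝ) := fun k => hy _ (hSu _)
      change CauchySeq _
      simpa [this] using cauchySeq_const (0 : ℝ)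
    rwa [sup_eq_left.2 hle] at hmem
  choose l hl using fun w => cauchySeq_tendsto_of_complete (show CauchySeq _ from hStop w)
  let f : H →ₗ[ℝ] ℝ :=
    { toFun := l
      map_add' := by
        intro x y
        refine tendsto_nhds_unique (hl (x + y)) ?_
        simpa [inner_add_right] using (hl x).add (hl y)
      map_smul' := by
        intro c x
        refine tendsto_nhds_unique (hl (c • x)) ?_
        simpa [inner_smul_right] using (hl x).const_mul c }
  let f' : H →L[ℝ] ℝ := f.mkContinuous R (by
    intro w
    refine le_of_tendsto (hl w).norm (Eventually.of_forall fun k => ?_)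
    exact (norm_inner_le_norm _ _).trans (mul_le_mul_of_nonneg_right (hR _) (norm_nonneg _)))
  refine ⟨n, hn, (InnerProductSpace.toDual ℝ H).symm f', weaklyTendsto_iff_inner.2 fun w => ?_⟩
  rw [real_inner_comm, InnerProductSpace.toDual_symm_apply]
  have hfw : f' w = l w := rfl
  rw [hfw]
  simpa [real_inner_comm] using hl w

/-- In a separable Hilbert space, weakly measurable functions are strongly measurable. -/
theorem stronglyMeasurable_of_measurable_inner [CompleteSpace H] [TopologicalSpace.SeparableSpace H]
    {α : Type*} [MeasurableSpace α] {k : α → H}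
    (hk : ∀ w : H, Measurable fun x => (inner ℝ w (k x) : ℝ)) : StronglyMeasurable k := by
  -- Orthogonal projections onto an increasing sequence of finite-dimensional spaces with dense
  -- union: each projection of `k` is a finite sum with measurable coefficients, and the projections
  -- converge pointwise to `k`.
  let U : ℕ → Submodule ℝ H := fun N =>
    Submodule.span ℝ (TopologicalSpace.denseSeq H '' (Finset.range N))
  have hfin : ∀ N, FiniteDimensional ℝ (U N) := fun N =>
    FiniteDimensional.span_of_finite ℝ ((Finset.range N).finite_toSet.image _)
  have hmono : Monotone U := by
    intro a b hab
    exact Submodule.span_mono (image_mono (by simpa using hab))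
  have hdense : (⊤ : Submodule ℝ H) ≤ (⨆ N, U N).topologicalClosure := by
    intro x _
    have hx := TopologicalSpace.denseRange_denseSeq H x
    refine closure_mono ?_ hx
    rintro _ ⟨m, rfl⟩
    refine Submodule.mem_iSup_of_mem (m + 1) (Submodule.subset_span ⟨m, by simp, rfl⟩)
  refine stronglyMeasurable_of_tendsto atTop (f := fun N x => (U N).starProjection (k x))
    (fun N => ?_) (tendsto_pi_nhds.2 fun x => Submodule.starProjection_tendsto_self U hmono _ hdense)
  have hrepr : (fun x => (U N).starProjection (k x)) = fun x =>
      ∑ i, (inner ℝ (stdOrthonormalBasis ℝ (U N) i : H) (k x) : ℝ) •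
        (stdOrthonormalBasis ℝ (U N) i : H) := by
    funext x
    rw [Submodule.starProjection_apply,
      ← (stdOrthonormalBasis ℝ (U N)).sum_repr ((U N).orthogonalProjectionOnto (k x))]
    simp [OrthonormalBasis.repr_apply_apply]
  rw [hrepr]
  exact Finset.stronglyMeasurable_fun_sum _ fun i _ => (hk _).stronglyMeasurable.smul_const _

end WeakConvergence

/-! ### Grönwall inequalities and Carathéodory's theorem with square integrable coefficients. -/

section IntegralEquations

theorem setIntegral_uIoc_exp_le {c t₀ t : ℝ} (hc : 0 < c) :
    ∫ s in uIoc t₀ t, Real.exp (c * |s - t₀|) ≤ Real.exp (c * |t - t₀|) / c := by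
  rcases le_total t₀ t with h | h
  · have hint : ∫ s in t₀..t, Real.exp (c * (s - t₀))
        = Real.exp (c * (t - t₀)) / c - Real.exp (c * (t₀ - t₀)) / c := by
      refine intervalIntegral.integral_eq_sub_of_hasDerivAt
        (f := fun s => Real.exp (c * (s - t₀)) / c) (fun s _ => ?_)
        (Continuous.intervalIntegrable (by fun_prop) _ _)
      have := ((((hasDerivAt_id s).sub_const t₀).const_mul c).exp).div_const c
      simpa [hc.ne'] using this
    rw [uIoc_of_le h, abs_of_nonneg (sub_nonneg.2 h),
      setIntegral_congr_fun (g := fun s => Real.exp (c * (s - t₀))) measurableSet_Ioc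
        (fun s hs => by simp only [abs_of_pos (sub_pos.2 hs.1)]),
      ← intervalIntegral.integral_of_le h, hint]
    simp only [sub_self, mul_zero, Real.exp_zero]
    linarith [one_div_pos.2 hc]
  · have hint : ∫ s in t..t₀, Real.exp (c * (t₀ - s))
        = -(Real.exp (c * (t₀ - t₀)) / c) - -(Real.exp (c * (t₀ - t)) / c) := by
      refine intervalIntegral.integral_eq_sub_of_hasDerivAt
        (f := fun s => -(Real.exp (c * (t₀ - s)) / c)) (fun s _ => ?_)
        (Continuous.intervalIntegrable (by fun_prop) _ _)
      have := (((((hasDerivAt_id s).const_sub t₀).const_mul c).exp).div_const c).neg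
      exact this.congr_deriv (by simp [neg_div, hc.ne'])
    have habs : |t - t₀| = t₀ - t := by rw [abs_sub_comm, abs_of_nonneg (sub_nonneg.2 h)]
    rw [uIoc_of_ge h, habs,
      setIntegral_congr_fun (g := fun s => Real.exp (c * (t₀ - s))) measurableSet_Ioc
        (fun s hs => by simp only [abs_sub_comm s, abs_of_nonneg (sub_nonneg.2 hs.2)]),
      ← intervalIntegral.integral_of_le h, hint]
    simp only [sub_self, mul_zero, Real.exp_zero]
    linarith [one_div_pos.2 hc]

theorem uIoc_subset_Icc_unit {t₀ t : ℝ} (ht₀ : t₀ ∈ Icc (0 : ℝ) 1) (ht : t ∈ Icc (0 : ℝ) 1) :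
    uIoc t₀ t ⊆ Icc (0 : ℝ) 1 :=
  uIoc_subset_uIcc.trans (uIcc_subset_Icc ht₀ ht)

theorem integrableOn_unit_of_memLp {F : Type*} [NormedAddCommGroup F] {L : ℝ → F}
    (hL : MemLp L 2 (volume.restrict (Icc (0 : ℝ) 1))) : IntegrableOn L (Icc (0 : ℝ) 1) :=
  hL.integrable (by norm_num)

theorem integrableOn_mul_of_continuousOn {L z : ℝ → ℝ} (hL : IntegrableOn L (Icc (0 : ℝ) 1))
    (hz : ContinuousOn z (Icc 0 1)) : IntegrableOn (fun s => L s * z s) (Icc (0 : ℝ) 1) :=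
  hL.mul_continuousOn hz isCompact_Icc

/-- The weight that makes Volterra operators with `L²` Lipschitz constant contractive. -/
theorem setIntegral_mul_exp_le {L : ℝ → ℝ} {K : ℝ}
    (hL : MemLp L 2 (volume.restrict (Icc (0 : ℝ) 1)))
    (hK : ∫ s in Icc (0 : ℝ) 1, L s ^ 2 ≤ K ^ 2) {t₀ t : ℝ}
    (ht₀ : t₀ ∈ Icc (0 : ℝ) 1) (ht : t ∈ Icc (0 : ℝ) 1) :
    ∫ s in uIoc t₀ t, L s * Real.exp (2 * (K ^ 2 + 1) * |s - t₀|) ≤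
      1 / 2 * Real.exp (2 * (K ^ 2 + 1) * |t - t₀|) := by
  set c : ℝ := 2 * (K ^ 2 + 1) with hc
  have hc0 : 0 < c := by positivity
  set E : ℝ := Real.exp (c * |t - t₀|) with hE
  have hE0 : 0 < E := Real.exp_pos _
  have hsub := uIoc_subset_Icc_unit ht₀ ht
  have hcont : Continuous fun s => Real.exp (c * |s - t₀|) := by fun_prop
  have hcont2 : Continuous fun s => Real.exp (2 * c * |s - t₀|) := by fun_prop
  have hfin : ∀ g : ℝ → ℝ, Continuous g → IntegrableOn g (uIoc t₀ t) := fun g hg =>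
    (hg.continuousOn.integrableOn_compact isCompact_Icc).mono_set hsub
  have hL2 : IntegrableOn (fun s => L s ^ 2) (Icc (0 : ℝ) 1) := hL.integrable_sq
  have hleft : IntegrableOn (fun s => L s * Real.exp (c * |s - t₀|)) (uIoc t₀ t) :=
    (integrableOn_mul_of_continuousOn (integrableOn_unit_of_memLp hL) hcont.continuousOn).mono_set hsub
  calc ∫ s in uIoc t₀ t, L s * Real.exp (c * |s - t₀|)
      ≤ ∫ s in uIoc t₀ t, (E / c / 2 * L s ^ 2 + c / E / 2 * Real.exp (2 * c * |s - t₀|)) := by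
        refine setIntegral_mono hleft
          (((hL2.mono_set hsub).const_mul _).add ((hfin _ hcont2).const_mul _)) fun s => ?_
        have hsq : Real.exp (2 * c * |s - t₀|) = Real.exp (c * |s - t₀|) ^ 2 := by
          rw [← Real.exp_nat_mul]; congr 1; push_cast; ring
        -- Young's inequality with weight `E / c`. The choice of `c` makes both resulting terms at
        -- most `E / 4`; the `+ 1` in `c` keeps it positive when `K = 0`.
        have h1 : 0 ≤ (E * L s - c * Real.exp (c * |s - t₀|)) ^ 2 := sq_nonneg _
        simp only [hsq]
        rw [← sub_nonneg]
        have : E / c / 2 * L s ^ 2 + c / E / 2 * Real.exp (c * |s - t₀|) ^ 2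
            - L s * Real.exp (c * |s - t₀|)
            = (E * L s - c * Real.exp (c * |s - t₀|)) ^ 2 / (2 * c * E) := by
          field_simp; ring
        rw [this]
        positivity
    _ = E / c / 2 * (∫ s in uIoc t₀ t, L s ^ 2)
          + c / E / 2 * ∫ s in uIoc t₀ t, Real.exp (2 * c * |s - t₀|) := by
        rw [integral_add ((hL2.mono_set hsub).const_mul _) ((hfin _ hcont2).const_mul _),
          integral_const_mul, integral_const_mul]
    _ ≤ E / c / 2 * K ^ 2 + c / E / 2 * (E ^ 2 / (2 * c)) := by
        have h1 : ∫ s in uIoc t₀ t, L s ^ 2 ≤ K ^ 2 :=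
          (setIntegral_mono_set hL2 (Eventually.of_forall fun s => sq_nonneg _)
            hsub.eventuallyLE).trans hK
        have h2 : ∫ s in uIoc t₀ t, Real.exp (2 * c * |s - t₀|) ≤ E ^ 2 / (2 * c) := by
          refine (setIntegral_uIoc_exp_le (by positivity)).trans_eq ?_
          rw [hE, ← Real.exp_nat_mul]; congr 2; push_cast; ring
        gcongr
    _ ≤ 1 / 2 * E := by
        have : E / c / 2 * K ^ 2 + c / E / 2 * (E ^ 2 / (2 * c))
            = E * (K ^ 2 / (2 * c) + 1 / 4) := by field_simp; ring
        rw [this, mul_comm]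
        refine mul_le_mul_of_nonneg_right ?_ hE0.le
        have : K ^ 2 / (2 * c) ≤ 1 / 4 := by
          rw [div_le_iff₀ (by positivity), hc]; linarith
        linarith

/-- The constant of Grönwall's inequality on `[0,1]` for a coefficient whose `L²` norm is at most
`K`. -/
def gronwallConst (K : ℝ) : ℝ := 2 * Real.exp (2 * (K ^ 2 + 1))

theorem gronwallConst_pos (K : ℝ) : 0 < gronwallConst K := by unfold gronwallConst; positivity

/-- Grönwall's inequality in integral form on `[0,1]`, in both time directions. -/
theorem le_gronwallConst_mul {L z : ℝ → ℝ} {K ε : ℝ}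
    (hL : MemLp L 2 (volume.restrict (Icc (0 : ℝ) 1))) (hL0 : ∀ s, 0 ≤ L s)
    (hK : ∫ s in Icc (0 : ℝ) 1, L s ^ 2 ≤ K ^ 2) (hz : ContinuousOn z (Icc 0 1)) (hε : 0 ≤ ε)
    {t₀ : ℝ} (ht₀ : t₀ ∈ Icc (0 : ℝ) 1)
    (h : ∀ t ∈ Icc (0 : ℝ) 1, z t ≤ ε + ∫ s in uIoc t₀ t, L s * z s) {t : ℝ}
    (ht : t ∈ Icc (0 : ℝ) 1) : z t ≤ gronwallConst K * ε := by
  set c : ℝ := 2 * (K ^ 2 + 1) with hc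
  have hc0 : 0 < c := by positivity
  obtain ⟨t₁, ht₁, hmax⟩ := isCompact_Icc.exists_isMaxOn (nonempty_Icc.2 zero_le_one)
    (hz.mul (f := z) (g := fun s => Real.exp (-(c * |s - t₀|)))
      (by fun_prop : Continuous fun s => Real.exp (-(c * |s - t₀|))).continuousOn)
  set m : ℝ := z t₁ * Real.exp (-(c * |t₁ - t₀|)) with hm
  have hle : ∀ s ∈ Icc (0 : ℝ) 1, z s ≤ m * Real.exp (c * |s - t₀|) := by
    intro s hs
    have h1 : z s * Real.exp (-(c * |s - t₀|)) ≤ m := hmax hs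
    calc z s = z s * Real.exp (-(c * |s - t₀|)) * Real.exp (c * |s - t₀|) := by
          rw [mul_assoc, ← Real.exp_add]; simp
      _ ≤ _ := mul_le_mul_of_nonneg_right h1 (Real.exp_pos _).le
  -- At the maximum point of the weighted function the hypothesis reads `m * e ≤ ε + m * e / 2` with
  -- `e ≥ 1`. Arguing by contradiction supplies `m > 0`, which is needed because `z` may be
  -- negative.
  have hm2 : m ≤ 2 * ε := by
    by_contra! hlt
    have hm0 : 0 < m := by linarith
    have hsub := uIoc_subset_Icc_unit ht₀ ht₁
    have hint : ∫ s in uIoc t₀ t₁, L s * z s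
        ≤ m * (1 / 2 * Real.exp (c * |t₁ - t₀|)) := by
      calc ∫ s in uIoc t₀ t₁, L s * z s
          ≤ ∫ s in uIoc t₀ t₁, m * (L s * Real.exp (c * |s - t₀|)) := by
            refine setIntegral_mono_on
              ((integrableOn_mul_of_continuousOn (integrableOn_unit_of_memLp hL) hz).mono_set hsub)
              (((integrableOn_mul_of_continuousOn (integrableOn_unit_of_memLp hL)
                (by fun_prop : Continuous fun s => Real.exp (c * |s - t₀|)).continuousOn).mono_set
                hsub).const_mul m) measurableSet_uIoc fun s hs => ?_
            have := mul_le_mul_of_nonneg_left (hle s (hsub hs)) (hL0 s)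
            linarith
        _ = m * ∫ s in uIoc t₀ t₁, L s * Real.exp (c * |s - t₀|) := integral_const_mul _ _
        _ ≤ _ := mul_le_mul_of_nonneg_left (setIntegral_mul_exp_le hL hK ht₀ ht₁) hm0.le
    have hz1 : z t₁ = m * Real.exp (c * |t₁ - t₀|) := by
      rw [hm, mul_assoc, ← Real.exp_add]; simp
    have h1 := h t₁ ht₁
    have h2 : 1 ≤ Real.exp (c * |t₁ - t₀|) := Real.one_le_exp (by positivity)
    nlinarith
  calc z t ≤ m * Real.exp (c * |t - t₀|) := hle t ht
    _ ≤ (2 * ε) * Real.exp c := by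
        have : |t - t₀| ≤ 1 := by
          rw [abs_le]; constructor <;> linarith [ht.1, ht.2, ht₀.1, ht₀.2]
        have h3 : Real.exp (c * |t - t₀|) ≤ Real.exp c := Real.exp_le_exp.2 (by nlinarith)
        exact mul_le_mul hm2 h3 (Real.exp_pos _).le (by linarith)
    _ = gronwallConst K * ε := by unfold gronwallConst; ring

/-- Grönwall's inequality with a variable perturbation. -/
theorem le_add_gronwallConst_mul {L z ρ : ℝ → ℝ} {K : ℝ}
    (hL : MemLp L 2 (volume.restrict (Icc (0 : ℝ) 1))) (hL0 : ∀ s, 0 ≤ L s)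
    (hK : ∫ s in Icc (0 : ℝ) 1, L s ^ 2 ≤ K ^ 2) (hz : ContinuousOn z (Icc 0 1))
    (hρ : ContinuousOn ρ (Icc 0 1)) (hρ0 : ∀ t, 0 ≤ ρ t)
    (h : ∀ t ∈ Icc (0 : ℝ) 1, z t ≤ ρ t + ∫ s in uIoc 0 t, L s * z s) {t : ℝ}
    (ht : t ∈ Icc (0 : ℝ) 1) :
    z t ≤ ρ t + gronwallConst K * ∫ s in Icc (0 : ℝ) 1, L s * ρ s := by
  have h0 : (0 : ℝ) ∈ Icc (0 : ℝ) 1 := by simp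
  have hLρ := integrableOn_mul_of_continuousOn (integrableOn_unit_of_memLp hL) hρ
  -- The positive part of `z - ρ` satisfies the inequality with a constant perturbation, namely the
  -- integral of `L * ρ`. Thus only an integral of `ρ`, not its supremum, enters the estimate.
  have key : max (z t - ρ t) 0 ≤ gronwallConst K * ∫ s in Icc (0 : ℝ) 1, L s * ρ s := by
    have hyc : ContinuousOn (fun s => max (z s - ρ s) 0) (Icc 0 1) :=
      (hz.sub hρ).sup continuousOn_const
    refine le_gronwallConst_mul (z := fun s => max (z s - ρ s) 0) hL hL0 hK hyc
      (integral_nonneg fun s => mul_nonneg (hL0 s) (hρ0 s)) h0 (fun s hs => ?_) ht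
    have hsub := uIoc_subset_Icc_unit h0 hs
    have hLy := (integrableOn_mul_of_continuousOn (integrableOn_unit_of_memLp hL) hyc).mono_set hsub
    have h1 : ∫ r in uIoc 0 s, L r * z r ≤
        (∫ r in Icc (0 : ℝ) 1, L r * ρ r) + ∫ r in uIoc 0 s, L r * max (z r - ρ r) 0 := by
      calc ∫ r in uIoc 0 s, L r * z r
          ≤ ∫ r in uIoc 0 s, (L r * ρ r + L r * max (z r - ρ r) 0) := by
            refine setIntegral_mono
              ((integrableOn_mul_of_continuousOn (integrableOn_unit_of_memLp hL) hz).mono_set hsub)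
              ((hLρ.mono_set hsub).add hLy) fun r => ?_
            have : L r * z r ≤ L r * (ρ r + max (z r - ρ r) 0) :=
              mul_le_mul_of_nonneg_left (by linarith [le_max_left (z r - ρ r) 0]) (hL0 r)
            simpa [mul_add] using this
        _ = (∫ r in uIoc 0 s, L r * ρ r) + ∫ r in uIoc 0 s, L r * max (z r - ρ r) 0 :=
            integral_add (hLρ.mono_set hsub) hLy
        _ ≤ _ := by
            exact add_le_add (setIntegral_mono_set hLρ
              (Eventually.of_forall fun s => mul_nonneg (hL0 s) (hρ0 s)) hsub.eventuallyLE) le_rfl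
    refine max_le ?_ ?_
    · linarith [h s hs]
    · exact add_nonneg (integral_nonneg fun s => mul_nonneg (hL0 s) (hρ0 s))
        (integral_nonneg fun s => mul_nonneg (hL0 s) (le_max_right _ _))
  linarith [le_max_left (z t - ρ t) 0]

/-- Carathéodory's existence theorem on `[0,1]`, for a globally Lipschitz right-hand side with a
square integrable Lipschitz constant. -/
theorem exists_integral_solution {E : Type*} [NormedAddCommGroup E] [NormedSpace ℝ E]
    [CompleteSpace E] {L : ℝ → ℝ} {K : ℝ} {F : ℝ → E → E}
    (hL : MemLp L 2 (volume.restrict (Icc (0 : ℝ) 1)))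
    (hK : ∫ s in Icc (0 : ℝ) 1, L s ^ 2 ≤ K ^ 2)
    (hF : ∀ y : ℝ → E, ContinuousOn y (Icc 0 1) →
      IntegrableOn (fun s => F s (y s)) (Icc (0 : ℝ) 1))
    (hLip : ∀ s y z, ‖F s y - F s z‖ ≤ L s * ‖y - z‖)
    {t₀ : ℝ} (ht₀ : t₀ ∈ Icc (0 : ℝ) 1) (y₀ : E) :
    ∃ y : ℝ → E, ContinuousOn y (Icc 0 1) ∧
      ∀ t ∈ Icc (0 : ℝ) 1, y t = y₀ + ∫ s in t₀..t, F s (y s) := by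
  set c : ℝ := 2 * (K ^ 2 + 1) with hc
  -- The unknown is `w = exp(-c|s - t₀|) y`, so that the plain supremum norm of `w` is the weighted
  -- norm of `y` for which the integral operator contracts by `1/2`.
  let ext : C(Icc (0 : ℝ) 1, E) → ℝ → E := fun w s =>
    Real.exp (c * |s - t₀|) • w (projIcc 0 1 zero_le_one s)
  have hext : ∀ w, Continuous (ext w) := fun w => by
    have : Continuous fun s : ℝ => w (projIcc 0 1 zero_le_one s) :=
      w.continuous.comp continuous_projIcc
    fun_prop
  have hII : ∀ w, ∀ a ∈ Icc (0 : ℝ) 1, ∀ b ∈ Icc (0 : ℝ) 1,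
      IntervalIntegrable (fun s => F s (ext w s)) volume a b := fun w a ha b hb =>
    intervalIntegrable_iff.2 ((hF _ (hext w).continuousOn).mono_set (uIoc_subset_Icc_unit ha hb))
  let Φ : C(Icc (0 : ℝ) 1, E) → C(Icc (0 : ℝ) 1, E) := fun w =>
    { toFun := fun t => Real.exp (-(c * |(t : ℝ) - t₀|)) • (y₀ + ∫ s in t₀..t, F s (ext w s))
      continuous_toFun := by
        have h1 : ContinuousOn (fun t : ℝ => ∫ s in t₀..t, F s (ext w s)) (Icc 0 1) := by
          have := intervalIntegral.continuousOn_primitive_interval' (a := t₀) (b₁ := 0) (b₂ := 1)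
            (hII w 0 (by simp) 1 (by simp)) (by rwa [uIcc_of_le zero_le_one])
          rwa [uIcc_of_le zero_le_one] at this
        have h2 := continuousOn_iff_continuous_domRestrict.1 h1
        have h3 : Continuous fun t : Icc (0 : ℝ) 1 => ∫ s in t₀..(t : ℝ), F s (ext w s) := h2
        fun_prop }
  have hcontr : ContractingWith (1 / 2) Φ := by
    refine ⟨by norm_num, LipschitzWith.of_dist_le_mul fun w w' => ?_⟩
    rw [ContinuousMap.dist_le (by positivity)]
    intro t
    have hsub := uIoc_subset_Icc_unit ht₀ t.2
    have hw : ∀ s, ‖ext w s - ext w' s‖ ≤ Real.exp (c * |s - t₀|) * dist w w' := by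
      intro s
      simp only [ext, ← smul_sub, norm_smul, Real.norm_eq_abs, Real.abs_exp]
      rw [← dist_eq_norm]
      exact mul_le_mul_of_nonneg_left (ContinuousMap.dist_apply_le_dist _) (Real.exp_pos _).le
    have h1 : ‖∫ s in t₀..(t : ℝ), (F s (ext w s) - F s (ext w' s))‖
        ≤ 1 / 2 * Real.exp (c * |(t : ℝ) - t₀|) * dist w w' := by
      refine intervalIntegral.norm_integral_le_integral_norm_uIoc.trans ?_
      calc ∫ s in uIoc t₀ (t : ℝ), ‖F s (ext w s) - F s (ext w' s)‖
          ≤ ∫ s in uIoc t₀ (t : ℝ), L s * Real.exp (c * |s - t₀|) * dist w w' := by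
            have hi : IntegrableOn (fun s => F s (ext w s) - F s (ext w' s)) (uIoc t₀ (t : ℝ)) :=
              ((hF _ (hext w).continuousOn).sub (hF _ (hext w').continuousOn)).mono_set hsub
            refine integral_mono_of_nonneg (Eventually.of_forall fun s => norm_nonneg _)
              ((integrableOn_mul_of_continuousOn (integrableOn_unit_of_memLp hL)
                (by fun_prop : Continuous fun s => Real.exp (c * |s - t₀|)).continuousOn).mono_set
                hsub |>.mul_const _) ?_
            refine Eventually.of_forall fun s => ?_
            by_cases hE : Subsingleton E
            -- Nonnegativity of `L` is not assumed; it follows from the Lipschitz bound once `E` has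
            -- two distinct points, and a trivial `E` is treated apart.
            · have e1 : w = w' := by ext t; exact Subsingleton.elim _ _
              simp [e1]
            · rw [not_subsingleton_iff_nontrivial] at hE
              have hLs : 0 ≤ L s := by
                obtain ⟨a, b, hab⟩ := exists_pair_ne E
                have := (norm_nonneg _).trans (hLip s a b)
                exact nonneg_of_mul_nonneg_left this (norm_pos_iff.2 (sub_ne_zero.2 hab))
              calc _ ≤ L s * ‖ext w s - ext w' s‖ := hLip _ _ _
                _ ≤ L s * (Real.exp (c * |s - t₀|) * dist w w') :=
                  mul_le_mul_of_nonneg_left (hw s) hLs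
                _ = _ := by ring
        _ = (∫ s in uIoc t₀ (t : ℝ), L s * Real.exp (c * |s - t₀|)) * dist w w' :=
            integral_mul_const _ _
        _ ≤ _ := mul_le_mul_of_nonneg_right (setIntegral_mul_exp_le hL hK ht₀ t.2) dist_nonneg
    have h2 : Φ w t - Φ w' t = Real.exp (-(c * |(t : ℝ) - t₀|)) •
        ∫ s in t₀..(t : ℝ), (F s (ext w s) - F s (ext w' s)) := by
      rw [intervalIntegral.integral_sub (hII w _ ht₀ _ t.2) (hII w' _ ht₀ _ t.2)]
      have hΦ : ∀ w, Φ w t =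
        Real.exp (-(c * |(t : ℝ) - t₀|)) • (y₀ + ∫ s in t₀..(t : ℝ), F s (ext w s)) := fun _ => rfl
      rw [hΦ, hΦ, ← smul_sub, add_sub_add_left_eq_sub]
    rw [dist_eq_norm, h2, norm_smul, Real.norm_eq_abs, Real.abs_exp]
    calc _ ≤ Real.exp (-(c * |(t : ℝ) - t₀|)) *
          (1 / 2 * Real.exp (c * |(t : ℝ) - t₀|) * dist w w') :=
          mul_le_mul_of_nonneg_left h1 (Real.exp_pos _).le
      _ = (Real.exp (-(c * |(t : ℝ) - t₀|)) * Real.exp (c * |(t : ℝ) - t₀|)) *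
          (1 / 2 * dist w w') := by ring
      _ = _ := by rw [← Real.exp_add]; simp
  let w := hcontr.fixedPoint
  have hw : Φ w = w := hcontr.fixedPoint_isFixedPt
  refine ⟨ext w, (hext w).continuousOn, fun t ht => ?_⟩
  have h1 : w ⟨t, ht⟩ = Real.exp (-(c * |t - t₀|)) • (y₀ + ∫ s in t₀..t, F s (ext w s)) := by
    conv_lhs => rw [← hw]
    rfl
  change Real.exp (c * |t - t₀|) • w (projIcc 0 1 zero_le_one t) = _
  rw [projIcc_of_mem _ ht, h1, smul_smul, ← Real.exp_add]
  simp

end IntegralEquations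

/-! ### Existence, invertibility and differentiability of the flow. -/

section Flows

variable {d : ℕ} {V : Type*} [NormedAddCommGroup V] [InnerProductSpace ℝ V]

/-- The fields `ι v` are `C¹`, with values and derivatives bounded by `C ‖v‖`. -/
structure IsC1Bounded (ι : V →ₗ[ℝ] (Pt d → Pt d)) (C : ℝ) : Prop where
  nonneg : 0 ≤ C
  contDiff : ∀ v, ContDiff ℝ 1 (ι v)
  norm_le : ∀ v x, ‖ι v x‖ ≤ C * ‖v‖
  norm_fderiv_le : ∀ v x, ‖fderiv ℝ (ι v) x‖ ≤ C * ‖v‖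

theorem IsAdmissible.exists_isC1Bounded {p : ℕ} (hp : 1 ≤ p) {Ω : Set (Pt d)}
    {ι : V →ₗ[ℝ] (Pt d → Pt d)} (h : IsAdmissible p Ω ι) : ∃ C, IsC1Bounded ι C := by
  obtain ⟨C, hC⟩ := h.norm_le
  have hmono : ∀ v : V, C * ‖v‖ ≤ max C 0 * ‖v‖ := fun v =>
    mul_le_mul_of_nonneg_right (le_max_left _ _) (norm_nonneg _)
  refine ⟨max C 0, le_max_right _ _, fun v => (h.contDiff v).of_le (by exact_mod_cast hp),
    fun v x => ?_, fun v x => ?_⟩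
  · simpa using (hC v 0 (by omega) x).trans (hmono v)
  · simpa [norm_iteratedFDeriv_one] using (hC v 1 hp x).trans (hmono v)

variable {ι : V →ₗ[ℝ] (Pt d → Pt d)} {C : ℝ}

theorem IsC1Bounded.norm_sub_le (h : IsC1Bounded ι C) (v : V) (x y : Pt d) :
    ‖ι v x - ι v y‖ ≤ C * ‖v‖ * ‖x - y‖ :=
  convex_univ.norm_image_sub_le_of_norm_fderiv_le (𝕜 := ℝ)
    (fun z _ => ((h.contDiff v).differentiable one_ne_zero) z)
    (fun z _ => h.norm_fderiv_le v z) (mem_univ y) (mem_univ x)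

theorem IsC1Bounded.hasFDerivAt (h : IsC1Bounded ι C) (v : V) (x : Pt d) :
    HasFDerivAt (ι v) (fderiv ℝ (ι v) x) x :=
  (((h.contDiff v).differentiable one_ne_zero) x).hasFDerivAt

theorem IsC1Bounded.fderiv_sub (h : IsC1Bounded ι C) (v w : V) (x : Pt d) :
    fderiv ℝ (ι (v - w)) x = fderiv ℝ (ι v) x - fderiv ℝ (ι w) x := by
  rw [map_sub]
  exact ((h.hasFDerivAt v x).sub (h.hasFDerivAt w x)).fderiv

theorem IsC1Bounded.fderiv_add (h : IsC1Bounded ι C) (v w : V) (x : Pt d) :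
    fderiv ℝ (ι (v + w)) x = fderiv ℝ (ι v) x + fderiv ℝ (ι w) x := by
  rw [map_add]
  exact ((h.hasFDerivAt v x).add (h.hasFDerivAt w x)).fderiv

theorem IsC1Bounded.fderiv_smul (h : IsC1Bounded ι C) (c : ℝ) (v : V) (x : Pt d) :
    fderiv ℝ (ι (c • v)) x = c • fderiv ℝ (ι v) x := by
  rw [map_smul]
  exact ((h.hasFDerivAt v x).const_smul c).fderiv

/-- Linearity in the field and the uniform bound reduce joint continuity to continuity of one field.
This makes the velocity measurable in time along any continuous curve. -/
theorem IsC1Bounded.continuous_eval (h : IsC1Bounded ι C) :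
    Continuous fun q : V × Pt d => ι q.1 q.2 := by
  refine continuous_iff_continuousAt.2 fun q => ?_
  rw [ContinuousAt, tendsto_iff_norm_sub_tendsto_zero]
  refine squeeze_zero (fun _ => norm_nonneg _)
    (g := fun r : V × Pt d => C * ‖r.1 - q.1‖ + ‖ι q.1 r.2 - ι q.1 q.2‖) (fun r => ?_) ?_
  · have : ι r.1 r.2 - ι q.1 q.2 = ι (r.1 - q.1) r.2 + (ι q.1 r.2 - ι q.1 q.2) := by
      simp [map_sub]
    rw [this]
    exact (norm_add_le _ _).trans (add_le_add (h.norm_le _ _) le_rfl)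
  · have hc : Continuous fun r : V × Pt d => C * ‖r.1 - q.1‖ + ‖ι q.1 r.2 - ι q.1 q.2‖ := by
      have := (h.contDiff q.1).continuous
      fun_prop
    simpa using hc.tendsto q

theorem IsC1Bounded.continuous_fderiv (h : IsC1Bounded ι C) :
    Continuous fun q : V × Pt d => fderiv ℝ (ι q.1) q.2 := by
  refine continuous_iff_continuousAt.2 fun q => ?_
  rw [ContinuousAt, tendsto_iff_norm_sub_tendsto_zero]
  refine squeeze_zero (fun _ => norm_nonneg _)
    (g := fun r : V × Pt d => C * ‖r.1 - q.1‖ + ‖fderiv ℝ (ι q.1) r.2 - fderiv ℝ (ι q.1) q.2‖)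
    (fun r => ?_) ?_
  · have : fderiv ℝ (ι r.1) r.2 - fderiv ℝ (ι q.1) q.2
        = fderiv ℝ (ι (r.1 - q.1)) r.2 + (fderiv ℝ (ι q.1) r.2 - fderiv ℝ (ι q.1) q.2) := by
      rw [h.fderiv_sub]; abel
    rw [this]
    exact (norm_add_le _ _).trans (add_le_add (h.norm_fderiv_le _ _) le_rfl)
  · have hc : Continuous fun r : V × Pt d =>
        C * ‖r.1 - q.1‖ + ‖fderiv ℝ (ι q.1) r.2 - fderiv ℝ (ι q.1) q.2‖ := by
      have := (h.contDiff q.1).continuous_fderiv one_ne_zero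
      fun_prop
    simpa using hc.tendsto q

/-! ### Square integrable families of vectors -/

theorem L2Time.norm_sq_eq {H : Type*} [NormedAddCommGroup H] [InnerProductSpace ℝ H]
    (u : L2Time H) : ‖u‖ ^ 2 = ∫ s in Icc (0 : ℝ) 1, ‖u s‖ ^ 2 := by
  rw [← real_inner_self_eq_norm_sq, L2.inner_def]
  simp_rw [real_inner_self_eq_norm_sq]

theorem L2Time.memLp_mul_norm {H : Type*} [NormedAddCommGroup H] (u : L2Time H) (C : ℝ) :
    MemLp (fun s => C * ‖u s‖) 2 (volume.restrict (Icc (0 : ℝ) 1)) :=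
  (Lp.memLp u).norm.const_mul C

theorem L2Time.setIntegral_mul_norm_sq_le {H : Type*} [NormedAddCommGroup H]
    [InnerProductSpace ℝ H] {u : L2Time H} {R : ℝ} (hR : ‖u‖ ≤ R) (C : ℝ) :
    ∫ s in Icc (0 : ℝ) 1, (C * ‖u s‖) ^ 2 ≤ (C * R) ^ 2 := by
  simp_rw [mul_pow]
  rw [integral_const_mul, ← L2Time.norm_sq_eq]
  gcongr

theorem L2Time.integrableOn_norm {H : Type*} [NormedAddCommGroup H] (u : L2Time H) :
    IntegrableOn (fun s => ‖u s‖) (Icc (0 : ℝ) 1) :=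
  integrableOn_unit_of_memLp (Lp.memLp u).norm

theorem L2Time.aestronglyMeasurable {H : Type*} [NormedAddCommGroup H] (u : L2Time H) :
    AEStronglyMeasurable u (volume.restrict (Icc (0 : ℝ) 1)) :=
  Lp.aestronglyMeasurable u

theorem L2Time.setIntegral_norm_le {H : Type*} [NormedAddCommGroup H]
    [InnerProductSpace ℝ H] (u : L2Time H) : ∫ s in Icc (0 : ℝ) 1, ‖u s‖ ≤ ‖u‖ := by
  have h1 := integral_mul_le_Lp_mul_Lq_of_nonneg (μ := volume.restrict (Icc (0 : ℝ) 1))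
    (p := 2) (q := 2) (f := fun s => ‖u s‖) (g := fun _ => (1 : ℝ))
    Real.HolderConjugate.two_two (Eventually.of_forall fun s => norm_nonneg _)
    (Eventually.of_forall fun s => zero_le_one) (by simpa using (Lp.memLp u).norm)
    (memLp_const _)
  have h2 : ((∫ s in Icc (0 : ℝ) 1, ‖u s‖ ^ 2) ^ (2⁻¹ : ℝ)) = ‖u‖ := by
    rw [← L2Time.norm_sq_eq, ← one_div, ← Real.sqrt_eq_rpow, Real.sqrt_sq (norm_nonneg _)]
  simpa [h2] using h1

/-! ### Trajectories -/

theorem IsC1Bounded.integrableOn_field (h : IsC1Bounded ι C) (v : L2Time V) {y : ℝ → Pt d}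
    (hy : ContinuousOn y (Icc 0 1)) : IntegrableOn (fun s => ι (v s) (y s)) (Icc (0 : ℝ) 1) :=
  (v.integrableOn_norm.const_mul C).mono'
    (h.continuous_eval.comp_aestronglyMeasurable
      (v.aestronglyMeasurable.prodMk (hy.aestronglyMeasurable measurableSet_Icc)))
    (Eventually.of_forall fun _ => h.norm_le _ _)

theorem IntegrableOn.intervalIntegrable_unit {E : Type*} [NormedAddCommGroup E] {f : ℝ → E}
    (hf : IntegrableOn f (Icc (0 : ℝ) 1)) {a b : ℝ} (ha : a ∈ Icc (0 : ℝ) 1)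
    (hb : b ∈ Icc (0 : ℝ) 1) : IntervalIntegrable f volume a b :=
  intervalIntegrable_iff.2 (hf.mono_set (uIoc_subset_Icc_unit ha hb))

/-- `y` solves the flow equation of `v` on `[0,1]`, written from the time `t₀`. -/
def IsTrajectory (ι : V →ₗ[ℝ] (Pt d → Pt d)) (v : L2Time V) (t₀ : ℝ) (y : ℝ → Pt d) : Prop :=
  ContinuousOn y (Icc 0 1) ∧ ∀ t ∈ Icc (0 : ℝ) 1, y t = y t₀ + ∫ s in t₀..t, ι (v s) (y s)

/-- Moving the base time allows the two-sided Grönwall estimate to run backwards, which yields the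
lower Lipschitz bound and the invertibility of the flow. -/
theorem IsC1Bounded.isTrajectory_of_mem (h : IsC1Bounded ι C) {v : L2Time V} {t₀ t₁ : ℝ}
    (ht₀ : t₀ ∈ Icc (0 : ℝ) 1) (ht₁ : t₁ ∈ Icc (0 : ℝ) 1) {y : ℝ → Pt d}
    (hy : IsTrajectory ι v t₀ y) : IsTrajectory ι v t₁ y := by
  refine ⟨hy.1, fun t ht => ?_⟩
  have hi := h.integrableOn_field v hy.1
  rw [hy.2 t ht, hy.2 t₁ ht₁, add_assoc, intervalIntegral.integral_add_adjacent_intervals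
    (IntegrableOn.intervalIntegrable_unit hi ht₀ ht₁)
    (IntegrableOn.intervalIntegrable_unit hi ht₁ ht)]

theorem IsC1Bounded.exists_isTrajectory (h : IsC1Bounded ι C) (v : L2Time V) {t₀ : ℝ}
    (ht₀ : t₀ ∈ Icc (0 : ℝ) 1) (y₀ : Pt d) : ∃ y, y t₀ = y₀ ∧ IsTrajectory ι v t₀ y := by
  obtain ⟨y, hy, hy'⟩ := exists_integral_solution (F := fun s => ι (v s)) (v.memLp_mul_norm C)
    (L2Time.setIntegral_mul_norm_sq_le le_rfl C) (fun y hy => h.integrableOn_field v hy)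
    (fun s => h.norm_sub_le _) ht₀ y₀
  have h0 : y t₀ = y₀ := by simpa using hy' t₀ ht₀
  exact ⟨y, h0, hy, fun t ht => by rw [hy' t ht, h0]⟩

theorem IsC1Bounded.norm_trajectory_sub_le (h : IsC1Bounded ι C) {v : L2Time V} {R : ℝ}
    (hR : ‖v‖ ≤ R) {t₀ : ℝ} (ht₀ : t₀ ∈ Icc (0 : ℝ) 1) {y z : ℝ → Pt d}
    (hy : IsTrajectory ι v t₀ y) (hz : IsTrajectory ι v t₀ z) {t : ℝ} (ht : t ∈ Icc (0 : ℝ) 1) :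
    ‖y t - z t‖ ≤ gronwallConst (C * R) * ‖y t₀ - z t₀‖ := by
  refine le_gronwallConst_mul (z := fun t => ‖y t - z t‖) (v.memLp_mul_norm C)
    (fun s => mul_nonneg h.nonneg (norm_nonneg _)) (L2Time.setIntegral_mul_norm_sq_le hR C)
    (hy.1.sub hz.1).norm (norm_nonneg _) ht₀ (fun s hs => ?_) ht
  have hi := h.integrableOn_field v hy.1
  have hi' := h.integrableOn_field v hz.1
  have hsub := uIoc_subset_Icc_unit ht₀ hs
  have : y s - z s = (y t₀ - z t₀) + ∫ r in t₀..s, (ι (v r) (y r) - ι (v r) (z r)) := by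
    rw [hy.2 s hs, hz.2 s hs, intervalIntegral.integral_sub
      (IntegrableOn.intervalIntegrable_unit hi ht₀ hs)
      (IntegrableOn.intervalIntegrable_unit hi' ht₀ hs)]
    abel
  rw [this]
  refine (norm_add_le _ _).trans (add_le_add le_rfl ?_)
  refine intervalIntegral.norm_integral_le_integral_norm_uIoc.trans ?_
  refine integral_mono ((hi.sub hi').mono_set hsub).norm
    ((integrableOn_mul_of_continuousOn (v.integrableOn_norm.const_mul C)
      (hy.1.sub hz.1).norm).mono_set hsub) fun r => h.norm_sub_le _ _ _

/-! ### The flow -/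

theorem IsC1Bounded.isFlow_flow (h : IsC1Bounded ι C) (v : L2Time V) :
    IsFlow ι v (flow ι v) := by
  refine Classical.epsilon_spec (p := IsFlow ι v) ?_
  choose y hy0 hy using fun x => h.exists_isTrajectory v (t₀ := 0) (by simp) x
  refine ⟨fun t x => y x t, fun x => ⟨(hy x).1, ?_, fun t ht => ?_⟩⟩
  · exact IntegrableOn.intervalIntegrable_unit (h.integrableOn_field v (hy x).1) (by simp) (by simp)
  · simpa [hy0 x] using (hy x).2 t ht

theorem IsC1Bounded.flow_zero (h : IsC1Bounded ι C) (v : L2Time V) (x : Pt d) :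
    flow ι v 0 x = x := by
  simpa using (h.isFlow_flow v x).2.2 0 (by simp)

theorem IsC1Bounded.isTrajectory_flow (h : IsC1Bounded ι C) (v : L2Time V) (x : Pt d) {t₀ : ℝ}
    (ht₀ : t₀ ∈ Icc (0 : ℝ) 1) : IsTrajectory ι v t₀ (fun t => flow ι v t x) := by
  refine h.isTrajectory_of_mem (t₀ := 0) (by simp) ht₀ ⟨(h.isFlow_flow v x).1, fun t ht => ?_⟩
  simp only [h.flow_zero]
  exact (h.isFlow_flow v x).2.2 t ht

theorem IsC1Bounded.continuousOn_flow (h : IsC1Bounded ι C) (v : L2Time V) (x : Pt d) :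
    ContinuousOn (fun t => flow ι v t x) (Icc 0 1) := (h.isFlow_flow v x).1

theorem IsC1Bounded.flow_eq (h : IsC1Bounded ι C) (v : L2Time V) (x : Pt d) {t : ℝ}
    (ht : t ∈ Icc (0 : ℝ) 1) :
    flow ι v t x = x + ∫ s in (0 : ℝ)..t, ι (v s) (flow ι v s x) :=
  (h.isFlow_flow v x).2.2 t ht

theorem IsC1Bounded.norm_flow_sub_le (h : IsC1Bounded ι C) {v : L2Time V} {R : ℝ}
    (hR : ‖v‖ ≤ R) {s t : ℝ} (hs : s ∈ Icc (0 : ℝ) 1) (ht : t ∈ Icc (0 : ℝ) 1) (x y : Pt d) :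
    ‖flow ι v t x - flow ι v t y‖ ≤ gronwallConst (C * R) * ‖flow ι v s x - flow ι v s y‖ :=
  h.norm_trajectory_sub_le hR hs (h.isTrajectory_flow v x hs) (h.isTrajectory_flow v y hs) ht

theorem IsC1Bounded.norm_flow_sub_le' (h : IsC1Bounded ι C) {v : L2Time V} {R : ℝ}
    (hR : ‖v‖ ≤ R) {t : ℝ} (ht : t ∈ Icc (0 : ℝ) 1) (x y : Pt d) :
    ‖flow ι v t x - flow ι v t y‖ ≤ gronwallConst (C * R) * ‖x - y‖ := by
  simpa [h.flow_zero] using h.norm_flow_sub_le hR (s := 0) (by simp) ht x y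

theorem IsC1Bounded.norm_sub_le_flow (h : IsC1Bounded ι C) {v : L2Time V} {R : ℝ}
    (hR : ‖v‖ ≤ R) {t : ℝ} (ht : t ∈ Icc (0 : ℝ) 1) (x y : Pt d) :
    ‖x - y‖ ≤ gronwallConst (C * R) * ‖flow ι v t x - flow ι v t y‖ := by
  simpa [h.flow_zero] using h.norm_flow_sub_le hR (t := 0) ht (by simp) x y

theorem IsC1Bounded.lipschitzWith_flow (h : IsC1Bounded ι C) {v : L2Time V} {R : ℝ}
    (hR : ‖v‖ ≤ R) {t : ℝ} (ht : t ∈ Icc (0 : ℝ) 1) :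
    LipschitzWith (gronwallConst (C * R)).toNNReal (flow ι v t) := by
  refine LipschitzWith.of_dist_le_mul fun x y => ?_
  rw [Real.coe_toNNReal _ (gronwallConst_pos _).le, dist_eq_norm, dist_eq_norm]
  exact h.norm_flow_sub_le' hR ht x y

theorem IsC1Bounded.antilipschitzWith_flow (h : IsC1Bounded ι C) {v : L2Time V} {R : ℝ}
    (hR : ‖v‖ ≤ R) {t : ℝ} (ht : t ∈ Icc (0 : ℝ) 1) :
    AntilipschitzWith (gronwallConst (C * R)).toNNReal (flow ι v t) := by
  refine AntilipschitzWith.of_le_mul_dist fun x y => ?_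
  rw [Real.coe_toNNReal _ (gronwallConst_pos _).le, dist_eq_norm, dist_eq_norm]
  exact h.norm_sub_le_flow hR ht x y

/-- For surjectivity, the trajectory through `y` at time `t` is solved back to time `0`; by
uniqueness its value there flows to `y`. -/
theorem IsC1Bounded.bijective_flow (h : IsC1Bounded ι C) (v : L2Time V) {t : ℝ}
    (ht : t ∈ Icc (0 : ℝ) 1) : Function.Bijective (flow ι v t) := by
  refine ⟨(h.antilipschitzWith_flow le_rfl ht).injective, fun y => ?_⟩
  obtain ⟨z, hz, hz'⟩ := h.exists_isTrajectory v ht y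
  refine ⟨z 0, ?_⟩
  have h0 : (0 : ℝ) ∈ Icc (0 : ℝ) 1 := by simp
  have := h.norm_trajectory_sub_le le_rfl h0 (h.isTrajectory_flow v (z 0) h0)
    (h.isTrajectory_of_mem ht h0 hz') ht
  rw [h.flow_zero, sub_self, norm_zero, mul_zero] at this
  rw [← hz]
  exact sub_eq_zero.1 (norm_le_zero_iff.1 this)

theorem IsC1Bounded.flow_eq_self (h : IsC1Bounded ι C) (v : L2Time V) {x : Pt d}
    (hx : ∀ v, ι v x = 0) {t : ℝ} (ht : t ∈ Icc (0 : ℝ) 1) : flow ι v t x = x := by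
  have h0 : (0 : ℝ) ∈ Icc (0 : ℝ) 1 := by simp
  have := h.norm_trajectory_sub_le le_rfl h0 (h.isTrajectory_flow v x h0)
    (z := fun _ => x) ⟨continuousOn_const, fun t _ => by simp [hx]⟩ ht
  rw [h.flow_zero, sub_self, norm_zero, mul_zero] at this
  exact sub_eq_zero.1 (norm_le_zero_iff.1 this)

/-- Points outside `Ω` are stationary, and injectivity then prevents a point of `Ω` from reaching
one of them. -/
theorem IsC1Bounded.preimage_flow (h : IsC1Bounded ι C) {Ω : Set (Pt d)}
    (hΩ : ∀ v, ∀ x ∉ Ω, ι v x = 0) (v : L2Time V) {t : ℝ}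
    (ht : t ∈ Icc (0 : ℝ) 1) : flow ι v t ⁻¹' Ω = Ω := by
  ext x
  by_cases hx : x ∈ Ω
  · refine iff_of_true ?_ hx
    by_contra hx'
    have := h.flow_eq_self v (fun v => hΩ v _ hx') ht
    have := (h.bijective_flow v ht).1 this
    rw [mem_preimage, this] at hx'
    exact hx' hx
  · refine iff_of_false ?_ hx
    rwa [mem_preimage, h.flow_eq_self v (fun v => hΩ v _ hx) ht]

/-- Time is clamped because the flow equation constrains `flow` only on `[0,1]`. Joint continuity
provides the measurability in `(x, s)` required by Fubini's theorem. -/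
theorem IsC1Bounded.continuous_flow (h : IsC1Bounded ι C) (v : L2Time V) :
    Continuous fun q : ℝ × Pt d => flow ι v (projIcc (0 : ℝ) 1 zero_le_one q.1) q.2 :=
by
  refine continuous_prod_of_continuous_lipschitzWith' _ (gronwallConst (C * ‖v‖)).toNNReal
    (fun t => ?_) (fun x => ?_)
  · have h1 := h.lipschitzWith_flow (v := v) (R := ‖v‖) le_rfl (projIcc (0 : ℝ) 1 zero_le_one t).2
    exact h1
  · have h1 : Continuous fun s : Icc (0 : ℝ) 1 => flow ι v s x :=
      continuousOn_iff_continuous_domRestrict.1 (h.continuousOn_flow v x)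
    exact h1.comp continuous_projIcc

/-! ### The derivative of the flow -/

theorem IsC1Bounded.integrableOn_fderiv_comp (h : IsC1Bounded ι C) (v : L2Time V) {y : ℝ → Pt d}
    (hy : ContinuousOn y (Icc 0 1)) {M : ℝ → Pt d →L[ℝ] Pt d} (hM : ContinuousOn M (Icc 0 1)) :
    IntegrableOn (fun s => (fderiv ℝ (ι (v s)) (y s)).comp (M s)) (Icc (0 : ℝ) 1) := by
  obtain ⟨B, hB⟩ := isCompact_Icc.exists_bound_of_continuousOn hM
  refine (v.integrableOn_norm.const_mul (C * B)).mono' ?_ ?_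
  · have h1 := h.continuous_fderiv.comp_aestronglyMeasurable
      (v.aestronglyMeasurable.prodMk (hy.aestronglyMeasurable measurableSet_Icc))
    exact (by fun_prop : Continuous fun q : (Pt d →L[ℝ] Pt d) × (Pt d →L[ℝ] Pt d) =>
      q.1.comp q.2).comp_aestronglyMeasurable
      (h1.prodMk (hM.aestronglyMeasurable measurableSet_Icc))
  · refine (ae_restrict_mem measurableSet_Icc).mono fun s hs => ?_
    refine (ContinuousLinearMap.opNorm_comp_le _ _).trans ?_
    calc _ ≤ (C * ‖v s‖) * B := mul_le_mul (h.norm_fderiv_le _ _) (hB s hs) (norm_nonneg _)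
          (mul_nonneg h.nonneg (norm_nonneg _))
      _ = _ := by ring

theorem IsC1Bounded.exists_variation (h : IsC1Bounded ι C) (v : L2Time V) {y : ℝ → Pt d}
    (hy : ContinuousOn y (Icc 0 1)) :
    ∃ M : ℝ → Pt d →L[ℝ] Pt d, ContinuousOn M (Icc 0 1) ∧ ∀ t ∈ Icc (0 : ℝ) 1,
      M t = ContinuousLinearMap.id ℝ (Pt d) +
        ∫ s in (0 : ℝ)..t, (fderiv ℝ (ι (v s)) (y s)).comp (M s) := by
  refine exists_integral_solution (F := fun s m => (fderiv ℝ (ι (v s)) (y s)).comp m)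
    (v.memLp_mul_norm C) (L2Time.setIntegral_mul_norm_sq_le le_rfl C)
    (fun M hM => h.integrableOn_fderiv_comp v hy hM) (fun s m m' => ?_) (by simp) _
  rw [← ContinuousLinearMap.comp_sub]
  exact (ContinuousLinearMap.opNorm_comp_le _ _).trans
    (mul_le_mul_of_nonneg_right (h.norm_fderiv_le _ _) (norm_nonneg _))

/-- For each `s` the remainder is `o(k)` since the flow is Lipschitz in space; the quotients are
dominated by `2 G C ‖v s‖`. This is the forcing term when the flow is linearised. -/
theorem IsC1Bounded.integral_taylor_isLittleO (h : IsC1Bounded ι C) (v : L2Time V) (x : Pt d) :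
    (fun k : Pt d => ∫ s in Icc (0 : ℝ) 1, ‖ι (v s) (flow ι v s (x + k)) - ι (v s) (flow ι v s x)
      - fderiv ℝ (ι (v s)) (flow ι v s x) (flow ι v s (x + k) - flow ι v s x)‖)
      =o[𝓝 0] fun k => k := by
  set G := gronwallConst (C * ‖v‖) with hG
  set r : Pt d → ℝ → Pt d := fun k s => ι (v s) (flow ι v s (x + k)) - ι (v s) (flow ι v s x)
      - fderiv ℝ (ι (v s)) (flow ι v s x) (flow ι v s (x + k) - flow ι v s x) with hr
  rw [← Asymptotics.isLittleO_norm_right, Asymptotics.isLittleO_iff_tendsto' (by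
    refine Eventually.of_forall fun k hk => ?_
    rw [norm_eq_zero] at hk
    simp [hk])]
  have hconv : Tendsto (fun k => ∫ s in Icc (0 : ℝ) 1, ‖r k s‖ / ‖k‖) (𝓝 0)
      (𝓝 (∫ s in Icc (0 : ℝ) 1, (0 : ℝ))) := by
    have hmeas : ∀ k, AEStronglyMeasurable (r k) (volume.restrict (Icc (0 : ℝ) 1)) := by
      intro k
      have e1 := (h.continuousOn_flow v (x + k)).aestronglyMeasurable (μ := volume)
        measurableSet_Icc
      have e2 := (h.continuousOn_flow v x).aestronglyMeasurable (μ := volume) measurableSet_Icc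
      have e3 := h.continuous_fderiv.comp_aestronglyMeasurable (v.aestronglyMeasurable.prodMk e2)
      exact ((h.integrableOn_field v (h.continuousOn_flow v (x + k))).aestronglyMeasurable.sub
        (h.integrableOn_field v (h.continuousOn_flow v x)).aestronglyMeasurable).sub
        ((by fun_prop : Continuous fun q : (Pt d →L[ℝ] Pt d) × Pt d =>
          q.1 q.2).comp_aestronglyMeasurable (e3.prodMk (e1.sub e2)))
    refine tendsto_integral_filter_of_dominated_convergence (fun s => 2 * G * (C * ‖v s‖))
      (Eventually.of_forall fun k => by
        simpa only [div_eq_mul_inv] using (hmeas k).norm.mul_const ‖k‖⁻¹)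
      (Eventually.of_forall fun k => ?_) ((v.integrableOn_norm.const_mul C).const_mul _) ?_
    · refine (ae_restrict_mem measurableSet_Icc).mono fun s hs => ?_
      rw [Real.norm_of_nonneg (by positivity)]
      have hCv : 0 ≤ C * ‖v s‖ := mul_nonneg h.nonneg (norm_nonneg _)
      have hGp : 0 < G := gronwallConst_pos _
      refine div_le_of_le_mul₀ (norm_nonneg _) (by positivity) ?_
      have hφ : ‖flow ι v s (x + k) - flow ι v s x‖ ≤ G * ‖k‖ := by
        simpa using h.norm_flow_sub_le' le_rfl hs (x + k) x
      calc ‖r k s‖ ≤ C * ‖v s‖ * ‖flow ι v s (x + k) - flow ι v s x‖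
            + C * ‖v s‖ * ‖flow ι v s (x + k) - flow ι v s x‖ := by
            refine (_root_.norm_sub_le _ _).trans (add_le_add (h.norm_sub_le _ _ _) ?_)
            exact (ContinuousLinearMap.le_opNorm _ _).trans
              (mul_le_mul_of_nonneg_right (h.norm_fderiv_le _ _) (norm_nonneg _))
        _ ≤ C * ‖v s‖ * (G * ‖k‖) + C * ‖v s‖ * (G * ‖k‖) := by gcongr
        _ = _ := by ring
    · refine (ae_restrict_mem measurableSet_Icc).mono fun s hs => ?_
      have hO : (fun k => flow ι v s (x + k) - flow ι v s x) =O[𝓝 0] fun k => k :=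
        Asymptotics.IsBigO.of_bound G (Eventually.of_forall fun k => by
          simpa using h.norm_flow_sub_le' le_rfl hs (x + k) x)
      have hcont : Tendsto (fun k => flow ι v s (x + k)) (𝓝 0) (𝓝 (flow ι v s x)) := by
        have : Continuous fun k => flow ι v s (x + k) :=
          (h.lipschitzWith_flow le_rfl hs).continuous.comp (by fun_prop)
        simpa using this.tendsto 0
      have ho := ((h.hasFDerivAt (v s) (flow ι v s x)).isLittleO.comp_tendsto hcont).trans_isBigO hO
      have := ho.norm_norm.tendsto_div_nhds_zero
      exact this
  have heq : (fun k => (∫ s in Icc (0 : ℝ) 1, ‖r k s‖) / ‖k‖)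
      = fun k => ∫ s in Icc (0 : ℝ) 1, ‖r k s‖ / ‖k‖ := by
    funext k; rw [integral_div]
  rw [heq]
  simpa using hconv

/-- The error `φ(x + k) - φ(x) - M k` solves the linearised equation with zero initial value and the
Taylor remainder of the field as forcing, so Grönwall's inequality bounds it by the integral of that
remainder. -/
theorem IsC1Bounded.hasFDerivAt_flow_of_variation (h : IsC1Bounded ι C) (v : L2Time V) (x : Pt d)
    {M : ℝ → Pt d →L[ℝ] Pt d} (hM : ContinuousOn M (Icc 0 1))
    (hMeq : ∀ t ∈ Icc (0 : ℝ) 1, M t = ContinuousLinearMap.id ℝ (Pt d) +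
        ∫ s in (0 : ℝ)..t, (fderiv ℝ (ι (v s)) (flow ι v s x)).comp (M s)) {t : ℝ}
    (ht : t ∈ Icc (0 : ℝ) 1) : HasFDerivAt (flow ι v t) (M t) x := by
  rw [hasFDerivAt_iff_isLittleO_nhds_zero]
  have h0 : (0 : ℝ) ∈ Icc (0 : ℝ) 1 := by simp
  refine Asymptotics.IsBigO.trans_isLittleO ?_ (h.integral_taylor_isLittleO v x)
  refine Asymptotics.IsBigO.of_bound (gronwallConst (C * ‖v‖)) (Eventually.of_forall fun k => ?_)
  rw [Real.norm_of_nonneg (integral_nonneg fun _ => norm_nonneg _)]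
  set φ := flow ι v with hφ
  have hc1 := h.continuousOn_flow v (x + k)
  have hc2 := h.continuousOn_flow v x
  have hMk : ContinuousOn (fun s => M s k) (Icc 0 1) := hM.clm_apply continuousOn_const
  have hi1 := h.integrableOn_field v hc1
  have hi2 := h.integrableOn_field v hc2
  have hi3 := h.integrableOn_fderiv_comp v hc2 hM
  have happ : ∀ {N : ℝ → Pt d}, ContinuousOn N (Icc 0 1) → IntegrableOn (fun s =>
      fderiv ℝ (ι (v s)) (φ s x) (N s)) (Icc (0 : ℝ) 1) := by
    intro N hN
    obtain ⟨B, hB⟩ := isCompact_Icc.exists_bound_of_continuousOn hN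
    refine (v.integrableOn_norm.const_mul (C * B)).mono' ?_ ?_
    · exact (by fun_prop : Continuous fun q : (Pt d →L[ℝ] Pt d) × Pt d =>
        q.1 q.2).comp_aestronglyMeasurable ((h.continuous_fderiv.comp_aestronglyMeasurable
          (v.aestronglyMeasurable.prodMk (hc2.aestronglyMeasurable measurableSet_Icc))).prodMk
          (hN.aestronglyMeasurable measurableSet_Icc))
    · refine (ae_restrict_mem measurableSet_Icc).mono fun s hs => ?_
      refine (ContinuousLinearMap.le_opNorm _ _).trans ?_
      calc _ ≤ (C * ‖v s‖) * B := mul_le_mul (h.norm_fderiv_le _ _) (hB s hs) (norm_nonneg _)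
            (mul_nonneg h.nonneg (norm_nonneg _))
        _ = _ := by ring
  have hcd : ContinuousOn (fun s => φ s (x + k) - φ s x) (Icc 0 1) := hc1.sub hc2
  have hce : ContinuousOn (fun s => φ s (x + k) - φ s x - M s k) (Icc 0 1) := hcd.sub hMk
  have hi12 : IntegrableOn (fun r => ι (v r) (φ r (x + k)) - ι (v r) (φ r x)) (Icc (0 : ℝ) 1) :=
    hi1.sub hi2
  have hir : IntegrableOn (fun r => ι (v r) (φ r (x + k)) - ι (v r) (φ r x)
      - fderiv ℝ (ι (v r)) (φ r x) (φ r (x + k) - φ r x)) (Icc (0 : ℝ) 1) :=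
    hi12.sub (happ hcd)
  refine le_gronwallConst_mul (z := fun t => ‖φ t (x + k) - φ t x - M t k‖)
    (v.memLp_mul_norm C) (fun s => mul_nonneg h.nonneg (norm_nonneg _))
    (L2Time.setIntegral_mul_norm_sq_le le_rfl C) hce.norm
    (integral_nonneg fun _ => norm_nonneg _) h0 (fun s hs => ?_) ht
  have hsub := uIoc_subset_Icc_unit h0 hs
  have hMs : M s k = k + ∫ r in (0 : ℝ)..s, fderiv ℝ (ι (v r)) (φ r x) (M r k) := by
    rw [hMeq s hs, add_apply, ContinuousLinearMap.intervalIntegral_apply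
      (IntegrableOn.intervalIntegrable_unit hi3 h0 hs)]
    rfl
  have key : φ s (x + k) - φ s x - M s k = (∫ r in (0 : ℝ)..s, (ι (v r) (φ r (x + k))
      - ι (v r) (φ r x) - fderiv ℝ (ι (v r)) (φ r x) (φ r (x + k) - φ r x)))
      + ∫ r in (0 : ℝ)..s, fderiv ℝ (ι (v r)) (φ r x) (φ r (x + k) - φ r x - M r k) := by
    rw [← intervalIntegral.integral_add (IntegrableOn.intervalIntegrable_unit hir h0 hs)
      (IntegrableOn.intervalIntegrable_unit (happ hce) h0 hs), hMs,
      hφ, h.flow_eq v (x + k) hs, h.flow_eq v x hs, ← hφ]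
    have e : ∀ r, (ι (v r) (φ r (x + k)) - ι (v r) (φ r x)
        - fderiv ℝ (ι (v r)) (φ r x) (φ r (x + k) - φ r x))
        + fderiv ℝ (ι (v r)) (φ r x) (φ r (x + k) - φ r x - M r k)
        = (ι (v r) (φ r (x + k)) - ι (v r) (φ r x)) - fderiv ℝ (ι (v r)) (φ r x) (M r k) := by
      intro r; simp only [map_sub]; abel
    simp_rw [e]
    rw [intervalIntegral.integral_sub
      (IntegrableOn.intervalIntegrable_unit hi12 h0 hs)
      (IntegrableOn.intervalIntegrable_unit (happ hMk) h0 hs),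
      intervalIntegral.integral_sub (IntegrableOn.intervalIntegrable_unit hi1 h0 hs)
      (IntegrableOn.intervalIntegrable_unit hi2 h0 hs)]
    abel
  refine (congrArg norm key).trans_le ((norm_add_le _ _).trans (add_le_add ?_ ?_))
  · refine intervalIntegral.norm_integral_le_integral_norm_uIoc.trans ?_
    exact setIntegral_mono_set hir.norm (Eventually.of_forall fun _ => norm_nonneg _)
      hsub.eventuallyLE
  · refine intervalIntegral.norm_integral_le_integral_norm_uIoc.trans ?_
    refine integral_mono ((happ hce).mono_set hsub).norm
      ((integrableOn_mul_of_continuousOn (v.integrableOn_norm.const_mul C)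
        hce.norm).mono_set hsub) fun r => ?_
    exact (ContinuousLinearMap.le_opNorm _ _).trans
      (mul_le_mul_of_nonneg_right (h.norm_fderiv_le _ _) (norm_nonneg _))

/-- A solution `M` of the variational equation exists and is the derivative, so `fderiv` inherits
both the continuity in time and the equation. -/
theorem IsC1Bounded.fderiv_flow (h : IsC1Bounded ι C) (v : L2Time V) (x : Pt d) :
    ContinuousOn (fun t => fderiv ℝ (flow ι v t) x) (Icc 0 1) ∧
    (∀ t ∈ Icc (0 : ℝ) 1, HasFDerivAt (flow ι v t) (fderiv ℝ (flow ι v t) x) x) ∧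
    ∀ t ∈ Icc (0 : ℝ) 1, fderiv ℝ (flow ι v t) x = ContinuousLinearMap.id ℝ (Pt d) +
        ∫ s in (0 : ℝ)..t,
          (fderiv ℝ (ι (v s)) (flow ι v s x)).comp (fderiv ℝ (flow ι v s) x) := by
  obtain ⟨M, hM, hMeq⟩ := h.exists_variation v (h.continuousOn_flow v x)
  have hder : ∀ t ∈ Icc (0 : ℝ) 1, HasFDerivAt (flow ι v t) (M t) x := fun t ht =>
    h.hasFDerivAt_flow_of_variation v x hM hMeq ht
  have hfd : ∀ t ∈ Icc (0 : ℝ) 1, fderiv ℝ (flow ι v t) x = M t := fun t ht => (hder t ht).fderiv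
  refine ⟨hM.congr hfd, fun t ht => (hfd t ht).symm ▸ hder t ht, fun t ht => ?_⟩
  rw [hfd t ht, hMeq t ht]
  congr 1
  refine intervalIntegral.integral_congr fun s hs => ?_
  rw [uIcc_of_le ht.1] at hs
  simp only [hfd s ⟨hs.1, hs.2.trans ht.2⟩]

end Flows

/-! ### Dominated convergence in `L²`. -/

section Lp

open scoped ENNReal NNReal

theorem tendsto_eLpNorm_zero_of_dominated {α E : Type*} [MeasurableSpace α]
    [NormedAddCommGroup E] {μ : Measure α} {F : ℕ → α → E} {g : α → ℝ}
    (hF : ∀ n, AEStronglyMeasurable (F n) μ) (hg : MemLp g 2 μ)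
    (hbound : ∀ n, ∀ᵐ x ∂μ, ‖F n x‖ ≤ g x)
    (hlim : ∀ᵐ x ∂μ, Tendsto (fun n => F n x) atTop (𝓝 0)) :
    Tendsto (fun n => eLpNorm (F n) 2 μ) atTop (𝓝 0) := by
  simp_rw [eLpNorm_eq_lintegral_rpow_enorm_toReal (p := 2) (by norm_num) (by norm_num)]
  have hfin : ∫⁻ x, ‖g x‖ₑ ^ (2 : ℝ≥0∞).toReal ∂μ ≠ ∞ :=
    (lintegral_rpow_enorm_lt_top_of_eLpNorm_lt_top (by norm_num) (by norm_num) hg.2).ne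
  have h1 : Tendsto (fun n => ∫⁻ x, ‖F n x‖ₑ ^ (2 : ℝ≥0∞).toReal ∂μ) atTop
      (𝓝 (∫⁻ _, 0 ∂μ)) := by
    refine tendsto_lintegral_of_dominated_convergence' (fun x => ‖g x‖ₑ ^ (2 : ℝ≥0∞).toReal)
      (fun n => (hF n).enorm.pow_const _) (fun n => ?_) hfin ?_
    · filter_upwards [hbound n] with x hx
      refine ENNReal.rpow_le_rpow ?_ (by norm_num)
      rw [enorm_le_iff_norm_le]
      exact hx.trans (le_abs_self _)
    · filter_upwards [hlim] with x hx
      have h2 : Tendsto (fun n => ‖F n x‖ₑ) atTop (𝓝 0) := by simpa using hx.enorm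
      have h3 := (ENNReal.continuous_rpow_const (y := (2 : ℝ≥0∞).toReal)).tendsto 0
      simpa [Function.comp_def] using h3.comp h2
  rw [lintegral_zero] at h1
  have h3 := (ENNReal.continuous_rpow_const (y := 1 / (2 : ℝ≥0∞).toReal)).tendsto 0
  simpa [Function.comp_def] using h3.comp h1

end Lp

/-! ### Composition and multiplication on `L²(Ω)`, Jacobian determinants and adjoints. -/

section Composition

open scoped ENNReal NNReal

variable {d : ℕ} {Ω : Set (Pt d)}

/-- Composition with `ψ` is bounded on `L²(Ω)`, as the image under `ψ` of Lebesgue measure on `Ω`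
has a density bounded by `K`. -/
structure IsBoundedMap (Ω : Set (Pt d)) (K : ℝ≥0) (ψ : Pt d → Pt d) : Prop where
  measurable : Measurable ψ
  map_le : (volume.restrict Ω).map ψ ≤ (K : ℝ≥0∞) • volume.restrict Ω

/-- Taking preimages under a `K`-antilipschitz map enlarges `d`-dimensional Hausdorff measure by at
most `K ^ d`, and Lebesgue measure is a multiple of Hausdorff measure. -/
theorem isBoundedMap_of_antilipschitzWith {K : ℝ≥0} {ψ : Pt d → Pt d}
    (hψ : Continuous ψ) (hK : AntilipschitzWith K ψ) (hpre : ψ ⁻¹' Ω = Ω) :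
    IsBoundedMap Ω (K ^ d) ψ := by
  refine ⟨hψ.measurable, Measure.le_iff.2 fun A hA => ?_⟩
  rw [Measure.map_apply hψ.measurable hA, Measure.restrict_apply (hψ.measurable hA),
    Measure.smul_apply, Measure.restrict_apply hA]
  have hset : ψ ⁻¹' A ∩ Ω = ψ ⁻¹' (A ∩ Ω) := by rw [preimage_inter, hpre]
  rw [hset, Measure.isAddLeftInvariant_eq_smul (volume : Measure (Pt d)) (Measure.hausdorffMeasure d)]
  have := hK.hausdorffMeasure_preimage_le (d := d) (by positivity) (A ∩ Ω)
  simp only [Measure.smul_apply, smul_eq_mul, ENNReal.smul_def, ENNReal.coe_pow]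
  rw [ENNReal.rpow_natCast] at this
  calc _ ≤ _ := mul_le_mul_right this _
    _ = _ := by ring

variable {K : ℝ≥0} {ψ : Pt d → Pt d} {E : Type*} [NormedAddCommGroup E]

theorem IsBoundedMap.quasiMeasurePreserving (h : IsBoundedMap Ω K ψ) :
    Measure.QuasiMeasurePreserving ψ (volume.restrict Ω) (volume.restrict Ω) :=
  ⟨h.measurable, (Measure.absolutelyContinuous_of_le h.map_le).trans
    (Measure.smul_absolutelyContinuous)⟩

theorem IsBoundedMap.eLpNorm_comp_le (h : IsBoundedMap Ω K ψ) {f : Pt d → E}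
    (hf : AEStronglyMeasurable f (volume.restrict Ω)) :
    eLpNorm (fun x => f (ψ x)) 2 (volume.restrict Ω) ≤
      (K : ℝ≥0∞) ^ (1 / 2 : ℝ) * eLpNorm f 2 (volume.restrict Ω) := by
  have h1 : eLpNorm (fun x => f (ψ x)) 2 (volume.restrict Ω)
      = eLpNorm f 2 ((volume.restrict Ω).map ψ) :=
    (eLpNorm_map_measure (hf.mono_ac h.quasiMeasurePreserving.absolutelyContinuous)
      h.measurable.aemeasurable).symm
  rw [h1]
  refine (eLpNorm_mono_measure f h.map_le).trans ?_
  rw [eLpNorm_smul_measure_of_ne_top (by norm_num)]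
  simp

theorem IsBoundedMap.memLp_comp (h : IsBoundedMap Ω K ψ) {f : Pt d → E}
    (hf : MemLp f 2 (volume.restrict Ω)) : MemLp (fun x => f (ψ x)) 2 (volume.restrict Ω) :=
  ⟨hf.1.comp_quasiMeasurePreserving h.quasiMeasurePreserving,
    (h.eLpNorm_comp_le hf.1).trans_lt (ENNReal.mul_lt_top
      (ENNReal.rpow_lt_top_of_nonneg (by norm_num) ENNReal.coe_ne_top) hf.2)⟩

/-- Strong continuity of composition in `L²(Ω)`. -/
theorem tendsto_eLpNorm_comp_sub [NormedSpace ℝ E] (hΩ : Bornology.IsBounded Ω)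
    {ψ : ℕ → Pt d → Pt d} {ψ₀ : Pt d → Pt d}
    (hψ : ∀ n, IsBoundedMap Ω K (ψ n)) (hψ₀ : IsBoundedMap Ω K ψ₀)
    (hlim : ∀ᵐ x ∂(volume.restrict Ω), Tendsto (fun n => ψ n x) atTop (𝓝 (ψ₀ x)))
    {f : Pt d → E} (hf : MemLp f 2 (volume.restrict Ω)) :
    Tendsto (fun n => eLpNorm (fun x => f (ψ n x) - f (ψ₀ x)) 2 (volume.restrict Ω))
      atTop (𝓝 0) := by
  have : IsFiniteMeasure ((volume : Measure (Pt d)).restrict Ω) :=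
    isFiniteMeasure_restrict.2 hΩ.measure_lt_top.ne
  -- The added `1` keeps `B` nonzero, so that division by it is harmless when `K = 0`.
  set B : ℝ≥0∞ := (K : ℝ≥0∞) ^ (1 / 2 : ℝ) + 1 with hB
  have hBtop : B ≠ ∞ := by
    simp [hB]
  have hB0 : B ≠ 0 := by simp [hB]
  rw [ENNReal.tendsto_nhds_zero]
  intro ε hε
  -- Pointwise convergence of `ψ n` says nothing about a discontinuous `f`. The common bound `K`
  -- makes the error of a continuous approximation uniform in `n`, leaving dominated convergence for
  -- `g`.
  obtain ⟨g, hg, hgm⟩ := hf.exists_boundedContinuous_eLpNorm_sub_le (p := 2) (by norm_num)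
    (ε := ε / 3 / B) (by
      refine (ENNReal.div_pos (ENNReal.div_pos hε.ne' (by norm_num)).ne' hBtop).ne')
  have hsmall : ∀ φ : Pt d → Pt d, IsBoundedMap Ω K φ →
      eLpNorm (fun x => f (φ x) - g (φ x)) 2 (volume.restrict Ω) ≤ ε / 3 := by
    intro φ hφ
    calc _ ≤ (K : ℝ≥0∞) ^ (1 / 2 : ℝ) * eLpNorm (f - ⇑g) 2 (volume.restrict Ω) :=
          hφ.eLpNorm_comp_le (f := f - ⇑g) (hf.1.sub hgm.1)
      _ ≤ B * (ε / 3 / B) := mul_le_mul' le_self_add hg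
      _ = ε / 3 := ENNReal.mul_div_cancel hB0 hBtop
  have hgc : ∀ φ : Pt d → Pt d, IsBoundedMap Ω K φ →
      AEStronglyMeasurable (fun x => g (φ x)) (volume.restrict Ω) := fun φ hφ =>
    hgm.1.comp_quasiMeasurePreserving hφ.quasiMeasurePreserving
  have hfc : ∀ φ : Pt d → Pt d, IsBoundedMap Ω K φ →
      AEStronglyMeasurable (fun x => f (φ x)) (volume.restrict Ω) := fun φ hφ =>
    hf.1.comp_quasiMeasurePreserving hφ.quasiMeasurePreserving
  have hmid : Tendsto (fun n => eLpNorm (fun x => g (ψ n x) - g (ψ₀ x)) 2 (volume.restrict Ω))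
      atTop (𝓝 0) := by
    refine tendsto_eLpNorm_zero_of_dominated (g := fun _ => ‖g‖ + ‖g‖)
      (fun n => (hgc _ (hψ n)).sub (hgc _ hψ₀)) (memLp_const _)
      (fun n => Eventually.of_forall fun x => (norm_sub_le _ _).trans
        (add_le_add (g.norm_coe_le_norm _) (g.norm_coe_le_norm _))) ?_
    filter_upwards [hlim] with x hx
    have := ((g.continuous.tendsto _).comp hx).sub_const (g (ψ₀ x))
    simpa using this
  filter_upwards [(ENNReal.tendsto_nhds_zero.1 hmid) (ε / 3)
    (ENNReal.div_pos hε.ne' (by norm_num))] with n hn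
  have hsplit : (fun x => f (ψ n x) - f (ψ₀ x)) = ((fun x => f (ψ n x) - g (ψ n x)) +
      fun x => g (ψ n x) - g (ψ₀ x)) - fun x => f (ψ₀ x) - g (ψ₀ x) := by
    funext x; simp only [Pi.add_apply, Pi.sub_apply]; abel
  rw [hsplit]
  have hm1 := (hfc _ (hψ n)).sub (hgc _ (hψ n))
  have hm2 := (hgc _ (hψ n)).sub (hgc _ hψ₀)
  have hm3 := (hfc _ hψ₀).sub (hgc _ hψ₀)
  calc _ ≤ eLpNorm ((fun x => f (ψ n x) - g (ψ n x)) + fun x => g (ψ n x) - g (ψ₀ x)) 2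
          (volume.restrict Ω) + eLpNorm (fun x => f (ψ₀ x) - g (ψ₀ x)) 2 (volume.restrict Ω) :=
        eLpNorm_sub_le (hm1.add hm2) hm3 (by norm_num)
    _ ≤ (ε / 3 + ε / 3) + ε / 3 := by
        refine add_le_add ((eLpNorm_add_le hm1 hm2 (by norm_num)).trans
          (add_le_add (hsmall _ (hψ n)) hn)) (hsmall _ hψ₀)
    _ = ε := ENNReal.add_thirds ε

theorem IsBoundedMap.coeFn_compImage (h : IsBoundedMap Ω K ψ) (f : ImageSpace Ω) :
    compImage f ψ =ᵐ[volume.restrict Ω] fun x => f (ψ x) := by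
  rw [compImage, dif_pos (h.memLp_comp (Lp.memLp f))]
  exact MemLp.coeFn_toLp _

theorem IsBoundedMap.compImage_sub (h : IsBoundedMap Ω K ψ) (f g : ImageSpace Ω) :
    compImage (f - g) ψ = compImage f ψ - compImage g ψ := by
  refine Lp.ext ?_
  filter_upwards [h.coeFn_compImage (f - g), h.coeFn_compImage f, h.coeFn_compImage g,
    Lp.coeFn_sub (compImage f ψ) (compImage g ψ),
    h.quasiMeasurePreserving.ae_eq_comp (Lp.coeFn_sub f g)] with x h1 h2 h3 h4 h5
  have h5' : (f - g : ImageSpace Ω) (ψ x) = f (ψ x) - g (ψ x) := h5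
  rw [h1, h4, Pi.sub_apply, h2, h3, h5']

theorem IsBoundedMap.norm_compImage_le (h : IsBoundedMap Ω K ψ) (f : ImageSpace Ω) :
    ‖compImage f ψ‖ ≤ (K : ℝ) ^ (1 / 2 : ℝ) * ‖f‖ := by
  rw [Lp.norm_def, Lp.norm_def, eLpNorm_congr_ae (h.coeFn_compImage f)]
  have h1 := h.eLpNorm_comp_le (Lp.memLp f).1
  have h2 := ENNReal.toReal_mono (ENNReal.mul_ne_top
    (ENNReal.rpow_ne_top_of_nonneg (by norm_num) ENNReal.coe_ne_top) (Lp.memLp f).2.ne) h1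
  simpa [ENNReal.toReal_mul, ← ENNReal.toReal_rpow] using h2

theorem tendsto_compImage (hΩ : Bornology.IsBounded Ω)
    {ψ : ℕ → Pt d → Pt d} {ψ₀ : Pt d → Pt d}
    (hψ : ∀ n, IsBoundedMap Ω K (ψ n)) (hψ₀ : IsBoundedMap Ω K ψ₀)
    (hlim : ∀ᵐ x ∂(volume.restrict Ω), Tendsto (fun n => ψ n x) atTop (𝓝 (ψ₀ x)))
    {f : ℕ → ImageSpace Ω} {f₀ : ImageSpace Ω} (hf : Tendsto f atTop (𝓝 f₀)) :
    Tendsto (fun n => compImage (f n) (ψ n)) atTop (𝓝 (compImage f₀ ψ₀)) := by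
  have h1 : Tendsto (fun n => compImage f₀ (ψ n)) atTop (𝓝 (compImage f₀ ψ₀)) := by
    rw [Lp.tendsto_Lp_iff_tendsto_eLpNorm']
    refine (tendsto_eLpNorm_comp_sub hΩ hψ hψ₀ hlim (Lp.memLp f₀)).congr fun n => ?_
    refine eLpNorm_congr_ae ?_
    filter_upwards [(hψ n).coeFn_compImage f₀, hψ₀.coeFn_compImage f₀] with x h1 h2
    rw [Pi.sub_apply, h1, h2]
  have h2 : Tendsto (fun n => compImage (f n) (ψ n) - compImage f₀ (ψ n)) atTop (𝓝 0) := by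
    refine squeeze_zero_norm (a := fun n => (K : ℝ) ^ (1 / 2 : ℝ) * ‖f n - f₀‖) (fun n => ?_) ?_
    · rw [← (hψ n).compImage_sub]
      exact (hψ n).norm_compImage_le _
    · simpa using (tendsto_iff_norm_sub_tendsto_zero.1 hf).const_mul ((K : ℝ) ^ (1 / 2 : ℝ))
  simpa using h2.add h1

/-! ### Multiplication by bounded functions -/

open Classical in
/-- The image `w f`, for a bounded measurable function `w`. -/
def mulImage (w : Pt d → ℝ) (f : ImageSpace Ω) : ImageSpace Ω :=
  if h : MemLp (fun x => w x * f x) 2 ((volume : Measure (Pt d)).restrict Ω) then h.toLp _ else 0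

theorem memLp_mul_image {w : Pt d → ℝ} {B : ℝ} (hw : AEStronglyMeasurable w (volume.restrict Ω))
    (hB : ∀ x, |w x| ≤ B) (f : ImageSpace Ω) :
    MemLp (fun x => w x * f x) 2 ((volume : Measure (Pt d)).restrict Ω) :=
  (Lp.memLp f).of_le_mul (c := B) (hw.mul (Lp.memLp f).1) (Eventually.of_forall fun x => by
    rw [norm_mul]; exact mul_le_mul_of_nonneg_right (hB x) (norm_nonneg _))

theorem coeFn_mulImage {w : Pt d → ℝ} {B : ℝ} (hw : AEStronglyMeasurable w (volume.restrict Ω))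
    (hB : ∀ x, |w x| ≤ B) (f : ImageSpace Ω) :
    mulImage w f =ᵐ[volume.restrict Ω] fun x => w x * f x := by
  rw [mulImage, dif_pos (memLp_mul_image hw hB f)]
  exact MemLp.coeFn_toLp _

theorem mulImage_sub {w : Pt d → ℝ} {B : ℝ} (hw : AEStronglyMeasurable w (volume.restrict Ω))
    (hB : ∀ x, |w x| ≤ B) (f g : ImageSpace Ω) :
    mulImage w (f - g) = mulImage w f - mulImage w g := by
  refine Lp.ext ?_
  filter_upwards [coeFn_mulImage hw hB (f - g), coeFn_mulImage hw hB f, coeFn_mulImage hw hB g,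
    Lp.coeFn_sub (mulImage w f) (mulImage w g), Lp.coeFn_sub f g] with x h1 h2 h3 h4 h5
  rw [h1, h4, Pi.sub_apply, h2, h3, h5, Pi.sub_apply, mul_sub]

theorem norm_mulImage_le {w : Pt d → ℝ} {B : ℝ} (hw : AEStronglyMeasurable w (volume.restrict Ω))
    (hB : ∀ x, |w x| ≤ B) (f : ImageSpace Ω) : ‖mulImage w f‖ ≤ B * ‖f‖ := by
  refine Lp.norm_le_mul_norm_of_ae_le_mul ?_
  filter_upwards [coeFn_mulImage hw hB f] with x hx
  rw [hx, norm_mul]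
  exact mul_le_mul_of_nonneg_right (hB x) (norm_nonneg _)

theorem tendsto_mulImage {w : ℕ → Pt d → ℝ} {w₀ : Pt d → ℝ} {B : ℝ}
    (hw : ∀ n, AEStronglyMeasurable (w n) (volume.restrict Ω))
    (hw₀ : AEStronglyMeasurable w₀ (volume.restrict Ω))
    (hB : ∀ n x, |w n x| ≤ B) (hB₀ : ∀ x, |w₀ x| ≤ B)
    (hlim : ∀ᵐ x ∂(volume.restrict Ω), Tendsto (fun n => w n x) atTop (𝓝 (w₀ x)))
    {f : ℕ → ImageSpace Ω} {f₀ : ImageSpace Ω} (hf : Tendsto f atTop (𝓝 f₀)) :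
    Tendsto (fun n => mulImage (w n) (f n)) atTop (𝓝 (mulImage w₀ f₀)) := by
  have h1 : Tendsto (fun n => mulImage (w n) f₀) atTop (𝓝 (mulImage w₀ f₀)) := by
    rw [Lp.tendsto_Lp_iff_tendsto_eLpNorm']
    refine (tendsto_eLpNorm_zero_of_dominated (F := fun n x => (w n x - w₀ x) * f₀ x)
      (g := fun x => (B + B) * ‖f₀ x‖)
      (fun n => ((hw n).sub hw₀).mul (Lp.memLp f₀).1) ((Lp.memLp f₀).norm.const_mul _)
      (fun n => Eventually.of_forall fun x => ?_) ?_).congr fun n => ?_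
    · rw [norm_mul]
      exact mul_le_mul_of_nonneg_right ((norm_sub_le _ _).trans (add_le_add (hB n x) (hB₀ x)))
        (norm_nonneg _)
    · filter_upwards [hlim] with x hx
      simpa using (hx.sub_const (w₀ x)).mul_const (f₀ x)
    · refine eLpNorm_congr_ae ?_
      filter_upwards [coeFn_mulImage (hw n) (hB n) f₀, coeFn_mulImage hw₀ hB₀ f₀] with x h1 h2
      rw [Pi.sub_apply, h1, h2, sub_mul]
  have h2 : Tendsto (fun n => mulImage (w n) (f n) - mulImage (w n) f₀) atTop (𝓝 0) := by
    refine squeeze_zero_norm (a := fun n => B * ‖f n - f₀‖) (fun n => ?_) ?_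
    · rw [← mulImage_sub (hw n) (hB n)]
      exact norm_mulImage_le (hw n) (hB n) _
    · simpa using (tendsto_iff_norm_sub_tendsto_zero.1 hf).const_mul B
  simpa using h2.add h1

/-! ### Determinants of bounded invertible maps -/

/-- `|det M|` is the ratio of volumes of the image of the unit ball and the unit ball, and that
image lies in a ball of radius `G`. -/
theorem abs_det_le_of_norm_le {M : Pt d →L[ℝ] Pt d} {G : ℝ} (hG : 0 < G)
    (hM : ∀ h, ‖M h‖ ≤ G * ‖h‖) : |M.det| ≤ G ^ d := by
  have hsub : M '' Metric.ball 0 1 ⊆ Metric.ball 0 G := by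
    rintro _ ⟨h, hh, rfl⟩
    rw [mem_ball_zero_iff] at hh ⊢
    exact (hM h).trans_lt (by nlinarith)
  have h1 := measure_mono (μ := volume) hsub
  rw [Measure.addHaar_image_continuousLinearMap, Measure.addHaar_ball_of_pos _ _ hG] at h1
  have h2 := (ENNReal.mul_le_mul_iff_left (Metric.measure_ball_pos volume (0 : Pt d) one_pos).ne'
    measure_ball_lt_top.ne).1 h1
  rw [ENNReal.ofReal_le_ofReal_iff (by positivity)] at h2
  simpa using h2

/-- The same volume comparison, now for the preimage of the unit ball. -/
theorem abs_det_inv_le_of_le_norm {M : Pt d →L[ℝ] Pt d} {G : ℝ} (hG : 0 < G)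
    (hM : ∀ h, ‖h‖ ≤ G * ‖M h‖) : M.det ≠ 0 ∧ |M.det|⁻¹ ≤ G ^ d := by
  have hinj : Function.Injective M := by
    rw [injective_iff_map_eq_zero]
    intro h hh
    simpa [hh] using hM h
  have hdet : LinearMap.det (M : Pt d →ₗ[ℝ] Pt d) ≠ 0 := by
    intro h0
    exact (LinearMap.bot_lt_ker_of_det_eq_zero h0).ne'
      (LinearMap.ker_eq_bot.2 hinj)
  refine ⟨hdet, ?_⟩
  have hsub : M ⁻¹' Metric.ball 0 1 ⊆ Metric.ball 0 G := by
    intro h hh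
    rw [mem_preimage, mem_ball_zero_iff] at hh
    rw [mem_ball_zero_iff]
    exact (hM h).trans_lt (by nlinarith)
  have h1 := measure_mono (μ := volume) hsub
  rw [Measure.addHaar_preimage_continuousLinearMap _ hdet,
    Measure.addHaar_ball_of_pos _ _ hG] at h1
  have h2 := (ENNReal.mul_le_mul_iff_left (Metric.measure_ball_pos volume (0 : Pt d) one_pos).ne'
    measure_ball_lt_top.ne).1 h1
  rw [ENNReal.ofReal_le_ofReal_iff (by positivity), abs_inv] at h2
  simpa using h2

theorem norm_le_of_hasFDerivAt {φ : Pt d → Pt d} {M : Pt d →L[ℝ] Pt d} {x : Pt d} {G : ℝ}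
    (hφ : HasFDerivAt φ M x) (hG : ∀ y z, ‖y - z‖ ≤ G * ‖φ y - φ z‖) (h : Pt d) :
    ‖h‖ ≤ G * ‖M h‖ := by
  have hc : Tendsto (fun n : ℕ => ‖((n : ℝ) + 1)‖) atTop atTop :=
    tendsto_norm_atTop_atTop.comp (tendsto_atTop_add_const_right _ _ tendsto_natCast_atTop_atTop)
  have hlim := hφ.lim h hc
  refine ge_of_tendsto (hlim.norm.const_mul G) (Eventually.of_forall fun n => ?_)
  have hn : (0 : ℝ) < (n : ℝ) + 1 := by positivity
  rw [norm_smul, Real.norm_of_nonneg hn.le]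
  have h1 := hG (x + ((n : ℝ) + 1)⁻¹ • h) x
  rw [add_sub_cancel_left, norm_smul, norm_inv, Real.norm_of_nonneg hn.le] at h1
  calc ‖h‖ = ((n : ℝ) + 1) * (((n : ℝ) + 1)⁻¹ * ‖h‖) := by field_simp
    _ ≤ ((n : ℝ) + 1) * (G * ‖φ (x + ((n : ℝ) + 1)⁻¹ • h) - φ x‖) :=
        mul_le_mul_of_nonneg_left h1 hn.le
    _ = _ := by ring

/-! ### Duality -/

theorem inner_image_eq (f g : ImageSpace Ω) :
    inner ℝ f g = ∫ x in Ω, f x * g x := by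
  rw [L2.inner_def]
  simp [mul_comm]

/-- Change of variables `y = φ x`, with `φ` mapping `Ω` onto itself. -/
theorem inner_compImage_inverse (hΩ : MeasurableSet Ω) {φ χ : Pt d → Pt d} {B : ℝ} {K : ℝ≥0}
    (hφ : IsBoundedMap Ω K φ) (hχ : IsBoundedMap Ω K χ) (hl : Function.LeftInverse χ φ)
    (hr : Function.RightInverse χ φ) (hpre : φ ⁻¹' Ω = Ω)
    (hder : ∀ x, HasFDerivAt φ (fderiv ℝ φ x) x) (hB : ∀ x, |(fderiv ℝ φ x).det| ≤ B)
    (hm : Measurable fun x => |(fderiv ℝ φ x).det|)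
    (f g : ImageSpace Ω) :
    inner ℝ (compImage f χ) g
      = inner ℝ f (mulImage (fun x => |(fderiv ℝ φ x).det|) (compImage g φ)) := by
  have himg : φ '' Ω = Ω := by
    conv_lhs => rw [← hpre]
    exact image_preimage_eq _ hr.surjective
  rw [inner_image_eq, inner_image_eq]
  calc ∫ x in Ω, compImage f χ x * g x = ∫ x in Ω, f (χ x) * g x := by
        refine integral_congr_ae ?_
        filter_upwards [hχ.coeFn_compImage f] with x hx
        rw [hx]
    _ = ∫ x in φ '' Ω, f (χ x) * g x := by rw [himg]
    _ = ∫ x in Ω, |(fderiv ℝ φ x).det| • (f (χ (φ x)) * g (φ x)) :=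
        integral_image_eq_integral_abs_det_fderiv_smul _ hΩ
          (fun x _ => (hder x).hasFDerivWithinAt) hl.injective.injOn _
    _ = _ := by
        refine integral_congr_ae ?_
        filter_upwards [hφ.coeFn_compImage g, coeFn_mulImage hm.aestronglyMeasurable
          (fun x => (abs_abs _).trans_le (hB x)) (compImage g φ)] with x h1 h2
        rw [h2, h1, hl x, smul_eq_mul]
        ring

/-- The previous identity is applied to `g` divided by the Jacobian, and the two weights cancel. In
this way no derivative of the inverse `χ` is needed. -/
theorem inner_compImage (hΩ : MeasurableSet Ω) {φ χ : Pt d → Pt d} {B : ℝ} {K : ℝ≥0}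
    (hφ : IsBoundedMap Ω K φ) (hχ : IsBoundedMap Ω K χ) (hl : Function.LeftInverse χ φ)
    (hr : Function.RightInverse χ φ) (hpre : φ ⁻¹' Ω = Ω)
    (hder : ∀ x, HasFDerivAt φ (fderiv ℝ φ x) x) (hB : ∀ x, |(fderiv ℝ φ x).det| ≤ B)
    (hdet : ∀ x, (fderiv ℝ φ x).det ≠ 0) (hB' : ∀ x, |(fderiv ℝ φ x).det|⁻¹ ≤ B)
    (hm : Measurable fun x => |(fderiv ℝ φ x).det|) (f g : ImageSpace Ω) :
    inner ℝ (compImage f φ) g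
      = inner ℝ f (compImage (mulImage (fun x => |(fderiv ℝ φ x).det|⁻¹) g) χ) := by
  rw [real_inner_comm _ f, inner_compImage_inverse hΩ hφ hχ hl hr hpre hder hB hm, real_inner_comm,
    inner_image_eq, inner_image_eq]
  refine integral_congr_ae ?_
  filter_upwards [coeFn_mulImage hm.aestronglyMeasurable
      (fun x => (abs_abs _).trans_le (hB x)) (compImage f φ),
    coeFn_mulImage hm.inv.aestronglyMeasurable
      (fun x => by rw [Pi.inv_apply, abs_inv, abs_abs]; exact hB' x) g] with x h1 h2
  have h2' : mulImage (fun x => |(fderiv ℝ φ x).det|⁻¹) g x = |(fderiv ℝ φ x).det|⁻¹ * g x := h2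
  rw [h1, h2']
  have := abs_ne_zero.2 (hdet x)
  field_simp

end Composition

/-! ### Weak limits of fields: flows and Riesz representatives. -/

section WeakLimits

variable {d : ℕ} {V : Type*} [NormedAddCommGroup V] [InnerProductSpace ℝ V]

/-- The integral is a bounded linear map of the field with finite-dimensional values. Measurability
is required only of the integrands, since `β` is an arbitrary family. -/
theorem WeaklyTendsto.tendsto_intervalIntegral {E : Type*} [NormedAddCommGroup E] [NormedSpace ℝ E]
    [FiniteDimensional ℝ E] {β : ℝ → V →ₗ[ℝ] E} {B : ℝ}
    (hβ : ∀ s ∈ Icc (0 : ℝ) 1, ∀ w, ‖β s w‖ ≤ B * ‖w‖)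
    (hm : ∀ u : L2Time V, AEStronglyMeasurable (fun s => β s (u s))
      (volume.restrict (Icc (0 : ℝ) 1)))
    {u : ℕ → L2Time V} {u₀ : L2Time V} (hu : WeaklyTendsto u u₀) {t : ℝ}
    (ht : t ∈ Icc (0 : ℝ) 1) :
    Tendsto (fun n => ∫ s in (0 : ℝ)..t, β s (u n s)) atTop
      (𝓝 (∫ s in (0 : ℝ)..t, β s (u₀ s))) := by
  have h0 : (0 : ℝ) ∈ Icc (0 : ℝ) 1 := by simp
  have hsub : Ioc 0 t ⊆ Icc (0 : ℝ) 1 := fun s hs => ⟨hs.1.le, hs.2.trans ht.2⟩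
  have hB : ∀ w : L2Time V, ∀ᵐ s ∂(volume.restrict (Icc (0 : ℝ) 1)), ‖β s (w s)‖ ≤ B * ‖w s‖ :=
    fun w => (ae_restrict_mem measurableSet_Icc).mono fun s hs => hβ s hs _
  have hint : ∀ w : L2Time V, IntegrableOn (fun s => β s (w s)) (Icc (0 : ℝ) 1) := fun w =>
    (w.integrableOn_norm.const_mul B).mono' (hm w) (hB w)
  have hae : ∀ {P : ℝ → Prop}, (∀ᵐ s ∂(volume.restrict (Icc (0 : ℝ) 1)), P s) →
      ∀ᵐ s ∂(volume.restrict (Ioc 0 t)), P s := fun hP =>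
    ae_mono (Measure.restrict_mono hsub le_rfl) hP
  let f : L2Time V →ₗ[ℝ] E :=
    { toFun := fun w => ∫ s in Ioc 0 t, β s (w s)
      map_add' := by
        intro w w'
        rw [← integral_add ((hint w).mono_set hsub) ((hint w').mono_set hsub)]
        refine integral_congr_ae ?_
        filter_upwards [hae (Lp.coeFn_add w w')] with s hs
        rw [hs, Pi.add_apply, map_add]
      map_smul' := by
        intro c w
        rw [RingHom.id_apply, ← integral_smul]
        refine integral_congr_ae ?_
        filter_upwards [hae (Lp.coeFn_smul c w)] with s hs
        rw [hs, Pi.smul_apply, map_smul] }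
  have hbound : ∀ w, ‖f w‖ ≤ |B| * ‖w‖ := by
    intro w
    calc ‖f w‖ ≤ ∫ s in Ioc 0 t, ‖β s (w s)‖ := norm_integral_le_integral_norm _
      _ ≤ ∫ s in Icc (0 : ℝ) 1, ‖β s (w s)‖ :=
          setIntegral_mono_set (hint w).norm (Eventually.of_forall fun _ => norm_nonneg _)
            hsub.eventuallyLE
      _ ≤ ∫ s in Icc (0 : ℝ) 1, |B| * ‖w s‖ := by
          refine integral_mono_ae (hint w).norm (w.integrableOn_norm.const_mul _) ?_
          filter_upwards [hB w] with s hs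
          exact hs.trans (mul_le_mul_of_nonneg_right (le_abs_self _) (norm_nonneg _))
      _ = |B| * ∫ s in Icc (0 : ℝ) 1, ‖w s‖ := integral_const_mul _ _
      _ ≤ _ := mul_le_mul_of_nonneg_left w.setIntegral_norm_le (abs_nonneg _)
  have := hu.map_clm_finiteDimensional (f.mkContinuous |B| hbound)
  simp only [intervalIntegral.integral_of_le ht.1]
  exact this

theorem L2Time.setIntegral_norm_mul_le {H : Type*} [NormedAddCommGroup H]
    [InnerProductSpace ℝ H] (u : L2Time H) {ρ : ℝ → ℝ} (hρ0 : ∀ s, 0 ≤ ρ s)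
    (hρ : MemLp ρ 2 (volume.restrict (Icc (0 : ℝ) 1))) :
    ∫ s in Icc (0 : ℝ) 1, ‖u s‖ * ρ s ≤ ‖u‖ * √(∫ s in Icc (0 : ℝ) 1, ρ s ^ 2) := by
  have h1 := integral_mul_le_Lp_mul_Lq_of_nonneg (μ := volume.restrict (Icc (0 : ℝ) 1))
    (p := 2) (q := 2) (f := fun s => ‖u s‖) (g := ρ)
    Real.HolderConjugate.two_two (Eventually.of_forall fun s => norm_nonneg _)
    (Eventually.of_forall fun s => hρ0 s) (by simpa using (Lp.memLp u).norm)
    (by simpa using hρ)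
  have h2 : ((∫ s in Icc (0 : ℝ) 1, ‖u s‖ ^ 2) ^ (2⁻¹ : ℝ)) = ‖u‖ := by
    rw [← L2Time.norm_sq_eq, ← one_div, ← Real.sqrt_eq_rpow, Real.sqrt_sq (norm_nonneg _)]
  simpa [h2, Real.sqrt_eq_rpow] using h1

theorem memLp_unit_of_continuousOn {E : Type*} [NormedAddCommGroup E] {f : ℝ → E}
    (hf : ContinuousOn f (Icc (0 : ℝ) 1)) : MemLp f 2 (volume.restrict (Icc (0 : ℝ) 1)) := by
  obtain ⟨B, hB⟩ := isCompact_Icc.exists_bound_of_continuousOn hf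
  exact MemLp.of_bound (hf.aestronglyMeasurable_of_isCompact isCompact_Icc measurableSet_Icc) B
    ((ae_restrict_mem measurableSet_Icc).mono hB)

/-- Stability of integral inequalities under perturbations that vanish pointwise. -/
theorem tendsto_zero_of_gronwall {v : ℕ → L2Time V} {R C B : ℝ} (hC : 0 ≤ C)
    (hR : ∀ n, ‖v n‖ ≤ R) {z ρ : ℕ → ℝ → ℝ}
    (hz : ∀ n, ContinuousOn (z n) (Icc 0 1)) (hz0 : ∀ n t, 0 ≤ z n t)
    (hρ : ∀ n, ContinuousOn (ρ n) (Icc 0 1)) (hρ0 : ∀ n t, 0 ≤ ρ n t)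
    (hρB : ∀ n, ∀ t ∈ Icc (0 : ℝ) 1, ρ n t ≤ B)
    (hρlim : ∀ t ∈ Icc (0 : ℝ) 1, Tendsto (fun n => ρ n t) atTop (𝓝 0))
    (h : ∀ n, ∀ t ∈ Icc (0 : ℝ) 1, z n t ≤ ρ n t + ∫ s in uIoc 0 t, C * ‖v n s‖ * z n s)
    {t : ℝ} (ht : t ∈ Icc (0 : ℝ) 1) : Tendsto (fun n => z n t) atTop (𝓝 0) := by
  -- The perturbations need not vanish uniformly in time. Bounded pointwise convergence makes their
  -- `L²` norms vanish, which suffices against the bounded `L²` norms of the coefficients.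
  have hint : Tendsto (fun n => ∫ s in Icc (0 : ℝ) 1, ρ n s ^ 2) atTop
      (𝓝 (∫ s in Icc (0 : ℝ) 1, (0 : ℝ))) := by
    refine tendsto_integral_of_dominated_convergence (fun _ => B ^ 2)
      (fun n => ((hρ n).pow 2).aestronglyMeasurable_of_isCompact isCompact_Icc measurableSet_Icc)
      (integrable_const _) (fun n => ?_) ?_
    · filter_upwards [ae_restrict_mem measurableSet_Icc] with s hs
      rw [Real.norm_of_nonneg (sq_nonneg _)]
      exact pow_le_pow_left₀ (hρ0 n s) (hρB n s hs) 2
    · filter_upwards [ae_restrict_mem measurableSet_Icc] with s hs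
      simpa using (hρlim s hs).pow 2
  have hsqrt : Tendsto (fun n => ρ n t + gronwallConst (C * R) *
      (C * (R * √(∫ s in Icc (0 : ℝ) 1, ρ n s ^ 2)))) atTop (𝓝 0) := by
    have h1 := (Real.continuous_sqrt.tendsto _).comp hint
    have h2 := (hρlim t ht).add (((h1.const_mul R).const_mul C).const_mul (gronwallConst (C * R)))
    simpa [Function.comp_def] using h2
  refine squeeze_zero (fun n => hz0 n t) (fun n => ?_) hsqrt
  refine (le_add_gronwallConst_mul ((v n).memLp_mul_norm C)
    (fun s => mul_nonneg hC (norm_nonneg _)) (L2Time.setIntegral_mul_norm_sq_le (hR n) C) (hz n)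
    (hρ n) (hρ0 n) (h n) ht).trans (add_le_add le_rfl ?_)
  refine mul_le_mul_of_nonneg_left ?_ (gronwallConst_pos _).le
  simp_rw [mul_assoc]
  rw [integral_const_mul]
  refine mul_le_mul_of_nonneg_left ?_ hC
  exact ((v n).setIntegral_norm_mul_le (hρ0 n) (memLp_unit_of_continuousOn (hρ n))).trans
    (mul_le_mul_of_nonneg_right (hR n) (Real.sqrt_nonneg _))

theorem continuousOn_primitive_unit {E : Type*} [NormedAddCommGroup E] [NormedSpace ℝ E]
    {f : ℝ → E} (hf : IntegrableOn f (Icc (0 : ℝ) 1)) :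
    ContinuousOn (fun t => ∫ s in (0 : ℝ)..t, f s) (Icc 0 1) := by
  have := intervalIntegral.continuousOn_primitive_interval (μ := volume) (a := 0) (b := 1) (f := f)
    (by rwa [uIcc_of_le zero_le_one])
  rwa [uIcc_of_le zero_le_one] at this

theorem norm_intervalIntegral_unit_le {E : Type*} [NormedAddCommGroup E] [NormedSpace ℝ E]
    {f : ℝ → E} (hf : IntegrableOn f (Icc (0 : ℝ) 1)) {t : ℝ} (ht : t ∈ Icc (0 : ℝ) 1) :
    ‖∫ s in (0 : ℝ)..t, f s‖ ≤ ∫ s in Icc (0 : ℝ) 1, ‖f s‖ :=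
  intervalIntegral.norm_integral_le_integral_norm_uIoc.trans
    (setIntegral_mono_set hf.norm (Eventually.of_forall fun _ => norm_nonneg _)
      (uIoc_subset_Icc_unit (by simp) ht).eventuallyLE)

variable {ι : V →ₗ[ℝ] (Pt d → Pt d)} {C : ℝ}

/-- Flows depend continuously on the field, weakly in `L²([0,1], V)`. -/
theorem IsC1Bounded.tendsto_flow (h : IsC1Bounded ι C) {v : ℕ → L2Time V} {v₀ : L2Time V}
    {R : ℝ} (hR : ∀ n, ‖v n‖ ≤ R) (hv : WeaklyTendsto v v₀) (x : Pt d) {t : ℝ}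
    (ht : t ∈ Icc (0 : ℝ) 1) :
    Tendsto (fun n => flow ι (v n) t x) atTop (𝓝 (flow ι v₀ t x)) := by
  have h0 : (0 : ℝ) ∈ Icc (0 : ℝ) 1 := by simp
  have hc₀ := h.continuousOn_flow v₀ x
  have hc := fun n => h.continuousOn_flow (v n) x
  have hi : ∀ w : L2Time V, IntegrableOn (fun s => ι (w s) (flow ι v₀ s x)) (Icc (0 : ℝ) 1) :=
    fun w => h.integrableOn_field w hc₀
  have hi' := fun n => h.integrableOn_field (v n) (hc n)
  have hint_le : ∀ w : L2Time V, ∀ s ∈ Icc (0 : ℝ) 1,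
      ‖∫ r in (0 : ℝ)..s, ι (w r) (flow ι v₀ r x)‖ ≤ C * ‖w‖ := by
    intro w s hs
    refine (norm_intervalIntegral_unit_le (hi w) hs).trans ?_
    calc ∫ r in Icc (0 : ℝ) 1, ‖ι (w r) (flow ι v₀ r x)‖
        ≤ ∫ r in Icc (0 : ℝ) 1, C * ‖w r‖ :=
          integral_mono (hi w).norm (w.integrableOn_norm.const_mul _) fun r => h.norm_le _ _
      _ = C * ∫ r in Icc (0 : ℝ) 1, ‖w r‖ := integral_const_mul _ _
      _ ≤ _ := mul_le_mul_of_nonneg_left w.setIntegral_norm_le h.nonneg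
  rw [tendsto_iff_norm_sub_tendsto_zero]
  refine tendsto_zero_of_gronwall (z := fun n s => ‖flow ι (v n) s x - flow ι v₀ s x‖)
    (ρ := fun n s => ‖(∫ r in (0 : ℝ)..s, ι (v n r) (flow ι v₀ r x)) -
      ∫ r in (0 : ℝ)..s, ι (v₀ r) (flow ι v₀ r x)‖) (B := C * R + C * ‖v₀‖) h.nonneg hR
    (fun n => ((hc n).sub hc₀).norm) (fun n s => norm_nonneg _)
    (fun n => ((continuousOn_primitive_unit (hi (v n))).sub
      (continuousOn_primitive_unit (hi v₀))).norm) (fun n s => norm_nonneg _)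
    (fun n s hs => ?_) (fun s hs => ?_) (fun n s hs => ?_) ht
  · refine (_root_.norm_sub_le _ _).trans (add_le_add ((hint_le _ s hs).trans ?_) (hint_le _ s hs))
    exact mul_le_mul_of_nonneg_left (hR n) h.nonneg
  · rw [← tendsto_iff_norm_sub_tendsto_zero]
    -- The fields are evaluated along the fixed limit trajectory, so the integral is a fixed linear
    -- functional of the field and weak convergence applies.
    let β : ℝ → V →ₗ[ℝ] Pt d := fun r => (LinearMap.proj (flow ι v₀ r x)).comp ι
    exact WeaklyTendsto.tendsto_intervalIntegral (β := β) (B := C) (fun r _ w => h.norm_le _ _)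
      (fun w => (hi w).aestronglyMeasurable) hv hs
  · have hII := fun w => IntegrableOn.intervalIntegrable_unit (hi w) h0 hs
    have hII' := IntegrableOn.intervalIntegrable_unit (hi' n) h0 hs
    have hsub := uIoc_subset_Icc_unit h0 hs
    -- Frozen perturbation plus a difference of the same field along two trajectories; the latter is
    -- absorbed by the Lipschitz bound.
    have key : flow ι (v n) s x - flow ι v₀ s x = ((∫ r in (0 : ℝ)..s, ι (v n r) (flow ι v₀ r x)) -
        ∫ r in (0 : ℝ)..s, ι (v₀ r) (flow ι v₀ r x)) +
        ∫ r in (0 : ℝ)..s, (ι (v n r) (flow ι (v n) r x) - ι (v n r) (flow ι v₀ r x)) := by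
      rw [intervalIntegral.integral_sub hII' (hII (v n)), h.flow_eq (v n) x hs, h.flow_eq v₀ x hs]
      abel
    refine (congrArg norm key).trans_le ((norm_add_le _ _).trans (add_le_add le_rfl ?_))
    refine intervalIntegral.norm_integral_le_integral_norm_uIoc.trans ?_
    refine integral_mono (((hi' n).sub (hi (v n))).mono_set hsub).norm
      ((integrableOn_mul_of_continuousOn ((v n).integrableOn_norm.const_mul C)
        ((hc n).sub hc₀).norm).mono_set hsub) fun r => h.norm_sub_le _ _ _

/-! ### Riesz representatives of the point derivatives -/

/-- The Riesz representatives of the coordinates of evaluation at a countable dense set have dense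
span: a vector orthogonal to all of them is a continuous field vanishing on a dense set. -/
theorem IsC1Bounded.separableSpace [CompleteSpace V] (h : IsC1Bounded ι C)
    (hinj : Function.Injective ι) : TopologicalSpace.SeparableSpace V := by
  let ev : Pt d → Fin d → V →L[ℝ] ℝ := fun x i =>
    (EuclideanSpace.proj i).comp (((LinearMap.proj x).comp ι).mkContinuous C
      (fun w => h.norm_le w x))
  let S : Set V := range fun q : ℕ × Fin d =>
    (InnerProductSpace.toDual ℝ V).symm (ev (TopologicalSpace.denseSeq (Pt d) q.1) q.2)
  have hS : TopologicalSpace.IsSeparable S := (countable_range _).isSeparable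
  have hbot : (Submodule.span ℝ S)ᗮ = ⊥ := by
    rw [Submodule.eq_bot_iff]
    intro w hw
    have h1 : ∀ m i, ι w (TopologicalSpace.denseSeq (Pt d) m) i = 0 := by
      intro m i
      have := hw _ (Submodule.subset_span ⟨(m, i), rfl⟩)
      rw [InnerProductSpace.toDual_symm_apply] at this
      exact this
    have h2 : ι w = fun _ => 0 := by
      refine Continuous.ext_on (TopologicalSpace.denseRange_denseSeq (Pt d))
        (h.contDiff w).continuous continuous_const ?_
      rintro _ ⟨m, rfl⟩
      ext i
      simpa using h1 m i
    exact hinj (by rw [h2, map_zero]; rfl)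
  have htop : closure (Submodule.span ℝ S : Set V) = univ := by
    have := Submodule.topologicalClosure_eq_top_iff.2 hbot
    rw [← Submodule.topologicalClosure_coe, this]
    rfl
  have : TopologicalSpace.IsSeparable (univ : Set V) := by
    rw [← htop]
    exact (hS.span (R := ℝ)).closure
  exact TopologicalSpace.isSeparable_univ_iff.1 this

theorem opNorm_le_sum_coord (A : Pt d →L[ℝ] Pt d) :
    ‖A‖ ≤ ∑ q : Fin d × Fin d, |A (EuclideanSpace.single q.2 1) q.1| := by
  refine A.opNorm_le_bound (Finset.sum_nonneg fun _ _ => abs_nonneg _) fun y => ?_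
  have hcoord : ∀ i, |A y i| ≤ (∑ j, |A (EuclideanSpace.single j 1) i|) * ‖y‖ := by
    intro i
    have hy : y = ∑ j, y j • EuclideanSpace.single j (1 : ℝ) := by
      ext k
      simp [Finset.sum_apply, Pi.single_apply]
    conv_lhs => rw [hy]
    rw [map_sum, Finset.sum_mul]
    have : (∑ j, A (y j • EuclideanSpace.single j (1 : ℝ))) i
        = ∑ j, y j * A (EuclideanSpace.single j (1 : ℝ)) i := by
      simp
    rw [this]
    refine (Finset.abs_sum_le_sum_abs _ _).trans (Finset.sum_le_sum fun j _ => ?_)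
    rw [abs_mul, mul_comm]
    exact mul_le_mul_of_nonneg_left (PiLp.norm_apply_le y j) (abs_nonneg _)
  calc ‖A y‖ ≤ ∑ i, |A y i| := by
        conv_lhs => rw [show A y = ∑ i, A y i • EuclideanSpace.single i (1 : ℝ) by
          ext k; simp [Pi.single_apply]]
        refine (norm_sum_le _ _).trans (Finset.sum_le_sum fun i _ => ?_)
        simp [norm_smul]
    _ ≤ ∑ i, (∑ j, |A (EuclideanSpace.single j 1) i|) * ‖y‖ :=
        Finset.sum_le_sum fun i _ => hcoord i
    _ = _ := by rw [← Finset.sum_mul, Fintype.sum_prod_type]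

/-- The point derivatives of the fields, as a strongly measurable bounded function. -/
theorem IsC1Bounded.exists_derivative_representative [CompleteSpace V] (h : IsC1Bounded ι C)
    (hinj : Function.Injective ι) :
    ∃ κ : Pt d → Fin d × Fin d → V, StronglyMeasurable κ ∧ (∀ x, ‖κ x‖ ≤ C) ∧
      ∀ w x y, ‖fderiv ℝ (ι w) x - fderiv ℝ (ι w) y‖ ≤ (d * d : ℕ) * ‖κ x - κ y‖ * ‖w‖ := by
  have := h.separableSpace hinj
  let D : Pt d → V →L[ℝ] (Pt d →L[ℝ] Pt d) := fun x => LinearMap.mkContinuous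
    { toFun := fun w => fderiv ℝ (ι w) x
      map_add' := fun w w' => h.fderiv_add w w' x
      map_smul' := fun c w => h.fderiv_smul c w x } C (fun w => h.norm_fderiv_le w x)
  let e : Fin d × Fin d → (Pt d →L[ℝ] Pt d) →L[ℝ] ℝ := fun q =>
    (EuclideanSpace.proj q.1).comp (ContinuousLinearMap.apply ℝ (Pt d)
      (EuclideanSpace.single q.2 (1 : ℝ)))
  have he : ∀ q A, |e q A| ≤ ‖A‖ := by
    intro q A
    have h1 : e q A = A (EuclideanSpace.single q.2 1) q.1 := rfl
    rw [h1]
    refine (PiLp.norm_apply_le (A (EuclideanSpace.single q.2 1)) q.1).trans ?_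
    simpa using A.le_opNorm (EuclideanSpace.single q.2 1)
  let κ : Pt d → Fin d × Fin d → V := fun x q =>
    (InnerProductSpace.toDual ℝ V).symm ((e q).comp (D x))
  have hκ : ∀ x q w, inner ℝ (κ x q) w = e q (fderiv ℝ (ι w) x) := by
    intro x q w
    rw [InnerProductSpace.toDual_symm_apply]
    rfl
  refine ⟨κ, ?_, fun x => ?_, fun w x y => ?_⟩
  -- For fixed `w` the pairing with `κ x q` is an entry of `Dw(x)`, continuous in `x`. Separability
  -- of `V` turns this weak measurability into strong measurability.
  · have h1 : ∀ q, StronglyMeasurable fun x => κ x q := fun q => by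
      refine stronglyMeasurable_of_measurable_inner fun w => ?_
      have h2 : (fun x => (inner ℝ w (κ x q) : ℝ)) = fun x => e q (fderiv ℝ (ι w) x) := by
        funext x
        rw [real_inner_comm, hκ]
      rw [h2]
      exact ((e q).continuous.comp ((h.contDiff w).continuous_fderiv one_ne_zero)).measurable
    have h2 : κ = fun x => ∑ q, Pi.single q (κ x q) := by
      funext x
      exact (Finset.univ_sum_single (κ x)).symm
    rw [h2]
    exact Finset.stronglyMeasurable_fun_sum _ fun q _ =>
      (continuous_single q).comp_stronglyMeasurable (h1 q)
  · refine (pi_norm_le_iff_of_nonneg h.nonneg).2 fun q => ?_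
    rw [LinearIsometryEquiv.norm_map]
    refine ContinuousLinearMap.opNorm_le_bound _ h.nonneg fun w => ?_
    exact (he q _).trans (h.norm_fderiv_le w x)
  · refine (opNorm_le_sum_coord _).trans ?_
    have hq : ∀ q ∈ (Finset.univ : Finset (Fin d × Fin d)),
        |(fderiv ℝ (ι w) x - fderiv ℝ (ι w) y) (EuclideanSpace.single q.2 1) q.1|
          ≤ ‖κ x - κ y‖ * ‖w‖ := by
      intro q _
      have : (fderiv ℝ (ι w) x - fderiv ℝ (ι w) y) (EuclideanSpace.single q.2 1) q.1
          = inner ℝ ((κ x - κ y) q) w := by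
        rw [Pi.sub_apply, inner_sub_left, hκ, hκ, ← map_sub]
        rfl
      rw [this]
      exact (abs_real_inner_le_norm _ _).trans
        (mul_le_mul_of_nonneg_right (norm_le_pi_norm _ q) (norm_nonneg _))
    refine (Finset.sum_le_card_nsmul _ _ _ hq).trans_eq ?_
    simp [mul_assoc]

end WeakLimits

/-! ### Almost everywhere convergence of the derivatives of the flows. -/

section Jacobians

open scoped ENNReal NNReal

variable {d : ℕ} {V : Type*} [NormedAddCommGroup V] [InnerProductSpace ℝ V]
  {ι : V →ₗ[ℝ] (Pt d → Pt d)} {C : ℝ}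

/-- Hypothesis `hx` replaces a common modulus of continuity of the derivatives. The forcing in the
variational equation has two parts: the change of base points (`c n`), controlled through `κ` by the
Cauchy-Schwarz inequality, and the change of field along the limit trajectory, which vanishes by
weak convergence. -/
theorem IsC1Bounded.tendsto_fderiv_flow (h : IsC1Bounded ι C) {E : Type*} [NormedAddCommGroup E]
    {κ : Pt d → E} {N : ℝ} (hκm : StronglyMeasurable κ) (hκC : ∀ x, ‖κ x‖ ≤ C) (hN : 0 ≤ N)
    (hκ : ∀ w x y, ‖fderiv ℝ (ι w) x - fderiv ℝ (ι w) y‖ ≤ N * ‖κ x - κ y‖ * ‖w‖)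
    {v : ℕ → L2Time V} {v₀ : L2Time V} {R : ℝ} (hR : ∀ n, ‖v n‖ ≤ R) (hv : WeaklyTendsto v v₀)
    {x : Pt d}
    (hx : Tendsto (fun n => ∫ s in Icc (0 : ℝ) 1, ‖κ (flow ι (v n) s x) - κ (flow ι v₀ s x)‖ ^ 2)
      atTop (𝓝 0)) {t : ℝ} (ht : t ∈ Icc (0 : ℝ) 1) :
    Tendsto (fun n => fderiv ℝ (flow ι (v n) t) x) atTop (𝓝 (fderiv ℝ (flow ι v₀ t) x)) := by
  have h0 : (0 : ℝ) ∈ Icc (0 : ℝ) 1 := by simp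
  have hc₀ := h.continuousOn_flow v₀ x
  have hc := fun n => h.continuousOn_flow (v n) x
  obtain ⟨hM₀, -, hMeq₀⟩ := h.fderiv_flow v₀ x
  have hM := fun n => (h.fderiv_flow (v n) x).1
  have hMeq := fun n => (h.fderiv_flow (v n) x).2.2
  set M₀ : ℝ → Pt d →L[ℝ] Pt d := fun s => fderiv ℝ (flow ι v₀ s) x with hM₀def
  set M : ℕ → ℝ → Pt d →L[ℝ] Pt d := fun n s => fderiv ℝ (flow ι (v n) s) x with hMdef
  obtain ⟨B, hB⟩ := isCompact_Icc.exists_bound_of_continuousOn hM₀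
  have hB0 : 0 ≤ B := (norm_nonneg _).trans (hB 0 h0)
  have hR0 : 0 ≤ R := (norm_nonneg _).trans (hR 0)
  have hi1 := fun n => h.integrableOn_fderiv_comp (v n) (hc n) (hM n)
  have hi2 := fun n => h.integrableOn_fderiv_comp (v n) (hc n) hM₀
  have hi3 := fun w : L2Time V => h.integrableOn_fderiv_comp w hc₀ hM₀
  have hi12 : ∀ n, IntegrableOn (fun s => (fderiv ℝ (ι (v n s)) (flow ι (v n) s x)).comp (M n s)
      - (fderiv ℝ (ι (v n s)) (flow ι (v n) s x)).comp (M₀ s)) (Icc (0 : ℝ) 1) := fun n =>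
    (hi1 n).sub (hi2 n)
  have hi23 : ∀ n, IntegrableOn (fun s => (fderiv ℝ (ι (v n s)) (flow ι (v n) s x)).comp (M₀ s)
      - (fderiv ℝ (ι (v n s)) (flow ι v₀ s x)).comp (M₀ s)) (Icc (0 : ℝ) 1) := fun n =>
    (hi2 n).sub (hi3 (v n))
  set c : ℕ → ℝ := fun n => ∫ s in Icc (0 : ℝ) 1,
    ‖(fderiv ℝ (ι (v n s)) (flow ι (v n) s x)).comp (M₀ s)
      - (fderiv ℝ (ι (v n s)) (flow ι v₀ s x)).comp (M₀ s)‖ with hcdef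
  have hc0 : ∀ n, 0 ≤ c n := fun n => integral_nonneg fun _ => norm_nonneg _
  have hκq : ∀ w : L2Time V, AEStronglyMeasurable (fun s => κ (flow ι w s x))
      (volume.restrict (Icc (0 : ℝ) 1)) := fun w =>
    hκm.aestronglyMeasurable.comp_aemeasurable
      ((h.continuousOn_flow w x).aemeasurable measurableSet_Icc)
  have hq : ∀ n, MemLp (fun s => ‖κ (flow ι (v n) s x) - κ (flow ι v₀ s x)‖) 2
      (volume.restrict (Icc (0 : ℝ) 1)) := fun n =>
    (MemLp.of_bound ((hκq (v n)).sub (hκq v₀)) (C + C) (Eventually.of_forall fun s =>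
      (_root_.norm_sub_le _ _).trans (add_le_add (hκC _) (hκC _)))).norm
  have hcle : ∀ n, c n ≤ N * B * (R *
      √(∫ s in Icc (0 : ℝ) 1, ‖κ (flow ι (v n) s x) - κ (flow ι v₀ s x)‖ ^ 2)) := by
    intro n
    calc c n ≤ ∫ s in Icc (0 : ℝ) 1, N * B *
          (‖v n s‖ * ‖κ (flow ι (v n) s x) - κ (flow ι v₀ s x)‖) := by
          refine integral_mono_ae (hi23 n).norm
            (((Lp.memLp (v n)).norm.integrable_mul (hq n)).const_mul _) ?_
          filter_upwards [ae_restrict_mem measurableSet_Icc] with s hs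
          rw [← ContinuousLinearMap.sub_comp]
          refine (ContinuousLinearMap.opNorm_comp_le _ _).trans ?_
          calc _ ≤ (N * ‖κ (flow ι (v n) s x) - κ (flow ι v₀ s x)‖ * ‖v n s‖) * B :=
                mul_le_mul (hκ _ _ _) (hB s hs) (norm_nonneg _) (by positivity)
            _ = _ := by ring
      _ = N * B * ∫ s in Icc (0 : ℝ) 1,
          (‖v n s‖ * ‖κ (flow ι (v n) s x) - κ (flow ι v₀ s x)‖) := integral_const_mul _ _
      _ ≤ _ := by
          refine mul_le_mul_of_nonneg_left ?_ (by positivity)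
          exact ((v n).setIntegral_norm_mul_le (fun s => norm_nonneg _) (hq n)).trans
            (mul_le_mul_of_nonneg_right (hR n) (Real.sqrt_nonneg _))
  have hclim : Tendsto c atTop (𝓝 0) := by
    refine squeeze_zero hc0 hcle ?_
    have h1 := (Real.continuous_sqrt.tendsto _).comp hx
    simpa [Function.comp_def] using (h1.const_mul R).const_mul (N * B)
  obtain ⟨c₁, hc₁⟩ := hclim.bddAbove_range
  have hint_le : ∀ w : L2Time V, ∀ s ∈ Icc (0 : ℝ) 1,
      ‖∫ r in (0 : ℝ)..s, (fderiv ℝ (ι (w r)) (flow ι v₀ r x)).comp (M₀ r)‖ ≤ C * B * ‖w‖ := by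
    intro w s hs
    refine (norm_intervalIntegral_unit_le (hi3 w) hs).trans ?_
    calc ∫ r in Icc (0 : ℝ) 1, ‖(fderiv ℝ (ι (w r)) (flow ι v₀ r x)).comp (M₀ r)‖
        ≤ ∫ r in Icc (0 : ℝ) 1, C * B * ‖w r‖ := by
          refine integral_mono_ae (hi3 w).norm (w.integrableOn_norm.const_mul _) ?_
          filter_upwards [ae_restrict_mem measurableSet_Icc] with r hr
          refine (ContinuousLinearMap.opNorm_comp_le _ _).trans ?_
          calc _ ≤ (C * ‖w r‖) * B := mul_le_mul (h.norm_fderiv_le _ _) (hB r hr) (norm_nonneg _)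
                (mul_nonneg h.nonneg (norm_nonneg _))
            _ = _ := by ring
      _ = C * B * ∫ r in Icc (0 : ℝ) 1, ‖w r‖ := integral_const_mul _ _
      _ ≤ _ := mul_le_mul_of_nonneg_left w.setIntegral_norm_le (mul_nonneg h.nonneg hB0)
  rw [tendsto_iff_norm_sub_tendsto_zero]
  refine tendsto_zero_of_gronwall (z := fun n s => ‖M n s - M₀ s‖)
    (ρ := fun n s => c n + ‖(∫ r in (0 : ℝ)..s,
        (fderiv ℝ (ι (v n r)) (flow ι v₀ r x)).comp (M₀ r)) -
      ∫ r in (0 : ℝ)..s, (fderiv ℝ (ι (v₀ r)) (flow ι v₀ r x)).comp (M₀ r)‖)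
    (B := c₁ + (C * B * R + C * B * ‖v₀‖)) h.nonneg hR
    (fun n => ((hM n).sub hM₀).norm) (fun n s => norm_nonneg _)
    (fun n => continuousOn_const.add ((continuousOn_primitive_unit (hi3 (v n))).sub
      (continuousOn_primitive_unit (hi3 v₀))).norm)
    (fun n s => add_nonneg (hc0 n) (norm_nonneg _))
    (fun n s hs => ?_) (fun s hs => ?_) (fun n s hs => ?_) ht
  · refine add_le_add (hc₁ (mem_range_self n)) ((_root_.norm_sub_le _ _).trans
      (add_le_add ((hint_le _ s hs).trans ?_) (hint_le _ s hs)))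
    exact mul_le_mul_of_nonneg_left (hR n) (mul_nonneg h.nonneg hB0)
  · let β : ℝ → V →ₗ[ℝ] (Pt d →L[ℝ] Pt d) := fun r =>
      { toFun := fun w => (fderiv ℝ (ι w) (flow ι v₀ r x)).comp (M₀ r)
        map_add' := fun w w' => by rw [h.fderiv_add, ContinuousLinearMap.add_comp]
        map_smul' := fun a w => by
          rw [h.fderiv_smul, ContinuousLinearMap.smul_comp, RingHom.id_apply] }
    have h1 := WeaklyTendsto.tendsto_intervalIntegral (β := β) (B := C * B) (fun r hr w => by
      refine (ContinuousLinearMap.opNorm_comp_le _ _).trans ?_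
      calc _ ≤ (C * ‖w‖) * B := mul_le_mul (h.norm_fderiv_le _ _) (hB r hr) (norm_nonneg _)
            (mul_nonneg h.nonneg (norm_nonneg _))
        _ = _ := by ring) (fun w => (hi3 w).aestronglyMeasurable) hv hs
    have h2 := hclim.add (tendsto_iff_norm_sub_tendsto_zero.1 h1)
    rw [add_zero] at h2
    exact h2
  · have hsub := uIoc_subset_Icc_unit h0 hs
    have key : M n s - M₀ s = (∫ r in (0 : ℝ)..s,
        ((fderiv ℝ (ι (v n r)) (flow ι (v n) r x)).comp (M₀ r)
          - (fderiv ℝ (ι (v n r)) (flow ι v₀ r x)).comp (M₀ r)))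
        + ((∫ r in (0 : ℝ)..s, (fderiv ℝ (ι (v n r)) (flow ι v₀ r x)).comp (M₀ r)) -
          ∫ r in (0 : ℝ)..s, (fderiv ℝ (ι (v₀ r)) (flow ι v₀ r x)).comp (M₀ r))
        + ∫ r in (0 : ℝ)..s, ((fderiv ℝ (ι (v n r)) (flow ι (v n) r x)).comp (M n r)
          - (fderiv ℝ (ι (v n r)) (flow ι (v n) r x)).comp (M₀ r)) := by
      rw [intervalIntegral.integral_sub (IntegrableOn.intervalIntegrable_unit (hi2 n) h0 hs)
          (IntegrableOn.intervalIntegrable_unit (hi3 (v n)) h0 hs),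
        intervalIntegral.integral_sub (IntegrableOn.intervalIntegrable_unit (hi1 n) h0 hs)
          (IntegrableOn.intervalIntegrable_unit (hi2 n) h0 hs)]
      have e1 : M n s = _ := hMeq n s hs
      have e2 : M₀ s = _ := hMeq₀ s hs
      rw [e1, e2]
      abel
    refine (congrArg norm key).trans_le ((norm_add_le _ _).trans (add_le_add ((norm_add_le _ _).trans
      (add_le_add (norm_intervalIntegral_unit_le (hi23 n) hs) le_rfl)) ?_))
    refine intervalIntegral.norm_integral_le_integral_norm_uIoc.trans ?_
    refine integral_mono ((hi12 n).mono_set hsub).norm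
      ((integrableOn_mul_of_continuousOn ((v n).integrableOn_norm.const_mul C)
        ((hM n).sub hM₀).norm).mono_set hsub) fun r => ?_
    simp only
    rw [← ContinuousLinearMap.comp_sub]
    exact (ContinuousLinearMap.opNorm_comp_le _ _).trans
      (mul_le_mul_of_nonneg_right (h.norm_fderiv_le _ _) (norm_nonneg _))

theorem tendsto_integral_sq_of_tendsto_eLpNorm {α E : Type*} [MeasurableSpace α]
    [NormedAddCommGroup E] {μ : Measure α} {F : ℕ → α → E} (hF : ∀ n, MemLp (F n) 2 μ)
    (hlim : Tendsto (fun n => eLpNorm (F n) 2 μ) atTop (𝓝 0)) :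
    Tendsto (fun n => ∫ x, ‖F n x‖ ^ 2 ∂μ) atTop (𝓝 0) := by
  have h1 : ∀ n, ∫ x, ‖F n x‖ ^ 2 ∂μ = (eLpNorm (F n) 2 μ).toReal ^ 2 := by
    intro n
    have hnn : 0 ≤ ∫ x, ‖F n x‖ ^ 2 ∂μ := integral_nonneg fun _ => by positivity
    rw [(hF n).eLpNorm_eq_integral_rpow_norm (by norm_num) (by norm_num),
      ENNReal.toReal_ofReal (by positivity)]
    simp only [ENNReal.toReal_ofNat, Real.rpow_ofNat]
    rw [← one_div, ← Real.sqrt_eq_rpow, Real.sq_sqrt hnn]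
  simp_rw [h1]
  have h2 := ((ENNReal.tendsto_toReal ENNReal.zero_ne_top).comp hlim).pow 2
  simpa [Function.comp_def] using h2

theorem exists_subseq_tendsto_ae_of_tendsto_integral {α : Type*} [MeasurableSpace α]
    {μ : Measure α} {f : ℕ → α → ℝ} (hf : ∀ n, Integrable (f n) μ) (hf0 : ∀ n x, 0 ≤ f n x)
    (hlim : Tendsto (fun n => ∫ x, f n x ∂μ) atTop (𝓝 0)) :
    ∃ n : ℕ → ℕ, StrictMono n ∧ ∀ᵐ x ∂μ, Tendsto (fun k => f (n k) x) atTop (𝓝 0) := by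
  have h1 : Tendsto (fun n => eLpNorm (f n - fun _ => (0 : ℝ)) 1 μ) atTop (𝓝 0) := by
    have h2 : ∀ n, eLpNorm (f n - fun _ => (0 : ℝ)) 1 μ = ENNReal.ofReal (∫ x, f n x ∂μ) := by
      intro n
      have : (f n - fun _ => (0 : ℝ)) = f n := by funext x; simp
      rw [this, eLpNorm_one_eq_lintegral_enorm, ← ofReal_integral_norm_eq_lintegral_enorm (hf n)]
      congr 1
      exact integral_congr_ae (Eventually.of_forall fun x => Real.norm_of_nonneg (hf0 n x))
    simp_rw [h2]
    simpa using ENNReal.tendsto_ofReal hlim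
  exact (tendstoInMeasure_of_tendsto_eLpNorm one_ne_zero (fun n => (hf n).1)
    aestronglyMeasurable_const h1).exists_seq_tendsto_ae

theorem IsC1Bounded.isBoundedMap_flow (h : IsC1Bounded ι C) {Ω : Set (Pt d)}
    (hΩ : ∀ v, ∀ x ∉ Ω, ι v x = 0) {v : L2Time V} {R : ℝ} (hR : ‖v‖ ≤ R) {t : ℝ}
    (ht : t ∈ Icc (0 : ℝ) 1) :
    IsBoundedMap Ω ((gronwallConst (C * R)).toNNReal ^ d) (flow ι v t) :=
  isBoundedMap_of_antilipschitzWith (h.lipschitzWith_flow hR ht).continuous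
    (h.antilipschitzWith_flow hR ht) (h.preimage_flow hΩ v ht)

/-- Along a subsequence, the derivatives of the flows converge almost everywhere, although the
fields converge only weakly. -/
theorem IsC1Bounded.exists_subseq_tendsto_fderiv_flow [CompleteSpace V] (h : IsC1Bounded ι C)
    (hinj : Function.Injective ι) {Ω : Set (Pt d)} (hΩb : Bornology.IsBounded Ω)
    (hΩ : ∀ v, ∀ x ∉ Ω, ι v x = 0)
    {v : ℕ → L2Time V} {v₀ : L2Time V} {R : ℝ} (hR : ∀ n, ‖v n‖ ≤ R) (hR₀ : ‖v₀‖ ≤ R)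
    (hv : WeaklyTendsto v v₀) :
    ∃ n : ℕ → ℕ, StrictMono n ∧ ∀ᵐ x ∂(volume.restrict Ω), ∀ t ∈ Icc (0 : ℝ) 1,
      Tendsto (fun k => fderiv ℝ (flow ι (v (n k)) t) x) atTop
        (𝓝 (fderiv ℝ (flow ι v₀ t) x)) := by
  obtain ⟨κ, hκm, hκC, hκ⟩ := h.exists_derivative_representative hinj
  have : IsFiniteMeasure ((volume : Measure (Pt d)).restrict Ω) :=
    isFiniteMeasure_restrict.2 hΩb.measure_lt_top.ne
  have hdiff : ∀ x y, ‖κ x - κ y‖ ≤ C + C := fun x y =>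
    (_root_.norm_sub_le _ _).trans (add_le_add (hκC x) (hκC y))
  let P : ℝ → ℝ := fun s => projIcc (0 : ℝ) 1 zero_le_one s
  have hP : ∀ s, P s ∈ Icc (0 : ℝ) 1 := fun s => (projIcc (0 : ℝ) 1 zero_le_one s).2
  have hPeq : ∀ s ∈ Icc (0 : ℝ) 1, P s = s := fun s hs => by
    simp only [P, projIcc_of_mem zero_le_one hs]
  let Q : ℕ → Pt d → ℝ → ℝ := fun n x s =>
    ‖κ (flow ι (v n) (P s) x) - κ (flow ι v₀ (P s) x)‖ ^ 2
  have hQ0 : ∀ n x s, 0 ≤ Q n x s := fun n x s => by positivity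
  have hQC : ∀ n x s, ‖Q n x s‖ ≤ (C + C) ^ 2 := fun n x s => by
    rw [Real.norm_of_nonneg (hQ0 n x s)]
    exact pow_le_pow_left₀ (norm_nonneg _) (hdiff _ _) 2
  have hQm : ∀ n, StronglyMeasurable (Function.uncurry (Q n)) := fun n => by
    have h1 : ∀ w : L2Time V, StronglyMeasurable fun q : Pt d × ℝ => κ (flow ι w (P q.2) q.1) :=
      fun w => hκm.comp_measurable ((h.continuous_flow w).comp continuous_swap).measurable
    exact (((h1 (v n)).sub (h1 v₀)).norm.pow 2)
  have hQi : ∀ n, Integrable (Function.uncurry (Q n))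
      ((volume.restrict Ω).prod (volume.restrict (Icc (0 : ℝ) 1))) := fun n =>
    Integrable.of_bound (hQm n).aestronglyMeasurable ((C + C) ^ 2)
      (Eventually.of_forall fun q => hQC n q.1 q.2)
  -- `κ` need not be continuous, but it is square integrable on the bounded set `Ω`, so strong
  -- continuity of composition in `L²(Ω)` applies at each fixed time.
  have hslice : ∀ s, Tendsto (fun n => ∫ x in Ω, Q n x s) atTop (𝓝 0) := by
    intro s
    have hbm := fun n => h.isBoundedMap_flow hΩ (hR n) (hP s)
    have hbm₀ := h.isBoundedMap_flow hΩ hR₀ (hP s)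
    have hκL : MemLp κ 2 (volume.restrict Ω) :=
      MemLp.of_bound hκm.aestronglyMeasurable C (Eventually.of_forall hκC)
    exact tendsto_integral_sq_of_tendsto_eLpNorm
      (fun n => ((hbm n).memLp_comp hκL).sub (hbm₀.memLp_comp hκL))
      (tendsto_eLpNorm_comp_sub hΩb hbm hbm₀
        (Eventually.of_forall fun x => h.tendsto_flow hR hv x (hP s)) hκL)
  have hlim : Tendsto (fun n => ∫ x in Ω, ∫ s in Icc (0 : ℝ) 1, Q n x s) atTop (𝓝 0) := by
    have hswap : ∀ n, ∫ x in Ω, ∫ s in Icc (0 : ℝ) 1, Q n x s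
        = ∫ s in Icc (0 : ℝ) 1, ∫ x in Ω, Q n x s := fun n => integral_integral_swap (hQi n)
    simp_rw [hswap]
    have h1 : Tendsto (fun n => ∫ s in Icc (0 : ℝ) 1, ∫ x in Ω, Q n x s) atTop
        (𝓝 (∫ s in Icc (0 : ℝ) 1, (0 : ℝ))) := by
      refine tendsto_integral_of_dominated_convergence
        (fun _ => (C + C) ^ 2 * (volume.restrict Ω).real univ)
        (fun n => (hQi n).swap.integral_prod_left.aestronglyMeasurable) (integrable_const _)
        (fun n => Eventually.of_forall fun s => ?_) (Eventually.of_forall hslice)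
      exact norm_integral_le_of_norm_le_const (Eventually.of_forall fun x => hQC n x s)
    simpa using h1
  -- After exchanging the integrals, the time integrals converge in `L¹(Ω)`. A single subsequence
  -- and null set arise, common to all times `t`.
  obtain ⟨n, hn, hae⟩ := exists_subseq_tendsto_ae_of_tendsto_integral
    (fun n => (hQi n).integral_prod_left) (fun n x => integral_nonneg fun s => hQ0 n x s) hlim
  refine ⟨n, hn, ?_⟩
  filter_upwards [hae] with x hx t ht
  refine h.tendsto_fderiv_flow hκm hκC (Nat.cast_nonneg _) hκ (fun k => hR (n k))
    (hv.comp_tendsto hn.tendsto_atTop) (hx.congr fun k => ?_) ht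
  refine setIntegral_congr_fun measurableSet_Icc fun s hs => ?_
  simp only [Q, Function.uncurry_apply_pair, hPeq s hs]

end Jacobians

/-! ### Adjoint transport and weak continuity of the registered template. -/

section Transport

open scoped ENNReal NNReal

variable {d : ℕ} {V : Type*} [NormedAddCommGroup V] [InnerProductSpace ℝ V]
  {ι : V →ₗ[ℝ] (Pt d → Pt d)} {C : ℝ} {Ω : Set (Pt d)}

/-- The Jacobian of the flow. -/
def jacobian (ι : V →ₗ[ℝ] (Pt d → Pt d)) (v : L2Time V) (t : ℝ) (x : Pt d) : ℝ :=
  |(fderiv ℝ (flow ι v t) x).det|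

theorem measurable_jacobian (v : L2Time V) (t : ℝ) : Measurable (jacobian ι v t) := by
  have h1 : Continuous fun A : Pt d →L[ℝ] Pt d => |A.det| :=
    ContinuousLinearMap.continuous_det.abs
  exact h1.measurable.comp (measurable_fderiv ℝ (flow ι v t))

/-- The two-sided Lipschitz bounds of the flow pass to its derivative and hence to the determinant.
-/
theorem IsC1Bounded.jacobian_bounds (h : IsC1Bounded ι C) {v : L2Time V} {R : ℝ} (hR : ‖v‖ ≤ R)
    {t : ℝ} (ht : t ∈ Icc (0 : ℝ) 1) (x : Pt d) :
    jacobian ι v t x ≤ gronwallConst (C * R) ^ d ∧ (fderiv ℝ (flow ι v t) x).det ≠ 0 ∧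
      (jacobian ι v t x)⁻¹ ≤ gronwallConst (C * R) ^ d := by
  have hG := gronwallConst_pos (C * R)
  have hder := (h.fderiv_flow v x).2.1 t ht
  refine ⟨abs_det_le_of_norm_le hG fun k => ?_,
    abs_det_inv_le_of_le_norm hG (norm_le_of_hasFDerivAt hder (h.norm_sub_le_flow hR ht))⟩
  have h1 := norm_fderiv_le_of_lipschitz ℝ (x₀ := x) (h.lipschitzWith_flow hR ht)
  rw [Real.coe_toNNReal _ hG.le] at h1
  exact (ContinuousLinearMap.le_opNorm _ _).trans (mul_le_mul_of_nonneg_right h1 (norm_nonneg _))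

theorem IsC1Bounded.leftInverse_invFun_flow (h : IsC1Bounded ι C) (v : L2Time V) {t : ℝ}
    (ht : t ∈ Icc (0 : ℝ) 1) :
    Function.LeftInverse (Function.invFun (flow ι v t)) (flow ι v t) :=
  Function.leftInverse_invFun (h.bijective_flow v ht).1

theorem IsC1Bounded.rightInverse_invFun_flow (h : IsC1Bounded ι C) (v : L2Time V) {t : ℝ}
    (ht : t ∈ Icc (0 : ℝ) 1) :
    Function.RightInverse (Function.invFun (flow ι v t)) (flow ι v t) :=
  Function.rightInverse_invFun (h.bijective_flow v ht).2

theorem IsC1Bounded.isBoundedMap_invFun_flow (h : IsC1Bounded ι C)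
    (hΩ : ∀ v, ∀ x ∉ Ω, ι v x = 0) {v : L2Time V} {R : ℝ} (hR : ‖v‖ ≤ R) {t : ℝ}
    (ht : t ∈ Icc (0 : ℝ) 1) :
    IsBoundedMap Ω ((gronwallConst (C * R)).toNNReal ^ d) (Function.invFun (flow ι v t)) := by
  have hr := h.rightInverse_invFun_flow v ht
  refine isBoundedMap_of_antilipschitzWith
    ((h.antilipschitzWith_flow hR ht).to_rightInverse hr).continuous
    ((h.lipschitzWith_flow hR ht).to_rightInverse hr) ?_
  conv_lhs => rw [← h.preimage_flow hΩ v ht]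
  rw [← preimage_comp, hr.comp_eq_id, preimage_id]

/-- With `x = φ⁻¹(y)`, the uniform lower Lipschitz bound gives `‖φ_n⁻¹(y) - x‖ ≤ G ‖y - φ_n(x)‖`. -/
theorem IsC1Bounded.tendsto_invFun_flow (h : IsC1Bounded ι C) {v : ℕ → L2Time V}
    {v₀ : L2Time V} {R : ℝ} (hR : ∀ n, ‖v n‖ ≤ R) {t : ℕ → ℝ} {t₀ : ℝ}
    (ht : ∀ n, t n ∈ Icc (0 : ℝ) 1) (ht₀ : t₀ ∈ Icc (0 : ℝ) 1)
    (hflow : ∀ x, Tendsto (fun n => flow ι (v n) (t n) x) atTop (𝓝 (flow ι v₀ t₀ x)))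
    (y : Pt d) :
    Tendsto (fun n => Function.invFun (flow ι (v n) (t n)) y) atTop
      (𝓝 (Function.invFun (flow ι v₀ t₀) y)) := by
  set x := Function.invFun (flow ι v₀ t₀) y with hx
  have hxy : flow ι v₀ t₀ x = y := h.rightInverse_invFun_flow v₀ ht₀ y
  rw [tendsto_iff_norm_sub_tendsto_zero]
  refine squeeze_zero (fun _ => norm_nonneg _)
    (g := fun n => gronwallConst (C * R) * ‖flow ι (v n) (t n) x - flow ι v₀ t₀ x‖)
    (fun n => ?_) ?_
  · refine (h.norm_sub_le_flow (hR n) (ht n) _ _).trans_eq ?_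
    rw [h.rightInverse_invFun_flow (v n) (ht n) y, hxy, norm_sub_rev]
  · simpa using (tendsto_iff_norm_sub_tendsto_zero.1 (hflow x)).const_mul
      (gronwallConst (C * R))

/-- The adjoint of `f ↦ f ∘ φ_{0,t}`. -/
def adjointTransport (ι : V →ₗ[ℝ] (Pt d → Pt d)) (v : L2Time V) (t : ℝ) (g : ImageSpace Ω) :
    ImageSpace Ω :=
  compImage (mulImage (fun x => (jacobian ι v t x)⁻¹) g) (Function.invFun (flow ι v t))

theorem IsC1Bounded.abs_jacobian_le (h : IsC1Bounded ι C) {v : L2Time V} {R : ℝ} (hR : ‖v‖ ≤ R)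
    {t : ℝ} (ht : t ∈ Icc (0 : ℝ) 1) (x : Pt d) :
    |jacobian ι v t x| ≤ gronwallConst (C * R) ^ d :=
  (abs_abs _).trans_le (h.jacobian_bounds hR ht x).1

theorem IsC1Bounded.abs_jacobian_inv_le (h : IsC1Bounded ι C) {v : L2Time V} {R : ℝ}
    (hR : ‖v‖ ≤ R) {t : ℝ} (ht : t ∈ Icc (0 : ℝ) 1) (x : Pt d) :
    |(jacobian ι v t x)⁻¹| ≤ gronwallConst (C * R) ^ d := by
  rw [abs_inv]
  unfold jacobian
  rw [abs_abs]
  exact (h.jacobian_bounds hR ht x).2.2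

theorem IsC1Bounded.inner_compImage_flow (h : IsC1Bounded ι C) (hΩm : MeasurableSet Ω)
    (hΩ : ∀ v, ∀ x ∉ Ω, ι v x = 0) (v : L2Time V) {t : ℝ} (ht : t ∈ Icc (0 : ℝ) 1)
    (f g : ImageSpace Ω) :
    inner ℝ (compImage f (flow ι v t)) g = inner ℝ f (adjointTransport ι v t g) :=
  inner_compImage hΩm (h.isBoundedMap_flow hΩ le_rfl ht) (h.isBoundedMap_invFun_flow hΩ le_rfl ht)
    (h.leftInverse_invFun_flow v ht) (h.rightInverse_invFun_flow v ht) (h.preimage_flow hΩ v ht)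
    (fun x => (h.fderiv_flow v x).2.1 t ht) (fun x => (h.jacobian_bounds le_rfl ht x).1)
    (fun x => (h.jacobian_bounds le_rfl ht x).2.1) (fun x => (h.jacobian_bounds le_rfl ht x).2.2)
    (measurable_jacobian v t) f g

theorem IsC1Bounded.inner_deform_flow (h : IsC1Bounded ι C) (hΩm : MeasurableSet Ω)
    (hΩ : ∀ v, ∀ x ∉ Ω, ι v x = 0) (v : L2Time V) {t : ℝ} (ht : t ∈ Icc (0 : ℝ) 1)
    (f g : ImageSpace Ω) :
    inner ℝ (deform (flow ι v t) f) g
      = inner ℝ f (mulImage (jacobian ι v t) (compImage g (flow ι v t))) :=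
  inner_compImage_inverse hΩm (h.isBoundedMap_flow hΩ le_rfl ht)
    (h.isBoundedMap_invFun_flow hΩ le_rfl ht)
    (h.leftInverse_invFun_flow v ht) (h.rightInverse_invFun_flow v ht) (h.preimage_flow hΩ v ht)
    (fun x => (h.fderiv_flow v x).2.1 t ht) (fun x => (h.jacobian_bounds le_rfl ht x).1)
    (measurable_jacobian v t) f g

theorem tendsto_jacobian {v : ℕ → L2Time V} {v₀ : L2Time V} {t : ℕ → ℝ} {t₀ : ℝ} {x : Pt d}
    (hx : Tendsto (fun n => fderiv ℝ (flow ι (v n) (t n)) x) atTop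
      (𝓝 (fderiv ℝ (flow ι v₀ t₀) x))) :
    Tendsto (fun n => jacobian ι (v n) (t n) x) atTop (𝓝 (jacobian ι v₀ t₀ x)) := by
  have h1 : Continuous fun A : Pt d →L[ℝ] Pt d => |A.det| :=
    ContinuousLinearMap.continuous_det.abs
  exact (h1.tendsto _).comp hx

/-- Field and time both vary with `n`, to serve continuity in time for a fixed field as well as
convergence of fields at a fixed time. -/
theorem IsC1Bounded.tendsto_adjointTransport (h : IsC1Bounded ι C)
    (hΩb : Bornology.IsBounded Ω) (hΩ : ∀ v, ∀ x ∉ Ω, ι v x = 0) {v : ℕ → L2Time V}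
    {v₀ : L2Time V} {R : ℝ} (hR : ∀ n, ‖v n‖ ≤ R) (hR₀ : ‖v₀‖ ≤ R) {t : ℕ → ℝ} {t₀ : ℝ}
    (ht : ∀ n, t n ∈ Icc (0 : ℝ) 1) (ht₀ : t₀ ∈ Icc (0 : ℝ) 1)
    (hflow : ∀ x, Tendsto (fun n => flow ι (v n) (t n) x) atTop (𝓝 (flow ι v₀ t₀ x)))
    (hder : ∀ᵐ x ∂(volume.restrict Ω), Tendsto (fun n => fderiv ℝ (flow ι (v n) (t n)) x) atTop
      (𝓝 (fderiv ℝ (flow ι v₀ t₀) x))) (g : ImageSpace Ω) :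
    Tendsto (fun n => adjointTransport ι (v n) (t n) g) atTop
      (𝓝 (adjointTransport ι v₀ t₀ g)) := by
  refine tendsto_compImage hΩb (fun n => h.isBoundedMap_invFun_flow hΩ (hR n) (ht n))
    (h.isBoundedMap_invFun_flow hΩ hR₀ ht₀)
    (Eventually.of_forall fun y => h.tendsto_invFun_flow hR ht ht₀ hflow y) ?_
  refine tendsto_mulImage (fun n => (measurable_jacobian _ _).inv.aestronglyMeasurable)
    (measurable_jacobian _ _).inv.aestronglyMeasurable
    (fun n => h.abs_jacobian_inv_le (hR n) (ht n)) (h.abs_jacobian_inv_le hR₀ ht₀) ?_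
    tendsto_const_nhds
  filter_upwards [hder] with x hx
  exact (tendsto_jacobian hx).inv₀ (abs_ne_zero.2 (h.jacobian_bounds hR₀ ht₀ x).2.1)

theorem IsC1Bounded.norm_adjointTransport_le (h : IsC1Bounded ι C)
    (hΩ : ∀ v, ∀ x ∉ Ω, ι v x = 0) {v : L2Time V} {R : ℝ} (hR : ‖v‖ ≤ R)
    {t : ℝ} (ht : t ∈ Icc (0 : ℝ) 1) (g : ImageSpace Ω) :
    ‖adjointTransport ι v t g‖ ≤
      (((gronwallConst (C * R)).toNNReal ^ d : ℝ≥0) : ℝ) ^ (1 / 2 : ℝ) *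
        (gronwallConst (C * R) ^ d * ‖g‖) :=
  ((h.isBoundedMap_invFun_flow hΩ hR ht).norm_compImage_le _).trans
    (mul_le_mul_of_nonneg_left (norm_mulImage_le
      (measurable_jacobian _ _).inv.aestronglyMeasurable (h.abs_jacobian_inv_le hR ht) g)
      (by positivity))

theorem IsC1Bounded.continuousOn_adjointTransport (h : IsC1Bounded ι C)
    (hΩb : Bornology.IsBounded Ω) (hΩ : ∀ v, ∀ x ∉ Ω, ι v x = 0) (v : L2Time V)
    (g : ImageSpace Ω) : ContinuousOn (fun t => adjointTransport ι v t g) (Icc 0 1) := by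
  rw [continuousOn_iff_continuous_domRestrict, continuous_iff_seqContinuous]
  intro t t₀ ht
  have ht' : Tendsto (fun n => (t n : ℝ)) atTop (𝓝[Icc 0 1] t₀) :=
    tendsto_nhdsWithin_iff.2 ⟨(continuous_subtype_val.tendsto t₀).comp ht,
      Eventually.of_forall fun n => (t n).2⟩
  exact h.tendsto_adjointTransport (v := fun _ => v) (t := fun n => t n) hΩb hΩ (fun _ => le_rfl)
    le_rfl (fun n => (t n).2) t₀.2
    (fun x => ((h.continuousOn_flow v x) t₀ t₀.2).tendsto.comp ht')
    (Eventually.of_forall fun x => ((h.fderiv_flow v x).1 t₀ t₀.2).tendsto.comp ht') g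

/-- Measurability comes from joint continuity of `(t, f) ↦ f ∘ φ_t`, composed with the measurable `s
↦ (s, ζ s)`. -/
theorem IsC1Bounded.integrableOn_compImage_flow (h : IsC1Bounded ι C)
    (hΩb : Bornology.IsBounded Ω) (hΩ : ∀ v, ∀ x ∉ Ω, ι v x = 0) (v : L2Time V)
    (ζ : L2Time (ImageSpace Ω)) :
    IntegrableOn (fun s => compImage (ζ s) (flow ι v s)) (Icc (0 : ℝ) 1) := by
  let Ψ : Icc (0 : ℝ) 1 × ImageSpace Ω → ImageSpace Ω := fun q => compImage q.2 (flow ι v q.1)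
  have hΨ : Continuous Ψ := by
    rw [continuous_iff_seqContinuous]
    intro q q₀ hq
    have hq1 := (continuous_fst.tendsto q₀).comp hq
    have hq2 := (continuous_snd.tendsto q₀).comp hq
    have ht' : Tendsto (fun n => ((q n).1 : ℝ)) atTop (𝓝[Icc 0 1] q₀.1) :=
      tendsto_nhdsWithin_iff.2 ⟨(continuous_subtype_val.tendsto q₀.1).comp hq1,
        Eventually.of_forall fun n => (q n).1.2⟩
    exact tendsto_compImage hΩb (fun n => h.isBoundedMap_flow (v := v) hΩ le_rfl (q n).1.2)
      (h.isBoundedMap_flow (v := v) hΩ le_rfl q₀.1.2)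
      (Eventually.of_forall fun x => ((h.continuousOn_flow v x) q₀.1 q₀.1.2).tendsto.comp ht') hq2
  have hmeas : AEStronglyMeasurable (fun s => compImage (ζ s) (flow ι v s))
      (volume.restrict (Icc (0 : ℝ) 1)) := by
    have h1 := hΨ.comp_aestronglyMeasurable
      (((continuous_projIcc (a := (0 : ℝ)) (b := 1)
        (h := zero_le_one)).aestronglyMeasurable).prodMk ζ.aestronglyMeasurable)
    refine h1.congr ?_
    filter_upwards [ae_restrict_mem measurableSet_Icc] with s hs
    simp only [Ψ, projIcc_of_mem zero_le_one hs]
  refine (ζ.integrableOn_norm.const_mul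
    ((((gronwallConst (C * ‖v‖)).toNNReal ^ d : ℝ≥0) : ℝ) ^ (1 / 2 : ℝ))).mono' hmeas ?_
  filter_upwards [ae_restrict_mem measurableSet_Icc] with s hs
  exact (h.isBoundedMap_flow hΩ le_rfl hs).norm_compImage_le _

theorem template_one_eq (I₀ : ImageSpace Ω) (v : L2Time V) (ζ : L2Time (ImageSpace Ω)) :
    template ι I₀ v ζ 1 = I₀ + ∫ s in Icc (0 : ℝ) 1, compImage (ζ s) (flow ι v s) := by
  rw [template, intervalIntegral.integral_of_le zero_le_one, integral_Icc_eq_integral_Ioc]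

theorem IsC1Bounded.norm_template_one_le (h : IsC1Bounded ι C)
    (hΩb : Bornology.IsBounded Ω) (hΩ : ∀ v, ∀ x ∉ Ω, ι v x = 0) (I₀ : ImageSpace Ω)
    {v : L2Time V} {R : ℝ} (hR : ‖v‖ ≤ R) (ζ : L2Time (ImageSpace Ω)) :
    ‖template ι I₀ v ζ 1‖ ≤ ‖I₀‖ +
      (((gronwallConst (C * R)).toNNReal ^ d : ℝ≥0) : ℝ) ^ (1 / 2 : ℝ) * ‖ζ‖ := by
  rw [template_one_eq]
  refine (norm_add_le _ _).trans (add_le_add le_rfl ?_)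
  calc _ ≤ ∫ s in Icc (0 : ℝ) 1, ‖compImage (ζ s) (flow ι v s)‖ := norm_integral_le_integral_norm _
    _ ≤ ∫ s in Icc (0 : ℝ) 1,
        (((gronwallConst (C * R)).toNNReal ^ d : ℝ≥0) : ℝ) ^ (1 / 2 : ℝ) * ‖ζ s‖ := by
        refine integral_mono_ae (h.integrableOn_compImage_flow hΩb hΩ v ζ).norm
          (ζ.integrableOn_norm.const_mul _) ?_
        filter_upwards [ae_restrict_mem measurableSet_Icc] with s hs
        exact (h.isBoundedMap_flow hΩ hR hs).norm_compImage_le _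
    _ = _ := integral_const_mul _ _
    _ ≤ _ := mul_le_mul_of_nonneg_left ζ.setIntegral_norm_le (by positivity)

/-- All dependence on the flow moves into the second factor, so that weak convergence of `ζ` can be
paired with strong convergence of the adjoint images. -/
theorem IsC1Bounded.inner_template_one (h : IsC1Bounded ι C) (hΩm : MeasurableSet Ω)
    (hΩb : Bornology.IsBounded Ω) (hΩ : ∀ v, ∀ x ∉ Ω, ι v x = 0) (I₀ : ImageSpace Ω)
    (v : L2Time V) (ζ : L2Time (ImageSpace Ω)) (g : ImageSpace Ω) :
    inner ℝ (template ι I₀ v ζ 1) g = inner ℝ I₀ g + inner ℝ ζ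
      ((memLp_unit_of_continuousOn (h.continuousOn_adjointTransport hΩb hΩ v g)).toLp _) := by
  rw [template_one_eq, inner_add_left, real_inner_comm _ (∫ s in Icc (0 : ℝ) 1, _),
    ← integral_inner (h.integrableOn_compImage_flow hΩb hΩ v ζ), L2.inner_def]
  congr 1
  refine integral_congr_ae ?_
  filter_upwards [ae_restrict_mem measurableSet_Icc, MemLp.coeFn_toLp
    (memLp_unit_of_continuousOn (h.continuousOn_adjointTransport hΩb hΩ v g))] with s hs h1
  rw [h1, real_inner_comm, h.inner_compImage_flow hΩm hΩ v hs]

/-- The registered template depends weakly sequentially continuously on the parameters, along a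
subsequence. -/
theorem IsC1Bounded.exists_subseq_weaklyTendsto_registered [CompleteSpace V]
    (h : IsC1Bounded ι C) (hinj : Function.Injective ι) (hΩm : MeasurableSet Ω)
    (hΩb : Bornology.IsBounded Ω) (hΩ : ∀ v, ∀ x ∉ Ω, ι v x = 0) (I₀ : ImageSpace Ω)
    {v : ℕ → L2Time V} {v₀ : L2Time V} {ζ : ℕ → L2Time (ImageSpace Ω)}
    {ζ₀ : L2Time (ImageSpace Ω)} {R S : ℝ} (hR : ∀ n, ‖v n‖ ≤ R) (hS : ∀ n, ‖ζ n‖ ≤ S)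
    (hv : WeaklyTendsto v v₀) (hζ : WeaklyTendsto ζ ζ₀) :
    ∃ n : ℕ → ℕ, StrictMono n ∧
      WeaklyTendsto (fun k => registered ι I₀ (v (n k)) (ζ (n k))) (registered ι I₀ v₀ ζ₀) := by
  obtain ⟨R, hR, hR₀⟩ : ∃ R', (∀ n, ‖v n‖ ≤ R') ∧ ‖v₀‖ ≤ R' :=
    ⟨max R ‖v₀‖, fun n => (hR n).trans (le_max_left _ _), le_max_right _ _⟩
  obtain ⟨n, hn, hder⟩ := h.exists_subseq_tendsto_fderiv_flow hinj hΩb hΩ hR hR₀ hv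
  have h1I : (1 : ℝ) ∈ Icc (0 : ℝ) 1 := by simp
  have hv' := hv.comp_tendsto hn.tendsto_atTop
  have hζ' := hζ.comp_tendsto hn.tendsto_atTop
  have hflow : ∀ t ∈ Icc (0 : ℝ) 1, ∀ x, Tendsto (fun k => flow ι (v (n k)) t x) atTop
      (𝓝 (flow ι v₀ t x)) := fun t ht x => h.tendsto_flow (fun k => hR (n k)) hv' x ht
  have hder' : ∀ t ∈ Icc (0 : ℝ) 1, ∀ᵐ x ∂(volume.restrict Ω),
      Tendsto (fun k => fderiv ℝ (flow ι (v (n k)) t) x) atTop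
        (𝓝 (fderiv ℝ (flow ι v₀ t) x)) := fun t ht => hder.mono fun x hx => hx t ht
  have htemp : WeaklyTendsto (fun k => template ι I₀ (v (n k)) (ζ (n k)) 1)
      (template ι I₀ v₀ ζ₀ 1) := by
    refine weaklyTendsto_iff_inner.2 fun g => ?_
    simp_rw [real_inner_comm _ g, h.inner_template_one hΩm hΩb hΩ]
    refine tendsto_const_nhds.add (hζ'.inner_tendsto (fun k => hS (n k)) ?_)
    rw [Lp.tendsto_Lp_iff_tendsto_eLpNorm'']
    set b := (((gronwallConst (C * R)).toNNReal ^ d : ℝ≥0) : ℝ) ^ (1 / 2 : ℝ) *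
        (gronwallConst (C * R) ^ d * ‖g‖)
    refine tendsto_eLpNorm_zero_of_dominated (g := fun _ => b + b) (fun k =>
      ((h.continuousOn_adjointTransport hΩb hΩ (v (n k)) g).aestronglyMeasurable_of_isCompact
        isCompact_Icc measurableSet_Icc).sub
      ((h.continuousOn_adjointTransport hΩb hΩ v₀ g).aestronglyMeasurable_of_isCompact
        isCompact_Icc measurableSet_Icc)) (memLp_const _) (fun k => ?_) ?_
    · filter_upwards [ae_restrict_mem measurableSet_Icc] with s hs
      exact (_root_.norm_sub_le _ _).trans (add_le_add
        (h.norm_adjointTransport_le hΩ (hR _) hs g) (h.norm_adjointTransport_le hΩ hR₀ hs g))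
    · filter_upwards [ae_restrict_mem measurableSet_Icc] with s hs
      have := h.tendsto_adjointTransport hΩb hΩ (fun k => hR (n k)) hR₀ (t := fun _ => s)
        (fun _ => hs) hs (hflow s hs) (hder' s hs) g
      simpa using this.sub_const (adjointTransport ι v₀ s g)
  refine ⟨n, hn, weaklyTendsto_iff_inner.2 fun g => ?_⟩
  -- The final deformation is moved to the test image as well: its adjoint `g ↦ |det Dφ| (g ∘ φ)`
  -- converges strongly, against the weakly convergent templates.
  simp_rw [real_inner_comm _ g, registered, h.inner_deform_flow hΩm hΩ _ h1I]
  refine htemp.inner_tendsto (R := ‖I₀‖ +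
      (((gronwallConst (C * R)).toNNReal ^ d : ℝ≥0) : ℝ) ^ (1 / 2 : ℝ) * S) (fun k => ?_) ?_
  · exact (h.norm_template_one_le hΩb hΩ I₀ (hR _) _).trans (add_le_add le_rfl
      (mul_le_mul_of_nonneg_left (hS _) (by positivity)))
  · refine tendsto_mulImage (fun k => (measurable_jacobian _ _).aestronglyMeasurable)
      (measurable_jacobian _ _).aestronglyMeasurable (fun k => h.abs_jacobian_le (hR _) h1I)
      (h.abs_jacobian_le hR₀ h1I) ?_ ?_
    · filter_upwards [hder' 1 h1I] with x hx
      exact tendsto_jacobian hx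
    · exact tendsto_compImage hΩb (fun k => h.isBoundedMap_flow hΩ (hR (n k)) h1I)
        (h.isBoundedMap_flow hΩ hR₀ h1I) (Eventually.of_forall fun x => hflow 1 h1I x)
        tendsto_const_nhds

end Transport

/-! ### The limit of the discrepancy and the convergence of minimisers. -/

theorem WeaklyTendsto.tendsto_discrepancy_eq {Y : Type*} [NormedAddCommGroup Y] [NormedSpace ℝ Y]
    {D : Y → Y → ℝ} (hD_nonneg : ∀ y h, 0 ≤ D y h) (hD_definite : ∀ y h, D y h = 0 → y = h)
    (hD_lsc : ∀ (y : ℕ → Y) (h : ℕ → Y) (y₀ h₀ : Y), WeaklyTendsto y y₀ → Tendsto h atTop (𝓝 h₀) →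
      ∀ c < D y₀ h₀, ∀ᶠ n in atTop, c < D (y n) (h n))
    {y h : ℕ → Y} {y₀ h₀ : Y} (hy : WeaklyTendsto y y₀) (hh : Tendsto h atTop (𝓝 h₀))
    (hlim : Tendsto (fun n => D (y n) (h n)) atTop (𝓝 0)) : y₀ = h₀ := by
  by_contra hne
  have hpos : 0 < D y₀ h₀ := lt_of_le_of_ne (hD_nonneg _ _) fun h0 => hne (hD_definite _ _ h0.symm)
  have h1 := hD_lsc y h y₀ h₀ hy hh (D y₀ h₀ / 2) (by linarith)
  have h2 := hlim.eventually (gt_mem_nhds (half_pos hpos))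
  obtain ⟨n, hn1, hn2⟩ := (h1.and h2).exists
  linarith

end Metamorphosis

end

theorem mainTheorem3 {d p : ℕ} (hp : 1 ≤ p)
    {Ω : Set (Metamorphosis.Pt d)} (hΩ_open : IsOpen Ω) (hΩ_bdd : Bornology.IsBounded Ω)
    {V : Type*} [NormedAddCommGroup V] [InnerProductSpace ℝ V] [CompleteSpace V]
    (ι : V →ₗ[ℝ] (Metamorphosis.Pt d → Metamorphosis.Pt d))
    (hV : Metamorphosis.IsAdmissible p Ω ι)
    {Y : Type*} [NormedAddCommGroup Y] [InnerProductSpace ℝ Y] [CompleteSpace Y]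
    -- the forward operator: weakly sequentially continuous
    (T : Metamorphosis.ImageSpace Ω → Y)
    (hT : ∀ (u : ℕ → Metamorphosis.ImageSpace Ω) (f : Metamorphosis.ImageSpace Ω),
      Metamorphosis.WeaklyTendsto u f → Metamorphosis.WeaklyTendsto (fun n => T (u n)) (T f))
    -- the data discrepancy: nonnegative, definite, sequentially lower semicontinuous for
    -- (weak, norm) convergence, for instance the squared norm of the difference
    (D : Y → Y → ℝ)
    (hD_nonneg : ∀ y h, 0 ≤ D y h)
    (hD_definite : ∀ y h, D y h = 0 → y = h)
    (hD_lsc : ∀ (y : ℕ → Y) (h : ℕ → Y) (y₀ h₀ : Y),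
      Metamorphosis.WeaklyTendsto y y₀ → Tendsto h atTop (𝓝 h₀) →
      ∀ c < D y₀ h₀, ∀ᶠ n in atTop, c < D (y n) (h n))
    (I₀ : Metamorphosis.ImageSpace Ω)
    -- the exact data are attained, and the discrepancy is at most quadratic near them
    (g : Y)
    (hD_quad : (fun h => D g h) =O[𝓝 g] fun h => ‖h - g‖ ^ 2)
    (hg : ∃ (v : Metamorphosis.L2Time V)
      (ζ : Metamorphosis.L2Time (Metamorphosis.ImageSpace Ω)),
      T (Metamorphosis.registered ι I₀ v ζ) = g)
    -- the noise, the parameter choice rules and the minimisers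
    (e : ℝ → Y) (he : ∀ δ > 0, ‖e δ‖ = δ)
    (γ τ : ℝ → ℝ) (hγ_pos : ∀ δ > 0, 0 < γ δ) (hτ_pos : ∀ δ > 0, 0 < τ δ)
    (hγτ : ∃ B : ℝ, ∀ δ > 0, γ δ / τ δ ≤ B) (hτγ : ∃ B : ℝ, ∀ δ > 0, τ δ / γ δ ≤ B)
    (hγ : Tendsto γ (𝓝[>] 0) (𝓝 0)) (hτ : Tendsto τ (𝓝[>] 0) (𝓝 0))
    (hδγ : Tendsto (fun δ => δ ^ 2 / γ δ) (𝓝[>] 0) (𝓝 0))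
    (hδτ : Tendsto (fun δ => δ ^ 2 / τ δ) (𝓝[>] 0) (𝓝 0))
    (v : ℝ → Metamorphosis.L2Time V)
    (ζ : ℝ → Metamorphosis.L2Time (Metamorphosis.ImageSpace Ω))
    (hmin : ∀ δ > 0,
      IsMinOn (Metamorphosis.objective ι I₀ T D (γ δ) (τ δ) (g + e δ)) univ (v δ, ζ δ))
    (δ : ℕ → ℝ) (hδ_pos : ∀ k, 0 < δ k) (hδ : Tendsto δ atTop (𝓝 0)) :
    ∃ n : ℕ → ℕ, StrictMono n ∧
      ∃ (vStar : Metamorphosis.L2Time V)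
        (ζStar : Metamorphosis.L2Time (Metamorphosis.ImageSpace Ω)),
        Metamorphosis.WeaklyTendsto (fun k => v (δ (n k))) vStar ∧
        Metamorphosis.WeaklyTendsto (fun k => ζ (δ (n k))) ζStar ∧
        T (Metamorphosis.registered ι I₀ vStar ζStar) = g := by
  obtain ⟨C, hC⟩ := hV.exists_isC1Bounded hp
  obtain ⟨v₁, ζ₁, h₁⟩ := hg
  obtain ⟨B₁, hB₁⟩ := hγτ
  obtain ⟨B₂, hB₂⟩ := hτγ
  have hδ' : Tendsto δ atTop (𝓝[>] 0) :=
    tendsto_nhdsWithin_iff.2 ⟨hδ, Eventually.of_forall hδ_pos⟩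
  set E : ℕ → ℝ := fun k => D g (g + e (δ k)) with hE
  have hE0 : ∀ k, 0 ≤ E k := fun k => hD_nonneg _ _
  have hdata : Tendsto (fun k => g + e (δ k)) atTop (𝓝 g) := by
    rw [tendsto_iff_norm_sub_tendsto_zero]
    refine hδ.congr fun k => ?_
    rw [add_sub_cancel_left, he _ (hδ_pos k)]
  -- The quadratic growth of `D g` near `g` meets `‖e δ‖ = δ`; the limits of `δ² / γ` and `δ² / τ`
  -- then control `E`.
  have hEO : E =O[atTop] fun k => δ k ^ 2 := by
    refine (hD_quad.comp_tendsto hdata).congr_right fun k => ?_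
    simp [he _ (hδ_pos k)]
  have hEγ : Tendsto (fun k => E k / γ (δ k)) atTop (𝓝 0) :=
    (hEO.mul (Asymptotics.isBigO_refl (fun k => (γ (δ k))⁻¹) atTop)).trans_tendsto
      (hδγ.comp hδ')
  have hEτ : Tendsto (fun k => E k / τ (δ k)) atTop (𝓝 0) :=
    (hEO.mul (Asymptotics.isBigO_refl (fun k => (τ (δ k))⁻¹) atTop)).trans_tendsto
      (hδτ.comp hδ')
  have hElim : Tendsto E atTop (𝓝 0) :=
    hEO.trans_tendsto (by simpa using hδ.pow 2)
  have hobj : ∀ k, γ (δ k) / 2 * ‖v (δ k)‖ ^ 2 + τ (δ k) / 2 * ‖ζ (δ k)‖ ^ 2 +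
      D (T (Metamorphosis.registered ι I₀ (v (δ k)) (ζ (δ k)))) (g + e (δ k)) ≤
      γ (δ k) / 2 * ‖v₁‖ ^ 2 + τ (δ k) / 2 * ‖ζ₁‖ ^ 2 + E k := by
    intro k
    have h2 := hmin (δ k) (hδ_pos k) (mem_univ (v₁, ζ₁))
    simp only [mem_ofPred_eq, Metamorphosis.objective, h₁] at h2
    exact h2
  obtain ⟨c₁, hc₁⟩ := hEγ.bddAbove_range
  obtain ⟨c₂, hc₂⟩ := hEτ.bddAbove_range
  -- The constant is the comparison inequality multiplied by `2 / γ`: `B₂` bounds `τ / γ` and `c₁`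
  -- bounds `E / γ`. The bound on `ζ` below is the same with `2 / τ`.
  have hR : ∀ k, ‖v (δ k)‖ ≤ √(‖v₁‖ ^ 2 + B₂ * ‖ζ₁‖ ^ 2 + 2 * c₁) := by
    intro k
    refine Real.le_sqrt_of_sq_le ?_
    have hγk := hγ_pos _ (hδ_pos k)
    have hτk := hτ_pos _ (hδ_pos k)
    have hEk : E k ≤ c₁ * γ (δ k) := (div_le_iff₀ hγk).1 (hc₁ (mem_range_self k))
    have hτγk : τ (δ k) ≤ B₂ * γ (δ k) := (div_le_iff₀ hγk).1 (hB₂ _ (hδ_pos k))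
    have h3 := mul_le_mul_of_nonneg_right hτγk (sq_nonneg ‖ζ₁‖)
    have h4 := hD_nonneg (T (Metamorphosis.registered ι I₀ (v (δ k)) (ζ (δ k)))) (g + e (δ k))
    have h5 : 0 ≤ τ (δ k) / 2 * ‖ζ (δ k)‖ ^ 2 := by positivity
    refine le_of_mul_le_mul_left ?_ hγk
    linarith [hobj k]
  have hS : ∀ k, ‖ζ (δ k)‖ ≤ √(‖ζ₁‖ ^ 2 + B₁ * ‖v₁‖ ^ 2 + 2 * c₂) := by
    intro k
    refine Real.le_sqrt_of_sq_le ?_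
    have hγk := hγ_pos _ (hδ_pos k)
    have hτk := hτ_pos _ (hδ_pos k)
    have hEk : E k ≤ c₂ * τ (δ k) := (div_le_iff₀ hτk).1 (hc₂ (mem_range_self k))
    have hγτk : γ (δ k) ≤ B₁ * τ (δ k) := (div_le_iff₀ hτk).1 (hB₁ _ (hδ_pos k))
    have h3 := mul_le_mul_of_nonneg_right hγτk (sq_nonneg ‖v₁‖)
    have h4 := hD_nonneg (T (Metamorphosis.registered ι I₀ (v (δ k)) (ζ (δ k)))) (g + e (δ k))
    have h5 : 0 ≤ γ (δ k) / 2 * ‖v (δ k)‖ ^ 2 := by positivity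
    refine le_of_mul_le_mul_left ?_ hτk
    linarith [hobj k]
  have hDlim : Tendsto (fun k => D (T (Metamorphosis.registered ι I₀ (v (δ k)) (ζ (δ k))))
      (g + e (δ k))) atTop (𝓝 0) := by
    refine squeeze_zero (fun k => hD_nonneg _ _)
      (g := fun k => γ (δ k) / 2 * ‖v₁‖ ^ 2 + τ (δ k) / 2 * ‖ζ₁‖ ^ 2 + E k) (fun k => ?_) ?_
    · have hγk := hγ_pos _ (hδ_pos k)
      have hτk := hτ_pos _ (hδ_pos k)
      have h5 : 0 ≤ γ (δ k) / 2 * ‖v (δ k)‖ ^ 2 := by positivity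
      have h6 : 0 ≤ τ (δ k) / 2 * ‖ζ (δ k)‖ ^ 2 := by positivity
      linarith [hobj k]
    · simpa using ((((hγ.comp hδ').div_const 2).mul_const (‖v₁‖ ^ 2)).add
        (((hτ.comp hδ').div_const 2).mul_const (‖ζ₁‖ ^ 2))).add hElim
  obtain ⟨n₁, hn₁, vStar, hv⟩ := Metamorphosis.exists_subseq_weaklyTendsto hR
  obtain ⟨n₂, hn₂, ζStar, hζ⟩ :=
    Metamorphosis.exists_subseq_weaklyTendsto (fun k => hS (n₁ k))
  -- A third extraction is needed beyond the weak limits of `v` and `ζ`, because the Jacobians are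
  -- shown to converge almost everywhere only along a subsequence.
  obtain ⟨n₃, hn₃, hW⟩ := hC.exists_subseq_weaklyTendsto_registered hV.injective
    hΩ_open.measurableSet hΩ_bdd hV.eq_zero_of_notMem I₀ (fun k => hR (n₁ (n₂ k)))
    (fun k => hS (n₁ (n₂ k))) (hv.comp_tendsto hn₂.tendsto_atTop) hζ
  have hn : StrictMono fun k => n₁ (n₂ (n₃ k)) := hn₁.comp (hn₂.comp hn₃)
  refine ⟨fun k => n₁ (n₂ (n₃ k)), hn, vStar, ζStar,
    hv.comp_tendsto (hn₂.comp hn₃).tendsto_atTop, hζ.comp_tendsto hn₃.tendsto_atTop, ?_⟩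
  exact Metamorphosis.WeaklyTendsto.tendsto_discrepancy_eq hD_nonneg hD_definite hD_lsc
    (hT _ _ hW) (hdata.comp hn.tendsto_atTop) (hDlim.comp hn.tendsto_atTop)
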